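/- There are a randomised algorithm and an absolute constant $C$ such that the following holds. Let $G$ be a finite undirected graph with $n\ge 2$ vertices and $m$ edges, not necessarily simple (parallel edges and loops are allowed; a loop counts twice in the degree of its vertex and, like every edge, has two directions), in which every vertex has degree at least $3$, stored as an adjacency list in which the edges at each vertex are arbitrarily ordered. Let $0<\varepsilon<1$ be rational, given as $\varepsilon=a/b$ with positive integers $a<b$. Let $Z$ be the number of sink-free orientations of $G$, i.e. of the ways to direct every edge so that every vertex has at least one outgoing edge. Then, on input $(G,a,b)$, the algorithm always halts within $C\,(n/\varepsilon)^2\log(n/\varepsilon)$ steps, and with probability at least $3/4$ it outputs a number $\widetilde Z$ with $$(1-\varepsilon)\,Z\le\widetilde Z\le(1+\varepsilon)\,Z .$$ Here an algorithm is a program for a random access machine whose unit-cost instructions are loading and storing words, $+$, truncated $-$, $\times$, integer division, tests, and tossing a fair coin. All words that occur are non-negative integers of at most $(n+m+b)^{C}$, and $\widetilde Z$ is output in binary floating point, as $M\cdot 2^{e-e'}$ with three words $M,e,e'$. -/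

import Mathlib

/-! ## Multigraphs, orientations, sink-free orientations -/

namespace SFO

/-- An undirected graph with vertex type `V` and edge type `E`; parallel edges and loops are
allowed.  `ends e false` and `ends e true` are the two end vertices of the edge `e`
(in an arbitrary order). -/
structure Multigraph (V E : Type) where
  ends : E → Bool → V

namespace Multigraph

variable {V E : Type}

/-- An orientation chooses a direction for each edge: under `σ : E → Bool` the edge `e` is
directed from `ends e (σ e)` to `ends e (!(σ e))`.  This is the vertex the edge points away from. -/
def tail (G : Multigraph V E) (σ : E → Bool) (e : E) : V := G.ends e (σ e)

/-- The vertex the edge points to. -/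
def head (G : Multigraph V E) (σ : E → Bool) (e : E) : V := G.ends e (!(σ e))

/-- The orientation `σ` is sink-free: every vertex has at least one outgoing edge. -/
def IsSinkFree (G : Multigraph V E) (σ : E → Bool) : Prop :=
  ∀ v : V, ∃ e : E, G.tail σ e = v

/-- The number of sink-free orientations (for a finite graph). -/
noncomputable def numSinkFree (G : Multigraph V E) : ℕ :=
  Nat.card {σ : E → Bool // G.IsSinkFree σ}

/-- The degree of `v`: the number of edge ends at `v` (so a loop counts twice). -/
noncomputable def degree (G : Multigraph V E) (v : V) : ℕ :=
  Nat.card {d : E × Bool // G.ends d.1 d.2 = v}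

end Multigraph

/-! ## Adjacency lists and the input words -/

/-- An adjacency list of a graph with vertices `0, …, n - 1` and edges `0, …, m - 1`: for each
vertex, the edge ends at that vertex, each once, in an arbitrary order. -/
structure AdjList {n m : ℕ} (G : Multigraph (Fin n) (Fin m)) where
  list : Fin n → List (Fin m × Bool)
  nodup : ∀ v, (list v).Nodup
  mem_iff : ∀ v d, d ∈ list v ↔ G.ends d.1 d.2 = v

namespace AdjList

variable {n m : ℕ} {G : Multigraph (Fin n) (Fin m)}

/-- The address in the input at which the list of vertex `v` starts; for `v = n` the address
just after the last list. -/
def start (L : AdjList G) (v : ℕ) : ℕ :=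
  (n + 4) + ∑ u : Fin n with u.val < v, 2 * (L.list u).length

/-- The input words: the number `n` of vertices, the accuracy as a numerator `a` and
a denominator `b`, then `n + 1` pointers (the list of vertex `v` occupies the addresses from
`start v` up to `start (v + 1)`, exclusive), then the adjacency lists one after the other; each
entry of the list of `v` consists of two words, the neighbour of `v` along an edge and the number
of that edge. -/
def encode (L : AdjList G) (a b : ℕ) : List ℕ :=
  [n, a, b] ++ (List.range (n + 1)).map L.start ++
    (List.finRange n).flatMap fun v =>
      (L.list v).flatMap fun d => [(G.ends d.1 (!d.2)).val, d.1.val]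

end AdjList

/-! ## A randomised random access machine with unit-cost instructions -/

/-- The contents of the registers and of the memory. -/
structure Store where
  reg : ℕ → ℕ
  mem : ℕ → ℕ

namespace Store

/-- Initially all registers and memory cells hold `0`. -/
def zero : Store := ⟨fun _ => 0, fun _ => 0⟩

/-- Write the value `x` to register `d`. -/
def setReg (s : Store) (d x : ℕ) : Store := { s with reg := Function.update s.reg d x }

/-- Write the value `x` to the memory cell with address `i`. -/
def setMem (s : Store) (i x : ℕ) : Store := { s with mem := Function.update s.mem i x }

/-- All words in the registers and in the memory are at most `W`. -/
def BoundedBy (s : Store) (W : ℕ) : Prop := (∀ i, s.reg i ≤ W) ∧ ∀ i, s.mem i ≤ W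

/-- The output of the machine, a binary floating point number: mantissa in register `0`,
exponent the difference of the contents of registers `1` and `2`. -/
noncomputable def output (s : Store) : ℝ := (s.reg 0 : ℝ) * 2 ^ (s.reg 1) / 2 ^ (s.reg 2)

end Store

/-- Elementary instructions; `d s t` are names of registers, `r[d]` is the content of `d`. -/
inductive Instr where
  /-- `r[d] := c` for a fixed number `c`. -/
  | const (d c : ℕ)
  /-- `r[d] := r[s] + r[t]`. -/
  | add (d s t : ℕ)
  /-- `r[d] := max (r[s] - r[t]) 0`. -/
  | sub (d s t : ℕ)
  /-- `r[d] := r[s] * r[t]`. -/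
  | mul (d s t : ℕ)
  /-- `r[d] := ⌊r[s] / r[t]⌋` (and `0` if `r[t] = 0`). -/
  | div (d s t : ℕ)
  /-- `r[d] :=` the content of the memory cell with address `r[s]`. -/
  | load (d s : ℕ)
  /-- The memory cell with address `r[d]` receives the value `r[s]`. -/
  | store (d s : ℕ)
  /-- `r[d] :=` the input word with address `r[s]` (and `0` beyond the end of the input). -/
  | read (d s : ℕ)
  /-- `r[d] :=` a fair random bit, independent of everything so far. -/
  | flip (d : ℕ)

/-- The effect of an instruction on the store, on the input `x`. -/
noncomputable def Instr.exec (x : List ℕ) : Instr → Store → PMF Store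
  | .const d c, σ => PMF.pure (σ.setReg d c)
  | .add d s t, σ => PMF.pure (σ.setReg d (σ.reg s + σ.reg t))
  | .sub d s t, σ => PMF.pure (σ.setReg d (σ.reg s - σ.reg t))
  | .mul d s t, σ => PMF.pure (σ.setReg d (σ.reg s * σ.reg t))
  | .div d s t, σ => PMF.pure (σ.setReg d (σ.reg s / σ.reg t))
  | .load d s, σ => PMF.pure (σ.setReg d (σ.mem (σ.reg s)))
  | .store d s, σ => PMF.pure (σ.setMem (σ.reg d) (σ.reg s))
  | .read d s, σ => PMF.pure (σ.setReg d (x.getD (σ.reg s) 0))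
  | .flip d, σ => (PMF.uniformOfFintype Bool).map fun c => σ.setReg d c.toNat

/-- Programs: finite texts built from instructions by sequencing, branching and loops. -/
inductive Program where
  /-- A single instruction. -/
  | instr (i : Instr)
  /-- First `p`, then `q`. -/
  | seq (p q : Program)
  /-- `p` if `r[s] ≠ 0`, otherwise `q`. -/
  | branch (s : ℕ) (p q : Program)
  /-- Repeat `p` as long as `r[s] ≠ 0`. -/
  | loop (s : ℕ) (p : Program)

/-- A configuration: what remains to be executed, and the store.  The machine has halted when
nothing remains to be executed. -/
structure Config where
  todo : List Program
  store : Store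

/-- One step of the machine on the input `x`: one instruction, one test, or the unfolding of one
sequential composition.  A configuration that has halted does not change any more. -/
noncomputable def Config.step (x : List ℕ) : Config → PMF Config
  | ⟨[], σ⟩ => PMF.pure ⟨[], σ⟩
  | ⟨.instr i :: k, σ⟩ => (i.exec x σ).map fun τ => ⟨k, τ⟩
  | ⟨.seq p q :: k, σ⟩ => PMF.pure ⟨p :: q :: k, σ⟩
  | ⟨.branch s p q :: k, σ⟩ => PMF.pure ⟨(if σ.reg s ≠ 0 then p else q) :: k, σ⟩
  | ⟨.loop s p :: k, σ⟩ => PMF.pure ⟨if σ.reg s ≠ 0 then p :: .loop s p :: k else k, σ⟩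

/-- The distribution of the configuration after `t` steps from the configuration `c`. -/
noncomputable def Config.run (x : List ℕ) : ℕ → Config → PMF Config
  | 0, c => PMF.pure c
  | t + 1, c => (c.step x).bind (Config.run x t)

/-- The distribution of the configuration of the machine with program `P` on the input `x`
after `t` steps. -/
noncomputable def Program.runFor (P : Program) (x : List ℕ) (t : ℕ) : PMF Config :=
  Config.run x t ⟨[P], Store.zero⟩

/-- Whatever the random bits are, `P` halts on the input `x` within `T` steps. -/
def Program.HaltsWithin (P : Program) (x : List ℕ) (T : ℕ) : Prop :=
  ∀ c ∈ (P.runFor x T).support, c.todo = []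

/-- Whatever the random bits are, no word that occurs while `P` runs on `x` exceeds `W`. -/
def Program.WordsBoundedBy (P : Program) (x : List ℕ) (W : ℕ) : Prop :=
  ∀ t, ∀ c ∈ (P.runFor x t).support, c.store.BoundedBy W

/-- The probability that `P`, on the input `x`, has halted after `T` steps with an output
in the set `A`. -/
noncomputable def Program.probOutput (P : Program) (x : List ℕ) (T : ℕ) (A : Set ℝ) : ENNReal :=
  (P.runFor x T).toOuterMeasure {c | c.todo = [] ∧ c.store.output ∈ A}

/-- `y` is an `ε`-approximation of `z`, for `z > 0`: the ratio `y / z` lies between `1 - ε` and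
`1 + ε`. -/
def IsApprox (ε z y : ℝ) : Prop := (1 - ε) * z ≤ y ∧ y ≤ (1 + ε) * z

end SFO

namespace SFO

/-! ## Running configurations: halting, word size and success probability -/

/-! Let `stageProb G i` be the probability, for a uniformly random orientation, that vertex `i` is
not a sink given that no earlier vertex is one. These probabilities telescope to `Z / 2 ^ m`
(`prod_stageProb`). The program estimates each of them by the frequency of success in `N = 64 * n *
k ^ 2` trials, where `k = b / a + 1` lies between `1 / ε` and `2 / ε`, and multiplies the
frequencies.

The trials come from sink popping. A run reveals the directions of edges by fair coins, only when
they are looked at, and settles the vertices in order. A vertex is settled when its scan meets an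
outgoing edge. If it proves to be a sink, its edges are forgotten and its settled neighbours go back
on a stack. Throughout, the orientation is uniform among those in which no settled vertex is a sink.
The reason is `sum_noSinkInto_append`: an edge known to point from `u` into the sink `v` already
satisfies the demand at `u`, so redrawing that edge and dropping the demand at `u` turns a uniform
orientation into a uniform one. Hence the first test of each stage is a Bernoulli trial with
parameter `stageProb G i`, independent of the past.

Counting with the same identity gives the local lemma `card_noSinkInto_le`: the first `j` edges at
an unsettled vertex all point inwards with probability at most `(5 / 8) ^ j`. So `stageProb` is at
least `1 / 2`, a scan looks at boundedly many edges on average, and a sink of degree `d`, which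
costs `O(d)` steps and unsettles at most `d` vertices, is rare. Since `(d + 1) * (5 / 8) ^ d < 1`
for `d ≥ 3`, the number of vertices left to settle drifts downwards, and a run takes `O(n)` expected
steps, whatever `m` is.

The expected squared relative error of the product is a martingale (`errorSq_harmonic`) that starts
at most at `2 * n / N`. `sum_noSinkIn_eagerValue_le` bounds, in one induction, the expected final
error plus a charge per step; Markov's inequality then gives success with probability `3 / 4` within
`1600 * n * N` steps (`three_quarters_le_lazyValue`).

The machine follows this chain step by step (`Represents.sampleStep`) and multiplies the frequencies
in floating point (`ProductApprox.next`). The total is `O((n / ε) ^ 2)` steps; of the logarithm in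
the time bound only a positive lower bound is used. -/

theorem Config.run_succ (x : List ℕ) (t : ℕ) (c : Config) :
    Config.run x (t + 1) c = (c.step x).bind (Config.run x t) := rfl

theorem Config.run_succ' (x : List ℕ) (t : ℕ) (c : Config) :
    Config.run x (t + 1) c = (Config.run x t c).bind (Config.step x) := by
  induction t generalizing c with
  | zero =>
    rw [Config.run_succ]
    show (c.step x).bind PMF.pure = (PMF.pure c).bind _
    rw [PMF.bind_pure, PMF.pure_bind]
  | succ t ih =>
    rw [Config.run_succ, Config.run_succ, PMF.bind_bind]
    congr 1
    funext d
    exact ih d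

theorem Config.step_of_todo_nil (x : List ℕ) (c : Config) (h : c.todo = []) :
    c.step x = PMF.pure c := by
  cases c with
  | mk k σ => subst h; rfl

theorem Config.run_succ_of_halted {x : List ℕ} {t : ℕ} {c : Config}
    (h : ∀ d ∈ (Config.run x t c).support, d.todo = []) :
    Config.run x (t + 1) c = Config.run x t c := by
  rw [Config.run_succ']
  ext d
  rw [PMF.bind_apply]
  have : ∀ a, Config.run x t c a * Config.step x a d = Config.run x t c a * PMF.pure a d := by
    intro a
    by_cases ha : a ∈ (Config.run x t c).support
    · rw [Config.step_of_todo_nil x a (h a ha)]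
    · rw [PMF.mem_support_iff, not_not] at ha
      rw [ha, zero_mul, zero_mul]
  simp_rw [this]
  rw [← PMF.bind_apply (Config.run x t c) PMF.pure, PMF.bind_pure]

/-- From the configuration `c` the machine halts within `T` steps, all words stay at most `W`,
and the output lies in `A` with probability at least `q`. -/
structure Config.Good (x : List ℕ) (A : Set ℝ) (W T : ℕ) (q : ℝ) (c : Config) : Prop where
  halts : ∀ d ∈ (Config.run x T c).support, d.todo = []
  bounded : ∀ t, ∀ d ∈ (Config.run x t c).support, d.store.BoundedBy W
  prob : ENNReal.ofReal q ≤
    (Config.run x T c).toOuterMeasure {d | d.todo = [] ∧ d.store.output ∈ A}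

namespace Config.Good

variable {x : List ℕ} {A : Set ℝ} {W T : ℕ} {q : ℝ}

theorem succ {c : Config} (h : c.Good x A W T q) : c.Good x A W (T + 1) q := by
  refine ⟨?_, h.bounded, ?_⟩ <;> rw [Config.run_succ_of_halted h.halts]
  exacts [h.halts, h.prob]

theorem mono {c : Config} {T' : ℕ} (h : c.Good x A W T q) (hT : T ≤ T') :
    c.Good x A W T' q := by
  induction hT with
  | refl => exact h
  | step _ ih => exact ih.succ

theorem mono_prob {c : Config} {q' : ℝ} (h : c.Good x A W T q) (hq : q' ≤ q) :
    c.Good x A W T q' :=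
  ⟨h.halts, h.bounded, (ENNReal.ofReal_le_ofReal hq).trans h.prob⟩

/-- The alternative `q ≤ 0` is for final states with a worthless output: they still have to respect
the word bound but claim no probability. -/
theorem of_halted {σ : Store} (hσ : σ.BoundedBy W) (hq : q ≤ 0 ∨ (q ≤ 1 ∧ σ.output ∈ A)) :
    Config.Good x A W 0 q ⟨[], σ⟩ := by
  have hrun : ∀ t, Config.run x t ⟨[], σ⟩ = PMF.pure ⟨[], σ⟩ := by
    intro t
    induction t with
    | zero => rfl
    | succ t ih => rw [Config.run_succ', ih, PMF.pure_bind]; rfl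
  refine ⟨?_, ?_, ?_⟩
  · intro d hd
    rw [hrun, PMF.support_pure, Set.mem_singleton_iff] at hd
    rw [hd]
  · intro t d hd
    rw [hrun, PMF.support_pure, Set.mem_singleton_iff] at hd
    rw [hd]; exact hσ
  · rw [hrun, PMF.toOuterMeasure_pure_apply]
    rcases hq with hq | ⟨hq, hA⟩
    · rw [ENNReal.ofReal_of_nonpos hq]; exact zero_le
    · rw [if_pos ⟨rfl, hA⟩]
      exact ENNReal.ofReal_le_one.2 hq

theorem of_step {c d : Config} (hs : c.step x = PMF.pure d) (hc : c.store.BoundedBy W)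
    (h : d.Good x A W T q) : c.Good x A W (T + 1) q := by
  have hrun : ∀ t, Config.run x (t + 1) c = Config.run x t d := by
    intro t; rw [Config.run_succ, hs, PMF.pure_bind]
  refine ⟨?_, ?_, ?_⟩
  · rw [hrun]; exact h.halts
  · intro t e he
    cases t with
    | zero =>
      have : e = c := by simpa [Config.run] using he
      rw [this]; exact hc
    | succ t => rw [hrun] at he; exact h.bounded t e he
  · rw [hrun]; exact h.prob

theorem of_flip {r : ℕ} {k : List Program} {σ : Store} {q' : ℝ} (hσ : σ.BoundedBy W)
    (hq : 0 ≤ q) (hq' : 0 ≤ q')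
    (h1 : Config.Good x A W T q ⟨k, σ.setReg r 1⟩)
    (h0 : Config.Good x A W T q' ⟨k, σ.setReg r 0⟩) :
    Config.Good x A W (T + 1) ((q + q') / 2) ⟨.instr (.flip r) :: k, σ⟩ := by
  have hstep : Config.step x ⟨.instr (.flip r) :: k, σ⟩ =
      (PMF.uniformOfFintype Bool).bind
        fun c => PMF.pure ⟨k, σ.setReg r c.toNat⟩ := by
    show (((PMF.uniformOfFintype Bool).map fun c => σ.setReg r c.toNat).map fun τ => _) = _
    rw [PMF.map_comp]; rfl
  have hrun : ∀ t, Config.run x (t + 1) ⟨.instr (.flip r) :: k, σ⟩ =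
      (PMF.uniformOfFintype Bool).bind
        fun c => Config.run x t ⟨k, σ.setReg r c.toNat⟩ := by
    intro t
    rw [Config.run_succ, hstep, PMF.bind_bind]
    simp_rw [PMF.pure_bind]
  refine ⟨?_, ?_, ?_⟩
  · intro d hd
    rw [hrun, PMF.mem_support_bind_iff] at hd
    obtain ⟨c, -, hc⟩ := hd
    cases c
    · exact h0.halts d hc
    · exact h1.halts d hc
  · intro t d hd
    cases t with
    | zero =>
      have : d = ⟨.instr (.flip r) :: k, σ⟩ := by simpa [Config.run] using hd
      rw [this]; exact hσ
    | succ t =>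
      rw [hrun, PMF.mem_support_bind_iff] at hd
      obtain ⟨c, -, hc⟩ := hd
      cases c
      · exact h0.bounded t d hc
      · exact h1.bounded t d hc
  · rw [hrun, PMF.toOuterMeasure_bind_apply, tsum_bool]
    simp only [PMF.uniformOfFintype_apply, Fintype.card_bool, Bool.toNat_false, Bool.toNat_true]
    have e : ENNReal.ofReal ((q + q') / 2) =
        ((2 : ℕ) : ENNReal)⁻¹ * ENNReal.ofReal q' + ((2 : ℕ) : ENNReal)⁻¹ * ENNReal.ofReal q := by
      rw [div_eq_mul_inv, mul_comm, ENNReal.ofReal_mul (by norm_num), ENNReal.ofReal_add hq hq',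
        ← mul_add, add_comm (ENNReal.ofReal q')]
      congr 1
      rw [ENNReal.ofReal_inv_of_pos (by norm_num)]
      norm_num
    rw [e]
    gcongr
    · exact h0.prob
    · exact h1.prob

end Config.Good

/-! ## Straight-line programs -/

/-- The effect of an instruction other than a coin toss. -/
def Instr.eval (x : List ℕ) : Instr → Store → Store
  | .const d c, σ => σ.setReg d c
  | .add d s t, σ => σ.setReg d (σ.reg s + σ.reg t)
  | .sub d s t, σ => σ.setReg d (σ.reg s - σ.reg t)
  | .mul d s t, σ => σ.setReg d (σ.reg s * σ.reg t)
  | .div d s t, σ => σ.setReg d (σ.reg s / σ.reg t)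
  | .load d s, σ => σ.setReg d (σ.mem (σ.reg s))
  | .store d s, σ => σ.setMem (σ.reg d) (σ.reg s)
  | .read d s, σ => σ.setReg d (x.getD (σ.reg s) 0)
  | .flip _, σ => σ

/-- The instruction is not a coin toss and its constant is at most `K`. -/
def Instr.Det (K : ℕ) : Instr → Prop
  | .const _ c => c ≤ K
  | .flip _ => False
  | _ => True

namespace Program

/-- The effect of a program without loops and coin tosses. -/
def eval (x : List ℕ) : Program → Store → Store
  | .instr i, σ => i.eval x σ
  | .seq p q, σ => q.eval x (p.eval x σ)
  | .branch s p q, σ => if σ.reg s ≠ 0 then p.eval x σ else q.eval x σ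
  | .loop _ _, σ => σ

/-- The program has no loops and no coin tosses and its constants are at most `K`. -/
def Det (K : ℕ) : Program → Prop
  | .instr i => i.Det K
  | .seq p q => p.Det K ∧ q.Det K
  | .branch _ p q => p.Det K ∧ q.Det K
  | .loop _ _ => False

/-- A bound for the number of steps of a program without loops. -/
def cost : Program → ℕ
  | .instr _ => 1
  | .seq p q => 1 + p.cost + q.cost
  | .branch _ p q => 1 + max p.cost q.cost
  | .loop _ _ => 0

end Program

theorem Store.BoundedBy.mono {σ : Store} {W W' : ℕ} (h : σ.BoundedBy W) (hW : W ≤ W') :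
    σ.BoundedBy W' :=
  ⟨fun i => (h.1 i).trans hW, fun i => (h.2 i).trans hW⟩

theorem Store.BoundedBy.setReg {σ : Store} {W d y : ℕ} (h : σ.BoundedBy W) (hy : y ≤ W) :
    (σ.setReg d y).BoundedBy W := by
  refine ⟨fun i => ?_, h.2⟩
  show Function.update σ.reg d y i ≤ W
  rw [Function.update_apply]
  split_ifs
  exacts [hy, h.1 i]

theorem Store.BoundedBy.setMem {σ : Store} {W d y : ℕ} (h : σ.BoundedBy W) (hy : y ≤ W) :
    (σ.setMem d y).BoundedBy W := by
  refine ⟨h.1, fun i => ?_⟩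
  show Function.update σ.mem d y i ≤ W
  rw [Function.update_apply]
  split_ifs
  exacts [hy, h.2 i]

theorem Instr.eval_boundedBy {x : List ℕ} {K B : ℕ} {i : Instr} {σ : Store} (hi : i.Det K)
    (hK : K ≤ B) (hB : 2 ≤ B) (hx : ∀ a, x.getD a 0 ≤ B) (hσ : σ.BoundedBy B) :
    (i.eval x σ).BoundedBy (B ^ 2) := by
  have hBB : B ≤ B ^ 2 := by nlinarith
  have hσ' := hσ.mono hBB
  cases i with
  | const d c => exact hσ'.setReg ((show c ≤ K from hi).trans (hK.trans hBB))
  | add d s t =>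
    have h1 := hσ.1 s
    have h2 := hσ.1 t
    exact hσ'.setReg (by nlinarith)
  | sub d s t => exact hσ'.setReg (((Nat.sub_le _ _).trans (hσ.1 s)).trans hBB)
  | mul d s t =>
    refine hσ'.setReg ?_
    rw [sq]
    exact Nat.mul_le_mul (hσ.1 s) (hσ.1 t)
  | div d s t => exact hσ'.setReg (((Nat.div_le_self _ _).trans (hσ.1 s)).trans hBB)
  | load d s => exact hσ'.setReg (hσ'.2 _)
  | store d s => exact hσ'.setMem (hσ'.1 _)
  | read d s => exact hσ'.setReg ((hx _).trans hBB)
  | flip d => exact hσ'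

theorem Instr.exec_eq_pure {x : List ℕ} {K : ℕ} {i : Instr} (hi : i.Det K) (σ : Store) :
    i.exec x σ = PMF.pure (i.eval x σ) := by
  cases i <;> first | rfl | exact hi.elim

/-- One instruction at most squares the word bound, multiplication being the worst case, so a
loop-free text of cost `c` raises it to the power `2 ^ c`. The bound is polynomial because `c` does
not depend on the input. -/
theorem Program.eval_boundedBy {x : List ℕ} {K : ℕ} {p : Program} (hp : p.Det K) :
    ∀ {B : ℕ} {σ : Store}, K ≤ B → 2 ≤ B → (∀ a, x.getD a 0 ≤ B) → σ.BoundedBy B →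
      (p.eval x σ).BoundedBy (B ^ 2 ^ p.cost) := by
  induction p with
  | instr i => exact fun hK hB hx hσ => Instr.eval_boundedBy hp hK hB hx hσ
  | seq p q ihp ihq =>
    intro B σ hK hB hx hσ
    have hB' : B ≤ B ^ 2 ^ p.cost := Nat.le_self_pow (by positivity) B
    have := ihq hp.2 (hK.trans hB') (hB.trans hB') (fun a => (hx a).trans hB')
      (ihp hp.1 hK hB hx hσ)
    refine this.mono ?_
    rw [← pow_mul, ← pow_add]
    exact Nat.pow_le_pow_right (by omega)
      (Nat.pow_le_pow_right (by omega) (by simp only [Program.cost]; omega))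
  | branch s p q ihp ihq =>
    intro B σ hK hB hx hσ
    simp only [Program.eval]
    split_ifs
    · refine (ihp hp.1 hK hB hx hσ).mono (Nat.pow_le_pow_right (by omega)
        (Nat.pow_le_pow_right (by omega) (by simp only [Program.cost]; omega)))
    · refine (ihq hp.2 hK hB hx hσ).mono (Nat.pow_le_pow_right (by omega)
        (Nat.pow_le_pow_right (by omega) (by simp only [Program.cost]; omega)))
  | loop s p => exact hp.elim

/-- Goodness is propagated backwards: from the configuration after a deterministic piece of program
to the one before it. This form lets a whole program be verified from its end. -/
theorem Config.Good.of_eval {x : List ℕ} {A : Set ℝ} {W : ℕ} {q : ℝ} {K : ℕ} {p : Program}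
    (hp : p.Det K) : ∀ {B T : ℕ} {k : List Program} {σ : Store}, K ≤ B → 2 ≤ B →
      (∀ a, x.getD a 0 ≤ B) → σ.BoundedBy B → B ^ 2 ^ p.cost ≤ W →
      Config.Good x A W T q ⟨k, p.eval x σ⟩ →
      Config.Good x A W (T + p.cost) q ⟨p :: k, σ⟩ := by
  induction p with
  | instr i =>
    intro B T k σ hK hB hx hσ hW h
    refine Config.Good.of_step ?_ (hσ.mono ((Nat.le_self_pow (by positivity) B).trans hW)) h
    show (i.exec x σ).map _ = _
    rw [Instr.exec_eq_pure hp, PMF.pure_map]; rfl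
  | seq p q ihp ihq =>
    intro B T k σ hK hB hx hσ hW h
    have hB' : B ≤ B ^ 2 ^ p.cost := Nat.le_self_pow (by positivity) B
    have hBW : B ≤ W := (Nat.le_self_pow (by positivity) B).trans hW
    have hq := ihq (T := T) (k := k) hp.2 (hK.trans hB') (hB.trans hB')
      (fun a => (hx a).trans hB') (Program.eval_boundedBy hp.1 hK hB hx hσ) (by
        refine le_trans ?_ hW
        rw [← pow_mul, ← pow_add]
        exact Nat.pow_le_pow_right (by omega)
          (Nat.pow_le_pow_right (by omega) (by simp only [Program.cost]; omega))) h
    have hp' := ihp hp.1 hK hB hx hσ (le_trans (Nat.pow_le_pow_right (by omega)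
          (Nat.pow_le_pow_right (by omega) (by simp only [Program.cost]; omega))) hW) hq
    have : Config.Good x A W (T + q.cost + p.cost + 1) _ ⟨.seq p q :: k, σ⟩ :=
      Config.Good.of_step rfl (hσ.mono hBW) hp'
    exact this.mono (by simp only [Program.cost]; omega)
  | branch s p q ihp ihq =>
    intro B T k σ hK hB hx hσ hW h
    have hBW : B ≤ W := (Nat.le_self_pow (by positivity) B).trans hW
    simp only [Program.eval] at h
    by_cases hs : σ.reg s ≠ 0
    · rw [if_pos hs] at h
      have hp' := ihp hp.1 hK hB hx hσ (le_trans (Nat.pow_le_pow_right (by omega)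
          (Nat.pow_le_pow_right (by omega) (by simp only [Program.cost]; omega))) hW) h
      have : Config.Good x A W (T + p.cost + 1) _ ⟨.branch s p q :: k, σ⟩ :=
        Config.Good.of_step (d := ⟨p :: k, σ⟩)
          (by simp only [Config.step]; rw [if_pos hs]) (hσ.mono hBW) hp'
      exact this.mono (by simp only [Program.cost]; omega)
    · rw [if_neg hs] at h
      have hp' := ihq hp.2 hK hB hx hσ (le_trans (Nat.pow_le_pow_right (by omega)
          (Nat.pow_le_pow_right (by omega) (by simp only [Program.cost]; omega))) hW) h
      have : Config.Good x A W (T + q.cost + 1) _ ⟨.branch s p q :: k, σ⟩ :=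
        Config.Good.of_step (d := ⟨q :: k, σ⟩)
          (by simp only [Config.step]; rw [if_neg hs]) (hσ.mono hBW) hp'
      exact this.mono (by simp only [Program.cost]; omega)
  | loop s p => exact hp.elim

open Finset

/-! ## Orientations without sinks in a given set of vertices -/

namespace Multigraph

variable {n m : ℕ} (G : Multigraph (Fin n) (Fin m))

open Classical in
/-- The orientations in which no vertex of `S` is a sink. -/
noncomputable def noSinkIn (S : Finset (Fin n)) : Finset (Fin m → Bool) :=
  univ.filter fun σ => ∀ u ∈ S, ∃ e, G.tail σ e = u

open Classical in
/-- The orientations in which no vertex of `S` is a sink and no edge from the list `l` is directed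
away from `v`. -/
noncomputable def noSinkInto (S : Finset (Fin n)) (v : Fin n) (l : List (Fin m × Bool)) :
    Finset (Fin m → Bool) :=
  univ.filter fun σ => (∀ u ∈ S, ∃ e, G.tail σ e = u) ∧ ∀ d ∈ l, G.tail σ d.1 ≠ v

variable {G}

theorem mem_noSinkIn {S : Finset (Fin n)} {σ : Fin m → Bool} :
    σ ∈ G.noSinkIn S ↔ ∀ u ∈ S, ∃ e, G.tail σ e = u := by
  simp [noSinkIn]

theorem mem_noSinkInto {S : Finset (Fin n)} {v : Fin n} {l : List (Fin m × Bool)}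
    {σ : Fin m → Bool} :
    σ ∈ G.noSinkInto S v l ↔
      (∀ u ∈ S, ∃ e, G.tail σ e = u) ∧ ∀ d ∈ l, G.tail σ d.1 ≠ v := by
  simp [noSinkInto]

theorem noSinkInto_nil (S : Finset (Fin n)) (v : Fin n) :
    G.noSinkInto S v [] = G.noSinkIn S := by
  ext σ; simp [mem_noSinkIn, mem_noSinkInto]

theorem noSinkIn_empty : G.noSinkIn ∅ = univ := by
  ext σ; simp [mem_noSinkIn]

theorem card_noSinkIn_univ : (G.noSinkIn univ).card = G.numSinkFree := by
  classical
  rw [numSinkFree, Nat.card_eq_fintype_card, Fintype.card_subtype, noSinkIn]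
  congr 1
  ext σ
  rw [mem_filter, mem_filter]
  exact and_congr_right fun _ => ⟨fun h v => h v (mem_univ v), fun h v _ => h v⟩

/-- The two updated orientations are `σ` and `σ` with `e` flipped, and flipping is an involution. -/
theorem sum_update_bool (e : Fin m) (h : (Fin m → Bool) → ℝ) :
    ∑ σ, (h (Function.update σ e true) + h (Function.update σ e false)) = 2 * ∑ σ, h σ := by
  have hinv : Function.Involutive fun σ : Fin m → Bool => Function.update σ e (!σ e) := by
    intro σ; simp
  have h1 : ∑ σ, h (Function.update σ e (!σ e)) = ∑ σ, h σ :=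
    Equiv.sum_comp hinv.toPerm h
  rw [two_mul]
  nth_rw 2 [← h1]
  rw [← sum_add_distrib]
  refine sum_congr rfl fun σ _ => ?_
  cases hσ : σ e
  · have : Function.update σ e false = σ := by rw [← hσ, Function.update_eq_self]
    rw [this, Bool.not_false, add_comm]
  · have : Function.update σ e true = σ := by rw [← hσ, Function.update_eq_self]
    rw [this, Bool.not_true]

theorem tail_update_of_ne {σ : Fin m → Bool} {e e' : Fin m} (h : e' ≠ e) (c : Bool) :
    G.tail (Function.update σ e c) e' = G.tail σ e' := by
  simp [tail, h]

/-! ### Peeling the last edge off a list of edges that point inwards -/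

section Peel

variable {S : Finset (Fin n)} {v u : Fin n} {l : List (Fin m × Bool)} {e : Fin m} {b : Bool}

/-- Neither end of `e` is under a demand: `v` is not in `S`, and `u` has been erased. So the
direction of `e` is irrelevant. -/
theorem update_mem_noSinkInto (hv : v ∉ S) (hb : G.ends e b = v) (hu : G.ends e (!b) = u)
    (he : ∀ d ∈ l, d.1 ≠ e) (σ : Fin m → Bool) (c : Bool) :
    Function.update σ e c ∈ G.noSinkInto (S.erase u) v l ↔ σ ∈ G.noSinkInto (S.erase u) v l := by
  rw [mem_noSinkInto, mem_noSinkInto]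
  have key : ∀ τ : Fin m → Bool, ∀ w ∈ S.erase u, G.tail τ e ≠ w := by
    intro τ w hw h
    rw [mem_erase] at hw
    rcases Bool.eq_or_eq_not (τ e) b with h' | h'
    · rw [tail, h', hb] at h; exact hv (h ▸ hw.2)
    · rw [tail, h', hu] at h; exact hw.1 h.symm
  refine and_congr (forall₂_congr fun w hw => exists_congr fun e' => ?_)
    (forall₂_congr fun d hd => ?_)
  · by_cases h : e' = e
    · subst h
      exact ⟨fun h => (key _ w hw h).elim, fun h => (key _ w hw h).elim⟩
    · rw [tail_update_of_ne h]
  · rw [tail_update_of_ne (he d hd)]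

/-- An edge that does not leave `v` leaves `u`, which takes care of the demand at `u`. -/
theorem mem_noSinkInto_append (hb : G.ends e b = v) (hu : G.ends e (!b) = u)
    (huv : u ≠ v) (σ : Fin m → Bool) :
    σ ∈ G.noSinkInto S v (l ++ [(e, b)]) ↔
      σ ∈ G.noSinkInto (S.erase u) v l ∧ σ e = !b := by
  rw [mem_noSinkInto, mem_noSinkInto]
  have h1 : G.tail σ e ≠ v ↔ σ e = !b := by
    rcases Bool.eq_or_eq_not (σ e) b with h | h
    · rw [tail, h, hb]; simp
    · rw [tail, h, hu]; simp [huv]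
  constructor
  · rintro ⟨h, h'⟩
    refine ⟨⟨fun w hw => h w (mem_of_mem_erase hw), fun d hd => h' d (by simp [hd])⟩, ?_⟩
    exact h1.1 (h' (e, b) (by simp))
  · rintro ⟨⟨h, h'⟩, h2⟩
    refine ⟨fun w hw => ?_, fun d hd => ?_⟩
    · by_cases hwu : w = u
      · exact ⟨e, by rw [tail, h2, hu, hwu]⟩
      · exact h w (mem_erase.2 ⟨hwu, hw⟩)
    · rcases List.mem_append.1 hd with hd | hd
      · exact h' d hd
      · rw [List.mem_singleton.1 hd]; exact h1.2 h2

/-- This identity carries both halves of the argument. With `f = 1` it is the recursion behind the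
local lemma. With `f` the value of the sampler it says that redrawing `e` and unsettling `u`
preserves uniformity. -/
theorem sum_noSinkInto_append (hv : v ∉ S) (hb : G.ends e b = v) (hu : G.ends e (!b) = u)
    (huv : u ≠ v) (he : ∀ d ∈ l, d.1 ≠ e) (f : (Fin m → Bool) → ℝ) :
    ∑ σ ∈ G.noSinkInto S v (l ++ [(e, b)]),
      (f (Function.update σ e true) + f (Function.update σ e false)) =
      ∑ σ ∈ G.noSinkInto (S.erase u) v l, f σ := by
  classical
  set X := G.noSinkInto (S.erase u) v l with hX
  have hL : ∑ σ ∈ G.noSinkInto S v (l ++ [(e, b)]),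
      (f (Function.update σ e true) + f (Function.update σ e false)) =
      ∑ σ, if σ ∈ X ∧ σ e = !b then
        (f (Function.update σ e true) + f (Function.update σ e false)) else 0 := by
    rw [← sum_filter]
    refine sum_congr ?_ fun _ _ => rfl
    ext σ
    rw [mem_noSinkInto_append hb hu huv]; simp [hX]
  have hR : ∑ σ ∈ X, f σ = ∑ σ, if σ ∈ X then f σ else 0 := by
    rw [← sum_filter]; simp
  rw [hL, hR]
  have h2 : (2 : ℝ) ≠ 0 := two_ne_zero
  apply mul_left_cancel₀ h2
  -- Both sums are grouped into pairs that differ only at `e`; within a pair membership in `X` is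
  -- constant and exactly one member satisfies `σ e = !b`.
  rw [← sum_update_bool e, ← sum_update_bool e]
  refine sum_congr rfl fun σ _ => ?_
  simp only [hX, update_mem_noSinkInto hv hb hu he, Function.update_self,
    Function.update_idem]
  by_cases h : σ ∈ G.noSinkInto (S.erase u) v l
  · cases b <;> simp [h]
  · simp [h]

theorem two_mul_card_noSinkInto_append (hv : v ∉ S) (hb : G.ends e b = v)
    (hu : G.ends e (!b) = u) (huv : u ≠ v) (he : ∀ d ∈ l, d.1 ≠ e) :
    2 * ((G.noSinkInto S v (l ++ [(e, b)])).card : ℝ) =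
      ((G.noSinkInto (S.erase u) v l).card : ℝ) := by
  have := sum_noSinkInto_append hv hb hu huv he (fun _ => (1 : ℝ))
  simp only [sum_const, nsmul_eq_mul, mul_one] at this
  rw [← this]; ring

/-- A loop leaves its vertex in either direction, so a vertex with a loop is never a sink. -/
theorem noSinkInto_append_loop (hb : G.ends e b = v) (hu : G.ends e (!b) = v) :
    G.noSinkInto S v (l ++ [(e, b)]) = ∅ := by
  rw [eq_empty_iff_forall_notMem]
  intro σ hσ
  have h := (mem_noSinkInto.1 hσ).2 (e, b) (by simp)
  rcases Bool.eq_or_eq_not (σ e) b with h' | h'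
  · exact h (by rw [tail, h', hb])
  · exact h (by rw [tail, h', hu])

end Peel

end Multigraph

/-! ### The local lemma: an unsettled vertex is rarely a sink -/

namespace AdjList

open Multigraph

variable {n m : ℕ} {G : Multigraph (Fin n) (Fin m)} (L : AdjList G)

theorem ends_of_mem {v : Fin n} {d : Fin m × Bool} (h : d ∈ L.list v) : G.ends d.1 d.2 = v :=
  (L.mem_iff v d).1 h

theorem length_list (v : Fin n) : (L.list v).length = G.degree v := by
  classical
  rw [degree, Nat.card_eq_fintype_card, Fintype.card_subtype,
    ← List.toFinset_card_of_nodup (L.nodup v)]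
  congr 1
  ext d
  simp [L.mem_iff]

theorem sum_noSinkIn (S : Finset (Fin n)) (v : Fin n) (f : (Fin m → Bool) → ℝ) :
    ∑ σ ∈ G.noSinkIn S, f σ =
      ∑ σ ∈ G.noSinkIn (insert v S), f σ + ∑ σ ∈ G.noSinkInto S v (L.list v), f σ := by
  classical
  rw [← sum_filter_add_sum_filter_not (G.noSinkIn S) (fun σ => ∃ e, G.tail σ e = v)]
  congr 1
  · refine sum_congr ?_ fun _ _ => rfl
    ext σ
    simp only [mem_filter, mem_noSinkIn, mem_insert, forall_eq_or_imp]
    tauto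
  · refine sum_congr ?_ fun _ _ => rfl
    ext σ
    simp only [mem_filter, mem_noSinkIn, mem_noSinkInto]
    refine and_congr_right fun _ => ⟨fun h d _ h' => h ⟨_, h'⟩, ?_⟩
    rintro h ⟨e, he⟩
    exact h (e, σ e) ((L.mem_iff v _).2 he) he

theorem card_noSinkIn_insert (S : Finset (Fin n)) (v : Fin n) :
    ((G.noSinkIn S).card : ℝ) =
      (G.noSinkIn (insert v S)).card + (G.noSinkInto S v (L.list v)).card := by
  simpa using L.sum_noSinkIn S v (fun _ => 1)

/-- An edge occurs twice in the list of one vertex only if it is a loop; parallel edges have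
different numbers. -/
theorem ne_of_prefix {v : Fin n} {l : List (Fin m × Bool)} {e : Fin m} {b : Bool}
    (hl : l ++ [(e, b)] <+: L.list v) (huv : G.ends e (!b) ≠ v) : ∀ d ∈ l, d.1 ≠ e := by
  rintro ⟨e', b'⟩ hd h
  obtain rfl : e' = e := h
  have hnd : (l ++ [(e', b)]).Nodup := (L.nodup v).sublist hl.sublist
  have hmem : (e', b') ∈ L.list v := hl.subset (by simp [hd])
  rcases Bool.eq_or_eq_not b' b with rfl | rfl
  · exact (List.nodup_append.1 hnd).2.2 _ hd _ (by simp) rfl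
  · exact huv (L.ends_of_mem hmem)

/-- Returning a vertex with a neighbour outside `S` to `S` costs at most a factor `4 / 5`. -/
def Ratio (G : Multigraph (Fin n) (Fin m)) (S : Finset (Fin n)) : Prop :=
  ∀ e b, G.ends e b ∈ S → G.ends e (!b) ∉ S.erase (G.ends e b) →
    ((G.noSinkIn (S.erase (G.ends e b))).card : ℝ) ≤ 5 / 4 * (G.noSinkIn S).card

/-- Peeling an edge to `u` gives a factor `1 / 2` for its direction and a factor `5 / 4` for
returning `u` to `S`, together `5 / 8`. The ratio at `u` is available because the other end `v` lies
outside `S`. If `u` is not in `S`, nothing is returned and one factor `5 / 4` is saved: this is the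
`4 / 5` in the second claim. -/
theorem card_noSinkInto_le_of_ratio {v : Fin n} {l : List (Fin m × Bool)}
    (hl : l <+: L.list v) : ∀ {S : Finset (Fin n)}, v ∉ S → (∀ S' ⊆ S, Ratio G S') →
    ((G.noSinkInto S v l).card : ℝ) ≤ (5 / 8) ^ l.length * (G.noSinkIn S).card ∧
    ((∃ d ∈ l, G.ends d.1 (!d.2) ∉ S) →
      ((G.noSinkInto S v l).card : ℝ) ≤
        (5 / 8) ^ l.length * (4 / 5) * (G.noSinkIn S).card) := by
  induction l using List.reverseRecOn with
  | nil =>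
    intro S hv hS
    simp [noSinkInto_nil]
  | append_singleton l d ih =>
    intro S hv hS
    obtain ⟨e, b⟩ := d
    have hmem : (e, b) ∈ L.list v := hl.subset (by simp)
    have hb : G.ends e b = v := L.ends_of_mem hmem
    by_cases huv : G.ends e (!b) = v
    · rw [noSinkInto_append_loop hb huv]
      constructor
      · simp; positivity
      · intro _; simp; positivity
    have hl' : l <+: L.list v := (List.prefix_append l _).trans hl
    have hne := L.ne_of_prefix hl huv
    set u := G.ends e (!b) with hu
    have hcard := two_mul_card_noSinkInto_append hv hb hu.symm huv hne
    obtain ⟨ih1, ih2⟩ := ih hl' (S := S.erase u) (fun h => hv (mem_of_mem_erase h))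
      (fun S' h => hS S' (h.trans (erase_subset _ _)))
    rw [List.length_append, List.length_singleton, pow_succ]
    have hpos : (0 : ℝ) ≤ (5 / 8) ^ l.length := by positivity
    by_cases huS : u ∈ S
    · have hr := hS S subset_rfl e (!b) huS (by
        rw [Bool.not_not, hb]; exact fun h => hv (mem_of_mem_erase h))
      rw [← hu] at hr
      constructor
      · nlinarith [mul_le_mul_of_nonneg_left hr hpos]
      · rintro ⟨d, hd, hdS⟩
        have hd' : d ∈ l := by
          rcases List.mem_append.1 hd with h | h
          · exact h
          · rw [List.mem_singleton.1 h] at hdS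
            exact (hdS huS).elim
        have := ih2 ⟨d, hd', fun h => hdS (mem_of_mem_erase h)⟩
        nlinarith [mul_le_mul_of_nonneg_left hr hpos]
    · rw [erase_eq_of_notMem huS] at ih1 hcard
      have h0 : (0 : ℝ) ≤ (5 / 8) ^ l.length * (G.noSinkIn S).card := by positivity
      constructor
      · nlinarith
      · intro _; nlinarith

/-- Given the other demands, `u` is a sink with probability at most `(5 / 8) ^ 3 * (4 / 5) = 25 /
128 < 1 / 5`. Without the saved factor from the neighbour outside, `(5 / 8) ^ 3` would exceed `1 /
5` and the induction would not close. The bound at `u` uses only ratios for subsets of `S.erase u`,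
hence strong induction. -/
theorem ratio (hdeg : ∀ v, 3 ≤ (L.list v).length)
    (S : Finset (Fin n)) : Ratio G S := by
  induction S using Finset.strongInduction with
  | H S ih =>
    intro e b hu hv
    set u := G.ends e b with hu'
    have h1 := (L.card_noSinkInto_le_of_ratio (List.prefix_refl (L.list u))
      (notMem_erase u S) (fun S' h => ih S' (lt_of_le_of_lt h (erase_ssubset hu)))).2
      ⟨(e, b), (L.mem_iff u _).2 hu'.symm, hv⟩
    have h2 := L.card_noSinkIn_insert (S.erase u) u
    rw [insert_erase hu] at h2
    have h3 : ((5 : ℝ) / 8) ^ (L.list u).length ≤ (5 / 8) ^ 3 :=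
      pow_le_pow_of_le_one (by norm_num) (by norm_num) (hdeg u)
    have h4 : (0 : ℝ) ≤ ((G.noSinkIn (S.erase u)).card : ℝ) := by positivity
    have h5 := mul_le_mul_of_nonneg_right h3 h4
    nlinarith

/-- The local lemma for sinks. -/
theorem card_noSinkInto_le (hdeg : ∀ v, 3 ≤ (L.list v).length)
    {v : Fin n} {l : List (Fin m × Bool)} (hl : l <+: L.list v)
    {S : Finset (Fin n)} (hv : v ∉ S) :
    ((G.noSinkInto S v l).card : ℝ) ≤ (5 / 8) ^ l.length * (G.noSinkIn S).card :=
  (L.card_noSinkInto_le_of_ratio hl hv fun S' _ => L.ratio hdeg S').1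

theorem card_noSinkIn_insert_ge (hdeg : ∀ v, 3 ≤ (L.list v).length)
    {S : Finset (Fin n)} {v : Fin n} (hv : v ∉ S) :
    1 / 2 * ((G.noSinkIn S).card : ℝ) ≤ (G.noSinkIn (insert v S)).card := by
  have h1 := L.card_noSinkInto_le hdeg (List.prefix_refl (L.list v)) hv
  have h2 := L.card_noSinkIn_insert S v
  have h3 : ((5 : ℝ) / 8) ^ (L.list v).length ≤ (5 / 8) ^ 3 :=
    pow_le_pow_of_le_one (by norm_num) (by norm_num) (hdeg v)
  have h5 := mul_le_mul_of_nonneg_right h3 (Nat.cast_nonneg (α := ℝ) (G.noSinkIn S).card)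
  have h4 : (0 : ℝ) ≤ ((G.noSinkIn S).card : ℝ) := by positivity
  nlinarith

theorem card_noSinkIn_pos (hdeg : ∀ v, 3 ≤ (L.list v).length)
    (S : Finset (Fin n)) : 0 < ((G.noSinkIn S).card : ℝ) := by
  induction S using Finset.induction_on with
  | empty => rw [noSinkIn_empty]; simp
  | insert v S hv ih => linarith [L.card_noSinkIn_insert_ge hdeg hv]

end AdjList

/-! ## The sampler as a Markov chain -/

/-- The control state of the sampler.  The vertices that are known not to be sinks are those up to
`stage` other than `cur` that are not on the stack `st`. -/
@[ext]
structure Ctl (n : ℕ) where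
  /-- The number of runs that remain, including the current one. -/
  runs : ℕ
  /-- The vertex whose probability of not being a sink is being sampled. -/
  stage : Fin n
  /-- The vertex whose adjacency list is scanned or reset. -/
  cur : Fin n
  /-- The vertices that have to be scanned later. -/
  st : List (Fin n)
  /-- Whether no sink has been met since the stage began. -/
  first : Bool
  /-- Whether the edges at `cur` are being reset. -/
  reset : Bool
  /-- The position in the adjacency list of `cur`. -/
  pos : ℕ
  /-- The number of successes of each vertex. -/
  cnt : Fin n → ℕ

namespace Ctl

variable {n : ℕ} [NeZero n]

/-- The counts after a success. -/
def bump (s : Ctl n) : Fin n → ℕ :=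
  Function.update s.cnt s.stage (s.cnt s.stage + s.first.toNat)

/-- A success in this state completes the run. -/
def EndsRun (s : Ctl n) : Prop := s.st = [] ∧ ¬ s.stage.val + 1 < n

instance (s : Ctl n) : Decidable s.EndsRun := inferInstanceAs (Decidable (_ ∧ _))

/-- The state after an edge directed away from `cur` has been found. -/
def succ (s : Ctl n) : Ctl n :=
  match s.st with
  | u :: l => ⟨s.runs, s.stage, u, l, s.first, false, 0, s.bump⟩
  | [] =>
    if h : s.stage.val + 1 < n then
      ⟨s.runs, ⟨s.stage.val + 1, h⟩, ⟨s.stage.val + 1, h⟩, [], true, false, 0, s.bump⟩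
    else ⟨s.runs - 1, 0, 0, [], true, false, 0, s.bump⟩

/-- The stack after an edge between `cur` and `u` has been reset. -/
def push (s : Ctl n) (u : Fin n) : List (Fin n) :=
  if u ≤ s.stage ∧ u ∉ s.st then u :: s.st else s.st

/-- The state after `cur` has turned out to be a sink. -/
def sink (s : Ctl n) : Ctl n := { s with reset := true, first := false }

/-- The state after the edge at position `j` with neighbour `u` has been reset. -/
def back (s : Ctl n) (u : Fin n) (j : ℕ) : Ctl n := { s with st := s.push u, pos := j }

end Ctl

section Chain

variable {n m : ℕ} [NeZero n] {G : Multigraph (Fin n) (Fin m)} (L : AdjList G)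

/-- One step of the sampler; `π` holds the directions of the edges that have been revealed, `c` is
a random bit. -/
def lazyStep (s : Ctl n) (π : Fin m → Option Bool) (c : Bool) :
    Ctl n × (Fin m → Option Bool) :=
  if s.runs = 0 then (s, π)
  else if s.reset then
    if s.pos = 0 then ({ s with reset := false }, π)
    else
      match (L.list s.cur)[s.pos - 1]? with
      | none => (s, π)
      | some d => (s.back (G.ends d.1 (!d.2)) (s.pos - 1), Function.update π d.1 none)
  else
    match (L.list s.cur)[s.pos]? with
    | none => (s.sink, π)
    | some d =>
      -- A revealed direction overrides the coin. Otherwise the coin `true` selects `d.2`, that is,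
      -- directs the edge away from `cur`.
      if G.ends d.1 ((π d.1).getD (c == d.2)) = s.cur then
        (s.succ, if s.EndsRun then fun _ => none
          else Function.update π d.1 (some ((π d.1).getD (c == d.2))))
      else ({ s with pos := s.pos + 1 },
        Function.update π d.1 (some ((π d.1).getD (c == d.2))))

/-- The expectation, over `F` steps of the sampler, of `t` of the final control state plus `κ` for
every step that is not idle. -/
noncomputable def lazyValue (t : Ctl n → ℝ) (κ : ℝ) :
    ℕ → Ctl n → (Fin m → Option Bool) → ℝ
  | 0, s, _ => t s
  | F + 1, s, π => (if s.runs = 0 then 0 else κ) +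
      (lazyValue t κ F (lazyStep L s π true).1 (lazyStep L s π true).2 +
        lazyValue t κ F (lazyStep L s π false).1 (lazyStep L s π false).2) / 2

/-- The average of a function over all orientations. -/
noncomputable def avg (f : (Fin m → Bool) → ℝ) : ℝ := (∑ σ, f σ) / 2 ^ m

/-- The analogue of `lazyValue` when all directions are drawn in advance. -/
noncomputable def eagerValue (t : Ctl n → ℝ) (κ : ℝ) : ℕ → Ctl n → (Fin m → Bool) → ℝ
  | 0, s, _ => t s
  | F + 1, s, σ =>
    if s.runs = 0 then eagerValue t κ F s σ
    else κ +
      if s.reset then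
        if s.pos = 0 then eagerValue t κ F { s with reset := false } σ
        else
          match (L.list s.cur)[s.pos - 1]? with
          | none => eagerValue t κ F s σ
          | some d =>
            (eagerValue t κ F (s.back (G.ends d.1 (!d.2)) (s.pos - 1))
                (Function.update σ d.1 true) +
              eagerValue t κ F (s.back (G.ends d.1 (!d.2)) (s.pos - 1))
                (Function.update σ d.1 false)) / 2
      else
        match (L.list s.cur)[s.pos]? with
        | none => eagerValue t κ F s.sink σ
        | some d =>
          if G.tail σ d.1 = s.cur then
            -- The next run starts from an independent uniform orientation.
            if s.EndsRun then avg (eagerValue t κ F s.succ) else eagerValue t κ F s.succ σ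
          else eagerValue t κ F { s with pos := s.pos + 1 } σ

/-- The orientation `σ` with the revealed directions `π` put in. -/
def complete (π : Fin m → Option Bool) (σ : Fin m → Bool) : Fin m → Bool :=
  fun e => (π e).getD (σ e)

theorem complete_none (σ : Fin m → Bool) : complete (fun _ => none) σ = σ := rfl

theorem avg_const (a : ℝ) : avg (fun _ : Fin m → Bool => a) = a := by
  simp [avg]

theorem avg_const_add (a : ℝ) (f : (Fin m → Bool) → ℝ) :
    avg (fun σ => a + f σ) = a + avg f := by
  conv_rhs => rw [← avg_const (m := m) a]
  simp only [avg]
  rw [← add_div, sum_add_distrib]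

theorem avg_update (e : Fin m) (f : (Fin m → Bool) → ℝ) :
    avg f = (avg (fun σ => f (Function.update σ e true)) +
      avg (fun σ => f (Function.update σ e false))) / 2 := by
  simp only [avg]
  rw [← add_div, ← sum_add_distrib, Multigraph.sum_update_bool]
  ring

theorem complete_reveal {π : Fin m → Option Bool} {e : Fin m} (h : π e = none)
    (σ : Fin m → Bool) (c : Bool) :
    complete π (Function.update σ e c) = complete (Function.update π e (some c)) σ := by
  funext e'
  by_cases h' : e' = e
  · subst h'; simp [complete, h]
  · simp [complete, h']

theorem complete_reset (π : Fin m → Option Bool) (e : Fin m) (σ : Fin m → Bool) (c : Bool) :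
    complete (Function.update π e none) (Function.update σ e c) =
      Function.update (complete π σ) e c := by
  funext e'
  by_cases h' : e' = e
  · subst h'; simp [complete]
  · simp [complete, h']

theorem avg_reveal {π : Fin m → Option Bool} {e : Fin m} (h : π e = none) (b : Bool)
    (f : (Fin m → Bool) → ℝ) :
    avg (fun σ => f (complete π σ)) =
      (avg (fun σ => f (complete (Function.update π e (some (true == b))) σ)) +
        avg (fun σ => f (complete (Function.update π e (some (false == b))) σ))) / 2 := by
  rw [avg_update e]
  simp only [complete_reveal h]
  cases b
  · rw [add_comm]; rfl
  · rfl

theorem avg_reset (π : Fin m → Option Bool) (e : Fin m) (f : (Fin m → Bool) → ℝ) :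
    avg (fun σ => f (complete (Function.update π e none) σ)) =
      avg (fun σ => (f (Function.update (complete π σ) e true) +
        f (Function.update (complete π σ) e false)) / 2) := by
  rw [avg_update e]
  simp only [complete_reset]
  simp only [avg]
  rw [← add_div, ← sum_add_distrib, ← sum_div]
  ring

/-- Deferred decisions: the unrevealed edges are independent fair coins. Revealing one splits the
average into two halves (`avg_reveal`), and forgetting one amounts to redrawing it (`avg_reset`). -/
theorem lazyValue_eq_avg (t : Ctl n → ℝ) (κ : ℝ) (F : ℕ) : ∀ (s : Ctl n)
    (π : Fin m → Option Bool),
    lazyValue L t κ F s π = avg fun σ => eagerValue L t κ F s (complete π σ) := by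
  induction F with
  | zero => intro s π; exact (avg_const _).symm
  | succ F ih =>
    intro s π
    simp only [lazyValue, ih]
    simp only [eagerValue]
    by_cases hr : s.runs = 0
    · simp [lazyStep, hr]
    simp only [if_neg hr]
    rw [avg_const_add]
    congr 1
    by_cases hs : s.reset
    · simp only [lazyStep, if_neg hr, if_pos hs]
      by_cases hp : s.pos = 0
      · simp only [if_pos hp]; ring
      simp only [if_neg hp]
      cases hd : (L.list s.cur)[s.pos - 1]? with
      | none => simp only []; ring
      | some d =>
        simp only []
        rw [avg_reset π d.1]
        ring
    · simp only [lazyStep, if_neg hr, if_neg hs]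
      cases hd : (L.list s.cur)[s.pos]? with
      | none => simp only []; ring
      | some d =>
        simp only []
        have key : ∀ (π' : Fin m → Option Bool) (b : Bool), π' d.1 = some b →
            (fun σ => if G.tail (complete π' σ) d.1 = s.cur then
              if s.EndsRun then avg (eagerValue L t κ F s.succ)
                else eagerValue L t κ F s.succ (complete π' σ)
              else eagerValue L t κ F { s with pos := s.pos + 1 } (complete π' σ)) =
            fun σ => if G.ends d.1 b = s.cur then
              if s.EndsRun then avg (eagerValue L t κ F s.succ)
                else eagerValue L t κ F s.succ (complete π' σ)
              else eagerValue L t κ F { s with pos := s.pos + 1 } (complete π' σ) := by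
          intro π' b h
          funext σ
          have : G.tail (complete π' σ) d.1 = G.ends d.1 b := by
            simp [Multigraph.tail, complete, h]
          rw [this]
        have key2 : ∀ (π' : Fin m → Option Bool) (b : Bool), π' d.1 = some b →
            avg (fun σ => eagerValue L t κ F
              (if G.ends d.1 b = s.cur then
                (s.succ, if s.EndsRun then fun _ => none else π')
                else ({ s with pos := s.pos + 1 }, π')).1
              (complete (if G.ends d.1 b = s.cur then
                (s.succ, if s.EndsRun then fun _ => none else π')
                else ({ s with pos := s.pos + 1 }, π')).2 σ)) =
            avg (fun σ => if G.tail (complete π' σ) d.1 = s.cur then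
              if s.EndsRun then avg (eagerValue L t κ F s.succ)
                else eagerValue L t κ F s.succ (complete π' σ)
              else eagerValue L t κ F { s with pos := s.pos + 1 } (complete π' σ)) := by
          intro π' b h
          rw [key π' b h]
          by_cases h1 : G.ends d.1 b = s.cur
          · simp only [if_pos h1]
            by_cases h2 : s.EndsRun
            · simp only [if_pos h2, complete_none, avg_const]
            · simp only [if_neg h2]
          · simp only [if_neg h1]
        cases hπ : π d.1 with
        | some b =>
          have : Function.update π d.1 (some b) = π := by rw [← hπ, Function.update_eq_self]
          simp only [Option.getD_some, this]
          rw [key2 π b hπ]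
          ring
        | none =>
          simp only [Option.getD_none]
          rw [key2 _ (true == d.2) (by simp), key2 _ (false == d.2) (by simp)]
          exact (avg_reveal hπ d.2 (fun τ => if G.tail τ d.1 = s.cur then
              if s.EndsRun then avg (eagerValue L t κ F s.succ)
                else eagerValue L t κ F s.succ τ
              else eagerValue L t κ F { s with pos := s.pos + 1 } τ)).symm

end Chain

/-! ## Mean and second moment of the estimate -/

section Moments

/-- The expectation of `(c + X) / (N * p)` for a binomial `X` with parameters `r` and `p`. -/
noncomputable def moment₁ (N p r c : ℝ) : ℝ := (c + r * p) / (N * p)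

/-- The expectation of `((c + X) / (N * p)) ^ 2` for a binomial `X` with parameters `r`, `p`. -/
noncomputable def moment₂ (N p r c : ℝ) : ℝ :=
  ((c + r * p) ^ 2 + r * (p * (1 - p))) / (N * p) ^ 2

/-- Conditioning on the next of the `r` trials. The identity is polynomial in `r` and `c`, so it
needs no binomial distribution. -/
theorem moment₁_harmonic (N p r c : ℝ) :
    p * moment₁ N p (r - 1) (c + 1) + (1 - p) * moment₁ N p (r - 1) c = moment₁ N p r c := by
  simp only [moment₁]; ring

theorem moment₂_harmonic (N p r c : ℝ) :
    p * moment₂ N p (r - 1) (c + 1) + (1 - p) * moment₂ N p (r - 1) c = moment₂ N p r c := by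
  simp only [moment₂]; ring

theorem moment₁_sq_le {N p r c : ℝ} (hp : 0 ≤ p) (hp' : p ≤ 1) (hr : 0 ≤ r) :
    moment₁ N p r c ^ 2 ≤ moment₂ N p r c := by
  rw [moment₁, moment₂, div_pow]
  have : 0 ≤ r * (p * (1 - p)) := mul_nonneg hr (mul_nonneg hp (by linarith))
  gcongr
  linarith

variable {n : ℕ}

/-- The expectation of the squared relative error when the vertex `i` has had `c i` successes and
`r i` trials remain. -/
noncomputable def errorSq (N : ℝ) (p r c : Fin n → ℝ) : ℝ :=
  ∏ i, moment₂ N (p i) (r i) (c i) - 2 * ∏ i, moment₁ N (p i) (r i) (c i) + 1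

/-- Only the factor at `i` changes, and both products are linear in it, so harmonicity of the single
moments suffices. -/
theorem errorSq_harmonic (N : ℝ) (p r c : Fin n → ℝ) (i : Fin n) :
    p i * errorSq N p (Function.update r i (r i - 1)) (Function.update c i (c i + 1)) +
      (1 - p i) * errorSq N p (Function.update r i (r i - 1)) c = errorSq N p r c := by
  have hprod : ∀ (f : ℝ → ℝ → ℝ → ℝ) (r' c' : Fin n → ℝ),
      (∀ j, j ≠ i → r' j = r j) → (∀ j, j ≠ i → c' j = c j) →
      ∏ j, f (p j) (r' j) (c' j) =
        f (p i) (r' i) (c' i) * ∏ j ∈ univ.erase i, f (p j) (r j) (c j) := by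
    intro f r' c' hr hc
    rw [← mul_prod_erase univ _ (mem_univ i)]
    congr 1
    refine prod_congr rfl fun j hj => ?_
    rw [hr j (ne_of_mem_erase hj), hc j (ne_of_mem_erase hj)]
  have hu : ∀ (g : Fin n → ℝ) (a : ℝ) (j : Fin n), j ≠ i → Function.update g i a j = g j :=
    fun g a j hj => Function.update_of_ne hj _ _
  simp only [errorSq]
  rw [hprod (moment₂ N) _ _ (hu r _) (hu c _), hprod (moment₁ N) _ _ (hu r _) (hu c _),
    hprod (moment₂ N) _ c (hu r _) (fun _ _ => rfl),
    hprod (moment₁ N) _ c (hu r _) (fun _ _ => rfl),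
    hprod (moment₂ N) r c (fun _ _ => rfl) (fun _ _ => rfl),
    hprod (moment₁ N) r c (fun _ _ => rfl) (fun _ _ => rfl)]
  simp only [Function.update_self]
  rw [← moment₁_harmonic N (p i) (r i) (c i), ← moment₂_harmonic N (p i) (r i) (c i)]
  ring

/-- With the second moment at least the square of the first, the expression is at least `(∏ moment₁
- 1) ^ 2`. -/
theorem errorSq_nonneg {N : ℝ} {p r c : Fin n → ℝ} (hp : ∀ i, 0 ≤ p i) (hp' : ∀ i, p i ≤ 1)
    (hr : ∀ i, 0 ≤ r i) : 0 ≤ errorSq N p r c := by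
  have : (∏ i, moment₁ N (p i) (r i) (c i)) ^ 2 ≤ ∏ i, moment₂ N (p i) (r i) (c i) := by
    rw [← prod_pow]
    exact prod_le_prod (fun _ _ => sq_nonneg _) fun i _ => moment₁_sq_le (hp i) (hp' i) (hr i)
  rw [errorSq]
  nlinarith [sq_nonneg (∏ i, moment₁ N (p i) (r i) (c i) - 1)]

theorem errorSq_zero (N : ℝ) (p c : Fin n → ℝ) :
    errorSq N p (fun _ => 0) c = (∏ i, c i / (N * p i) - 1) ^ 2 := by
  have h2 : ∏ i, moment₂ N (p i) 0 (c i) = (∏ i, c i / (N * p i)) ^ 2 := by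
    rw [← prod_pow]
    refine prod_congr rfl fun i _ => ?_
    simp [moment₂, div_pow]
  have h1 : ∏ i, moment₁ N (p i) 0 (c i) = ∏ i, c i / (N * p i) := by
    refine prod_congr rfl fun i _ => ?_
    simp [moment₁]
  rw [errorSq, h1, h2]; ring

/-- The estimate is unbiased, and each second moment is `1 + (1 - p) / (p * N) ≤ exp (1 / N)`
because `p ≥ 1 / 2`. For `n ≤ N` the product `exp (n / N)` is at most `1 + 2 * n / N`. -/
theorem errorSq_start_le {N : ℝ} {p : Fin n → ℝ} (hN : 0 < N) (hp : ∀ i, 1 / 2 ≤ p i)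
    (hp' : ∀ i, p i ≤ 1) (hnN : n ≤ N) :
    errorSq N p (fun _ => N) (fun _ => 0) ≤ 2 * (n / N) := by
  have h1 : ∏ i, moment₁ N (p i) N 0 = 1 := by
    refine prod_eq_one fun i _ => ?_
    have : 0 < p i := by linarith [hp i]
    rw [moment₁, zero_add, div_self (by positivity)]
  have h2 : ∏ i, moment₂ N (p i) N 0 ≤ Real.exp (n / N) := by
    calc ∏ i, moment₂ N (p i) N 0 ≤ ∏ _i : Fin n, Real.exp (1 / N) := by
          refine prod_le_prod (fun i _ => ?_) fun i _ => ?_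
          · have := moment₁_sq_le (N := N) (c := 0) (by linarith [hp i]) (hp' i) hN.le
            exact (sq_nonneg _).trans this
          · have hpi : 0 < p i := by linarith [hp i]
            have : moment₂ N (p i) N 0 = 1 + (1 - p i) / p i * (1 / N) := by
              rw [moment₂]; field_simp; ring
            rw [this]
            have h3 : (1 - p i) / p i ≤ 1 := by rw [div_le_one hpi]; linarith [hp i]
            have h4 : 0 < 1 / N := by positivity
            have h5 := Real.add_one_le_exp (1 / N)
            nlinarith
      _ = Real.exp (n / N) := by
          rw [prod_const, card_univ, Fintype.card_fin, ← Real.exp_nat_mul]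
          congr 1; ring
  have h3 : Real.exp (n / N) ≤ 1 + 2 * (n / N) := by
    have h0 : (0 : ℝ) ≤ n / N := by positivity
    have h1 : (n : ℝ) / N ≤ 1 := (div_le_one hN).2 hnN
    have := Real.abs_exp_sub_one_le (x := (n : ℝ) / N) (by rw [abs_of_nonneg h0]; exact h1)
    rw [abs_of_nonneg h0] at this
    linarith [(abs_le.1 this).2]
  rw [errorSq, h1]
  linarith

end Moments

/-! ## Potential of a control state -/

namespace Ctl

variable {n : ℕ}

/-- The number of trials of `i` that remain. -/
def rem (s : Ctl n) (i : Fin n) : ℝ :=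
  s.runs - if i < s.stage ∨ (i = s.stage ∧ s.first = false) then 1 else 0

/-- The vertices that are known not to be sinks. -/
def settled (s : Ctl n) : Finset (Fin n) :=
  univ.filter fun u => u ≤ s.stage ∧ u ∉ s.st ∧ u ≠ s.cur

/-- The number of vertices that have to be settled in this run or a later one. -/
def load (s : Ctl n) : ℝ :=
  if s.runs = 0 then 0 else s.st.length + (n - s.stage.val) + n * (s.runs - 1)

/-- The properties of the control state that hold throughout. -/
structure WF (s : Ctl n) : Prop where
  nodup : s.st.Nodup
  cur_notMem : s.cur ∉ s.st
  le_stage : ∀ u ∈ s.st, u ≤ s.stage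
  cur_le : s.cur ≤ s.stage
  st_nil : s.first = true → s.st = []
  cur_eq : s.first = true → s.cur = s.stage
  first_of_reset : s.reset = true → s.first = false
  stage_zero : s.runs = 0 → s.stage.val = 0
  first_true : s.runs = 0 → s.first = true

/-- The expected squared relative error. -/
noncomputable def error (N : ℝ) (p : Fin n → ℝ) (s : Ctl n) : ℝ :=
  errorSq N p s.rem fun i => s.cnt i

theorem WF.rem_nonneg {s : Ctl n} (h : s.WF) (i : Fin n) : 0 ≤ s.rem i := by
  rw [rem]
  by_cases hr : s.runs = 0
  · rw [if_neg]
    · simp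
    · rw [h.first_true hr]
      have := h.stage_zero hr
      simp [Fin.lt_def, this]
  · have : (1 : ℝ) ≤ s.runs := by exact_mod_cast Nat.one_le_iff_ne_zero.2 hr
    split_ifs <;> linarith

theorem load_nonneg (s : Ctl n) : 0 ≤ s.load := by
  rw [load]
  split_ifs with h
  · exact le_rfl
  · have h1 : (1 : ℝ) ≤ s.runs := by exact_mod_cast Nat.one_le_iff_ne_zero.2 h
    have h2 : (s.stage.val : ℝ) ≤ n := by exact_mod_cast s.stage.2.le
    have h3 : 0 ≤ (n : ℝ) * (s.runs - 1) := mul_nonneg (by positivity) (by linarith)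
    have h4 : (0 : ℝ) ≤ s.st.length := by positivity
    linarith

theorem error_of_done {N : ℝ} {p : Fin n → ℝ} {s : Ctl n} (h : s.WF) (hr : s.runs = 0) :
    s.error N p = (∏ i, (s.cnt i : ℝ) / (N * p i) - 1) ^ 2 := by
  rw [error, ← errorSq_zero]
  congr 1
  funext i
  rw [rem, h.first_true hr, hr]
  simp [Fin.lt_def, h.stage_zero hr]

theorem rem_sink (s : Ctl n) :
    s.sink.rem = if s.first then Function.update s.rem s.stage (s.rem s.stage - 1) else s.rem := by
  funext i
  cases hf : s.first
  · simp [rem, sink, hf]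
  · simp only [if_true, Function.update_apply]
    by_cases h : i = s.stage
    · simp [rem, sink, h, hf]
    · simp [rem, sink, h]

theorem mem_settled {s : Ctl n} {u : Fin n} :
    u ∈ s.settled ↔ u ≤ s.stage ∧ u ∉ s.st ∧ u ≠ s.cur := by
  simp [settled]

theorem bump_eq (s : Ctl n) : (fun i => (s.bump i : ℝ)) =
    if s.first then Function.update (fun i => (s.cnt i : ℝ)) s.stage (s.cnt s.stage + 1)
    else fun i => (s.cnt i : ℝ) := by
  funext i
  cases hf : s.first
  · simp [bump, hf]
  · simp only [bump, hf, if_true, Function.update_apply, Bool.toNat_true]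
    split_ifs <;> simp

theorem cur_notMem_settled (s : Ctl n) : s.cur ∉ s.settled := by simp [settled]

theorem wf_sink {s : Ctl n} (h : s.WF) (hr : s.runs ≠ 0) : s.sink.WF := by
  refine ⟨h.nodup, h.cur_notMem, h.le_stage, h.cur_le, ?_, ?_, ?_, h.stage_zero, ?_⟩
  · simp [sink]
  · simp [sink]
  · simp [sink]
  · intro h'; exact (hr h').elim

theorem wf_back {s : Ctl n} (h : s.WF) (hs : s.reset = true) {u : Fin n} (hu : u ≠ s.cur)
    (j : ℕ) : (s.back u j).WF := by
  have hf := h.first_of_reset hs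
  refine ⟨?_, ?_, ?_, h.cur_le, ?_, ?_, h.first_of_reset, h.stage_zero, h.first_true⟩
  · simp only [back, push]
    split_ifs with hp
    · exact List.nodup_cons.2 ⟨hp.2, h.nodup⟩
    · exact h.nodup
  · simp only [back, push]
    split_ifs with hp
    · rw [List.mem_cons, not_or]; exact ⟨hu.symm, h.cur_notMem⟩
    · exact h.cur_notMem
  · simp only [back, push]
    split_ifs with hp
    · intro w hw
      rcases List.mem_cons.1 hw with rfl | hw
      · exact hp.1
      · exact h.le_stage w hw
    · exact h.le_stage
  · simp [back, hf]
  · simp [back, hf]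

/-- If `u` is not pushed, it is above the stage or already on the stack; in both cases it was not
settled, and erasing it changes nothing. -/
theorem settled_back (s : Ctl n) (u : Fin n) (j : ℕ) :
    (s.back u j).settled = s.settled.erase u := by
  ext w
  have h1 : (s.back u j).st = s.push u := rfl
  have h2 : (s.back u j).stage = s.stage := rfl
  have h3 : (s.back u j).cur = s.cur := rfl
  rw [mem_erase, mem_settled, mem_settled, h1, h2, h3, push]
  by_cases hp : u ≤ s.stage ∧ u ∉ s.st
  · rw [if_pos hp, List.mem_cons]; tauto
  · rw [if_neg hp]
    by_cases hw : w = u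
    · subst hw; tauto
    · tauto

theorem load_back_le (s : Ctl n) (u : Fin n) (j : ℕ) : (s.back u j).load ≤ s.load + 1 := by
  have h : ((s.back u j).st.length : ℝ) ≤ s.st.length + 1 := by
    simp only [back, push]
    split_ifs
    · simp
    · simp
  simp only [load]
  have h1 : (s.back u j).runs = s.runs := rfl
  have h2 : (s.back u j).stage = s.stage := rfl
  rw [h1, h2]
  split_ifs
  · linarith
  · linarith

theorem succ_cases (s : Ctl n) :
    (∃ u l, s.st = u :: l) ∨ (s.st = [] ∧ s.stage.val + 1 < n) ∨ s.EndsRun := by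
  cases h : s.st with
  | nil =>
    by_cases h' : s.stage.val + 1 < n
    · exact Or.inr (Or.inl ⟨rfl, h'⟩)
    · exact Or.inr (Or.inr ⟨h, h'⟩)
  | cons u l => exact Or.inl ⟨u, l, rfl⟩

theorem WF.first_eq_false {s : Ctl n} (h : s.WF) {u : Fin n} {l : List (Fin n)}
    (hst : s.st = u :: l) : s.first = false := by
  cases hf : s.first
  · rfl
  · rw [h.st_nil hf] at hst; cases hst

variable [NeZero n]

theorem succ_cons {s : Ctl n} {u : Fin n} {l : List (Fin n)} (h : s.st = u :: l) :
    s.succ = ⟨s.runs, s.stage, u, l, s.first, false, 0, s.bump⟩ := by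
  rw [succ, h]

theorem succ_next {s : Ctl n} (h : s.st = []) (h' : s.stage.val + 1 < n) :
    s.succ = ⟨s.runs, ⟨s.stage.val + 1, h'⟩, ⟨s.stage.val + 1, h'⟩, [], true, false, 0,
      s.bump⟩ := by
  rw [succ, h]; exact dif_pos h'

theorem succ_of_endsRun {s : Ctl n} (h : s.EndsRun) :
    s.succ = ⟨s.runs - 1, 0, 0, [], true, false, 0, s.bump⟩ := by
  rw [succ, h.1]; exact dif_neg h.2

/-- A success uses up the trial exactly as a sink does. Passing to the next stage or run only
describes the same remaining numbers differently. -/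
theorem rem_succ {s : Ctl n} (h : s.WF) (hr : s.runs ≠ 0) : s.succ.rem =
    if s.first then Function.update s.rem s.stage (s.rem s.stage - 1) else s.rem := by
  rw [← rem_sink]
  funext i
  rcases s.succ_cases with ⟨u, l, hst⟩ | ⟨hst, hlt⟩ | he
  · rw [succ_cons hst]
    simp [rem, sink, h.first_eq_false hst]
  · rw [succ_next hst hlt]
    simp only [rem, sink]
    congr 1
    refine if_congr ?_ rfl rfl
    simp only [Fin.lt_def, Fin.ext_iff]
    constructor
    · intro h'; simp at h'; simp; omega
    · intro h'; simp at h'; simp; omega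
  · rw [succ_of_endsRun he]
    simp only [rem, sink]
    have h1 : ((s.runs - 1 : ℕ) : ℝ) = s.runs - 1 := by
      rw [Nat.cast_sub (Nat.one_le_iff_ne_zero.2 hr)]; simp
    have h2 : i < s.stage ∨ i = s.stage := by
      have := he.2
      have := i.2
      rw [Fin.lt_def, Fin.ext_iff]; omega
    have h3 : ¬ (i < (0 : Fin n)) := by rw [Fin.lt_def]; simp
    rw [if_neg (by simp [h3]), if_pos (by simpa using h2), h1]; simp

theorem load_succ {s : Ctl n} (hr : s.runs ≠ 0) : s.succ.load = s.load - 1 := by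
  rcases s.succ_cases with ⟨u, l, hst⟩ | ⟨hst, hlt⟩ | he
  · rw [succ_cons hst]
    simp only [load, if_neg hr, hst, List.length_cons]; push_cast; ring
  · rw [succ_next hst hlt]
    simp only [load, if_neg hr, hst]; push_cast; simp; ring
  · rw [succ_of_endsRun he]
    have h1 : ((s.runs - 1 : ℕ) : ℝ) = s.runs - 1 := by
      rw [Nat.cast_sub (Nat.one_le_iff_ne_zero.2 hr)]; simp
    have h2 : (n : ℝ) = s.stage.val + 1 := by
      have h3 := s.stage.2
      have h4 := he.2
      exact_mod_cast (by omega : n = s.stage.val + 1)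
    simp only [load, if_neg hr, he.1, h1]
    split_ifs with h0
    · have : (s.runs : ℝ) = 1 := by
        have : s.runs = 1 := by omega
        exact_mod_cast this
      simp [this, h2]
    · simp; rw [h2]; ring

theorem wf_succ {s : Ctl n} (h : s.WF) (hr : s.runs ≠ 0) : s.succ.WF := by
  rcases s.succ_cases with ⟨u, l, hst⟩ | ⟨hst, hlt⟩ | he
  · rw [succ_cons hst]
    have hf := h.first_eq_false hst
    have hnd := h.nodup
    have hle := h.le_stage
    rw [hst] at hnd hle
    rw [List.nodup_cons] at hnd
    exact ⟨hnd.2, hnd.1, fun w hw => hle w (by simp [hw]), hle u (by simp), by simp [hf],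
      by simp [hf], by simp, fun h' => (hr h').elim, fun h' => (hr h').elim⟩
  · rw [succ_next hst hlt]
    constructor <;> simp [hr]
  · rw [succ_of_endsRun he]
    constructor <;> simp

theorem settled_succ {s : Ctl n} (h : s.WF) (he : ¬ s.EndsRun) :
    s.succ.settled = insert s.cur s.settled := by
  ext w
  have hc := h.cur_le
  rcases s.succ_cases with ⟨u, l, hst⟩ | ⟨hst, hlt⟩ | he'
  · rw [mem_insert, mem_settled, mem_settled, succ_cons hst]
    have hnd := h.nodup
    have hcur := h.cur_notMem
    simp only [hst, List.nodup_cons, List.mem_cons, not_or] at hnd hcur ⊢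
    by_cases hw : w = s.cur
    · subst hw; tauto
    · tauto
  · rw [mem_insert, mem_settled, mem_settled, succ_next hst hlt, hst]
    simp only [List.not_mem_nil, not_false_iff, true_and, ne_eq, Fin.le_def, Fin.ext_iff] at hc ⊢
    omega
  · exact (he he').elim

theorem settled_succ_of_endsRun {s : Ctl n} (he : s.EndsRun) : s.succ.settled = ∅ := by
  rw [eq_empty_iff_forall_notMem]
  intro w
  rw [mem_settled, succ_of_endsRun he]
  simp only [List.not_mem_nil, not_false_iff, true_and, ne_eq, Fin.le_def, Fin.ext_iff]
  simp

theorem cnt_succ (s : Ctl n) : s.succ.cnt = s.bump := by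
  rw [succ]; split
  · rfl
  · split <;> rfl

theorem pos_succ (s : Ctl n) : s.succ.pos = 0 := by
  rw [succ]; split
  · rfl
  · split <;> rfl

theorem reset_succ (s : Ctl n) : s.succ.reset = false := by
  rw [succ]; split
  · rfl
  · split <;> rfl

/-- Only the first test of a stage is a trial. The tests after a sink merely repair the orientation
and leave counts and remaining trials alone. -/
theorem error_succ_sink (N : ℝ) (p : Fin n → ℝ) {s : Ctl n} (h : s.WF) (hr : s.runs ≠ 0) :
    (s.first = true → p s.stage * s.succ.error N p + (1 - p s.stage) * s.sink.error N p =
      s.error N p) ∧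
    (s.first = false → s.succ.error N p = s.error N p ∧ s.sink.error N p = s.error N p) := by
  have hs : s.sink.cnt = s.cnt := rfl
  constructor
  · intro hf
    simp only [error, rem_sink, rem_succ h hr, hf, if_true, cnt_succ, bump_eq, hs]
    exact errorSq_harmonic N p s.rem (fun i => (s.cnt i : ℝ)) s.stage
  · intro hf
    simp [error, rem_sink, rem_succ h hr, hf, cnt_succ, bump_eq, hs]

end Ctl

/-! ### Uniformity of the sampled orientation and drift of the potential -/

open Multigraph

section Potential

variable {n m : ℕ} {G : Multigraph (Fin n) (Fin m)} (L : AdjList G)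

/-- The probability that the vertex `i` is not a sink, given that no earlier vertex is. -/
noncomputable def stageProb (G : Multigraph (Fin n) (Fin m)) (i : Fin n) : ℝ :=
  (G.noSinkIn (insert i (univ.filter (· < i)))).card / (G.noSinkIn (univ.filter (· < i))).card

theorem settled_of_first {s : Ctl n} (h : s.WF) (hf : s.first = true) :
    s.settled = univ.filter (· < s.stage) := by
  ext w
  simp only [Ctl.mem_settled, mem_filter, mem_univ, true_and, h.st_nil hf, h.cur_eq hf,
    List.not_mem_nil, not_false_iff]
  rw [lt_iff_le_and_ne]

theorem stageProb_mul (hdeg : ∀ v, 3 ≤ (L.list v).length) (i : Fin n) :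
    stageProb G i * (G.noSinkIn (univ.filter (· < i))).card =
      (G.noSinkIn (insert i (univ.filter (· < i)))).card :=
  div_mul_cancel₀ _ (L.card_noSinkIn_pos hdeg _).ne'

theorem half_le_stageProb (hdeg : ∀ v, 3 ≤ (L.list v).length) (i : Fin n) :
    1 / 2 ≤ stageProb G i := by
  rw [stageProb, le_div_iff₀ (L.card_noSinkIn_pos hdeg _)]
  exact L.card_noSinkIn_insert_ge hdeg (by simp)

theorem stageProb_le_one (hdeg : ∀ v, 3 ≤ (L.list v).length) (i : Fin n) :
    stageProb G i ≤ 1 := by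
  have h := L.card_noSinkIn_insert (univ.filter (· < i)) i
  have h' : (0 : ℝ) ≤ (G.noSinkInto (univ.filter (· < i)) i (L.list i)).card := Nat.cast_nonneg _
  rw [stageProb, div_le_one (L.card_noSinkIn_pos hdeg _)]
  linarith

variable [NeZero n]

theorem avg_nonneg {f : (Fin m → Bool) → ℝ} (hf : ∀ σ, 0 ≤ f σ) : 0 ≤ avg f :=
  div_nonneg (sum_nonneg fun σ _ => hf σ) (by positivity)

theorem avg_mono {f g : (Fin m → Bool) → ℝ} (h : ∀ σ, f σ ≤ g σ) : avg f ≤ avg g :=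
  div_le_div_of_nonneg_right (sum_le_sum fun σ _ => h σ) (by positivity)

theorem eagerValue_nonneg {t : Ctl n → ℝ} {κ : ℝ} (ht : ∀ s, 0 ≤ t s) (hκ : 0 ≤ κ) (F : ℕ) :
    ∀ s (σ : Fin m → Bool), 0 ≤ eagerValue L t κ F s σ := by
  induction F with
  | zero => intro s σ; exact ht s
  | succ F ih =>
    intro s σ
    rw [eagerValue]
    by_cases hr : s.runs = 0
    · rw [if_pos hr]; exact ih _ _
    rw [if_neg hr]
    refine add_nonneg hκ ?_
    by_cases hs : s.reset
    · rw [if_pos hs]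
      by_cases hp : s.pos = 0
      · rw [if_pos hp]; exact ih _ _
      rw [if_neg hp]
      split
      · exact ih _ _
      · exact div_nonneg (add_nonneg (ih _ _) (ih _ _)) (by norm_num)
    · rw [if_neg hs]
      split
      · exact ih _ _
      · split_ifs
        · exact avg_nonneg fun σ => ih _ _
        · exact ih _ _
        · exact ih _ _

theorem eagerValue_of_done {t : Ctl n → ℝ} {κ : ℝ} {s : Ctl n} (hs : s.runs = 0) (F : ℕ)
    (σ : Fin m → Bool) : eagerValue L t κ F s σ = t s := by
  induction F with
  | zero => rfl
  | succ F ih => simp only [eagerValue, if_pos hs, ih]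

/-- Unfinished states have value `0`, so more fuel cannot lower the value. This makes it possible to
compare scans of different lengths at one common amount of fuel. -/
theorem eagerValue_le_succ {t : Ctl n → ℝ} {κ : ℝ} (ht : ∀ s, 0 ≤ t s) (hκ : 0 ≤ κ)
    (ht0 : ∀ s, s.runs ≠ 0 → t s = 0) (F : ℕ) : ∀ s (σ : Fin m → Bool),
    eagerValue L t κ F s σ ≤ eagerValue L t κ (F + 1) s σ := by
  induction F with
  | zero =>
    intro s σ
    by_cases hs : s.runs = 0
    · rw [eagerValue_of_done L hs, eagerValue_of_done L hs]
    · have h1 : eagerValue L t κ 0 s σ = 0 := ht0 s hs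
      rw [h1]
      exact eagerValue_nonneg L ht hκ _ _ _
  | succ F ih =>
    intro s σ
    rw [eagerValue, eagerValue]
    by_cases hr : s.runs = 0
    · rw [if_pos hr, if_pos hr]; exact ih _ _
    rw [if_neg hr, if_neg hr]
    refine add_le_add le_rfl ?_
    by_cases hs : s.reset
    · rw [if_pos hs, if_pos hs]
      by_cases hp : s.pos = 0
      · rw [if_pos hp, if_pos hp]; exact ih _ _
      rw [if_neg hp, if_neg hp]
      rcases (L.list s.cur)[s.pos - 1]? with _ | d
      · exact ih _ _
      · exact div_le_div_of_nonneg_right (add_le_add (ih _ _) (ih _ _)) (by norm_num)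
    · rw [if_neg hs, if_neg hs]
      rcases (L.list s.cur)[s.pos]? with _ | d
      · exact ih _ _
      · simp only []
        split_ifs
        · exact avg_mono fun σ => ih _ _
        · exact ih _ _
        · exact ih _ _

/-- The value after a success. -/
noncomputable def succValue (t : Ctl n → ℝ) (κ : ℝ) (F : ℕ) (s : Ctl n) (σ : Fin m → Bool) : ℝ :=
  if s.EndsRun then avg (eagerValue L t κ F s.succ) else eagerValue L t κ F s.succ σ

theorem eagerValue_scan_step {t : Ctl n → ℝ} {κ : ℝ} (F : ℕ) {s : Ctl n} (σ : Fin m → Bool)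
    (hr : s.runs ≠ 0) (hs : s.reset = false) {d : Fin m × Bool}
    (hd : (L.list s.cur)[s.pos]? = some d) :
    eagerValue L t κ (F + 1) s σ = κ + if G.tail σ d.1 = s.cur then succValue L t κ F s σ
      else eagerValue L t κ F { s with pos := s.pos + 1 } σ := by
  rw [eagerValue, if_neg hr, if_neg (by simp [hs]), hd]
  rfl

open Classical in
-- Position `i` is reached exactly when none of the first `i` edges leaves `cur`, so the sum counts
-- the steps of the scan; the term `i = length` is the step that detects a sink. The fuel left after
-- the scan is rounded up to `F` by monotonicity.
theorem eagerValue_scan_le {t : Ctl n → ℝ} {κ : ℝ} (ht : ∀ s, 0 ≤ t s) (hκ : 0 ≤ κ)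
    (ht0 : ∀ s, s.runs ≠ 0 → t s = 0) (F : ℕ) (s : Ctl n) (σ : Fin m → Bool) (hr : s.runs ≠ 0)
    (hs : s.reset = false) (k : ℕ) : ∀ j, j + k = (L.list s.cur).length →
    (∀ d ∈ (L.list s.cur).take j, G.tail σ d.1 ≠ s.cur) →
    eagerValue L t κ (F + 1) { s with pos := j } σ ≤
      κ * ∑ i ∈ Ico j ((L.list s.cur).length + 1),
        (if ∀ d ∈ (L.list s.cur).take i, G.tail σ d.1 ≠ s.cur then (1 : ℝ) else 0) +
      if ∃ e, G.tail σ e = s.cur then succValue L t κ F s σ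
      else eagerValue L t κ F { s.sink with pos := (L.list s.cur).length } σ := by
  induction k with
  | zero =>
    intro j hj hσ
    rw [add_zero] at hj
    subst hj
    have hno : ¬ ∃ e, G.tail σ e = s.cur := by
      rintro ⟨e, he⟩
      refine hσ (e, σ e) ?_ he
      rw [List.take_length]
      exact (L.mem_iff _ _).2 he
    rw [if_neg hno, eagerValue]
    simp only [if_neg hr, hs, Nat.Ico_succ_singleton, sum_singleton, if_pos hσ]
    simp [Ctl.sink]
  | succ k ih =>
    intro j hj hσ
    have hjl : j < (L.list s.cur).length := by omega
    have hget : (L.list s.cur)[j]? = some (L.list s.cur)[j] := List.getElem?_eq_getElem hjl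
    set d := (L.list s.cur)[j] with hd
    have hstep : eagerValue L t κ (F + 1) { s with pos := j } σ =
        κ + if G.tail σ d.1 = s.cur then succValue L t κ F s σ
          else eagerValue L t κ F { s with pos := j + 1 } σ :=
      eagerValue_scan_step L (s := { s with pos := j }) F σ hr hs hget
    rw [sum_eq_sum_Ico_succ_bot (by omega), if_pos hσ, hstep]
    by_cases hout : G.tail σ d.1 = s.cur
    · have hsum : 0 ≤ ∑ i ∈ Ico (j + 1) ((L.list s.cur).length + 1),
          (if ∀ d ∈ (L.list s.cur).take i, G.tail σ d.1 ≠ s.cur then (1 : ℝ) else 0) :=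
        sum_nonneg fun i _ => by split_ifs <;> norm_num
      rw [if_pos hout, if_pos ⟨_, hout⟩]
      nlinarith [mul_nonneg hκ hsum]
    · rw [if_neg hout]
      have h1 := ih (j + 1) (by omega) (by
        intro d' hd'
        rw [List.take_add_one, List.mem_append] at hd'
        rcases hd' with hd' | hd'
        · exact hσ d' hd'
        · rw [hget] at hd'
          simp only [Option.toList_some, List.mem_singleton] at hd'
          rw [hd']; exact hout)
      have h2 := eagerValue_le_succ L ht hκ ht0 F { s with pos := j + 1 } σ
      linarith

theorem geom_five_eighths (k : ℕ) : ∑ i ∈ range k, ((5 : ℝ) / 8) ^ i ≤ 8 / 3 := by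
  rw [geom_sum_eq (by norm_num)]
  have : (0 : ℝ) ≤ (5 / 8) ^ k := by positivity
  rw [div_le_iff_of_neg (by norm_num)]
  linarith

/-- Equality holds at `d = 3`, and the left side decreases from there on. At `d = 2` it is `75 / 64
> 1`, so the drift argument depends on minimum degree `3`. -/
theorem add_one_mul_pow_le {d : ℕ} (hd : 3 ≤ d) : ((d : ℝ) + 1) * (5 / 8) ^ d ≤ 125 / 128 := by
  induction d, hd using Nat.le_induction with
  | base => norm_num
  | succ d hd ih =>
    push_cast
    rw [pow_succ]
    have h3 : (3 : ℝ) ≤ d := by exact_mod_cast hd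
    have : (0 : ℝ) ≤ (5 / 8) ^ d := by positivity
    nlinarith

/-- The squared relative error of a final state, weighted by `w`. -/
noncomputable def finalError (G : Multigraph (Fin n) (Fin m)) (N w : ℝ) (s : Ctl n) : ℝ :=
  if s.runs = 0 then w * (∏ i, (s.cnt i : ℝ) / (N * stageProb G i) - 1) ^ 2 else 0

/-- A bound for the expected final error and cost. -/
noncomputable def potential (G : Multigraph (Fin n) (Fin m)) (N w κ : ℝ) (s : Ctl n) : ℝ :=
  w * s.error N (stageProb G) + 200 * κ * s.load

/-- The sums express expectations under the invariant: before a scan the orientation is uniform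
subject to the demands at settled vertices; during a reset it is, in addition, known that the first
`pos` edges at `cur` point inwards. In the second case `200 * κ * pos` pays for the neighbours that
may still be pushed and `κ * (pos + 1)` for the remaining steps of the reset. -/
theorem sum_noSinkIn_eagerValue_le (hdeg : ∀ v, 3 ≤ (L.list v).length) {N w κ : ℝ}
    (hw : 0 ≤ w) (hκ : 0 ≤ κ) (F : ℕ) : ∀ s : Ctl n, s.WF →
    (s.reset = false → s.pos = 0 →
      ∑ σ ∈ G.noSinkIn s.settled, eagerValue L (finalError G N w) κ F s σ ≤
        (G.noSinkIn s.settled).card * potential G N w κ s) ∧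
    (s.reset = true → s.runs ≠ 0 → s.pos ≤ (L.list s.cur).length →
      ∑ σ ∈ G.noSinkInto s.settled s.cur ((L.list s.cur).take s.pos),
        eagerValue L (finalError G N w) κ F s σ ≤
        (G.noSinkInto s.settled s.cur ((L.list s.cur).take s.pos)).card *
          (potential G N w κ s + 200 * κ * s.pos + κ * (s.pos + 1))) := by
  classical
  set t : Ctl n → ℝ := finalError G N w with ht_def
  have ht : ∀ s, 0 ≤ t s := by
    intro s; simp only [ht_def, finalError]; split_ifs
    · positivity
    · exact le_rfl
  have ht0 : ∀ s, s.runs ≠ 0 → t s = 0 := fun s hs => if_neg hs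
  have herr : ∀ s : Ctl n, s.WF → 0 ≤ s.error N (stageProb G) := fun s hs =>
    errorSq_nonneg (fun i => by linarith [half_le_stageProb L hdeg i])
      (stageProb_le_one L hdeg) hs.rem_nonneg
  have hpot : ∀ s : Ctl n, s.WF → 0 ≤ potential G N w κ s := fun s hs =>
    add_nonneg (mul_nonneg hw (herr s hs)) (mul_nonneg (by positivity) s.load_nonneg)
  have hdone : ∀ s : Ctl n, s.WF → s.runs = 0 → ∀ F (σ : Fin m → Bool),
      eagerValue L t κ F s σ = potential G N w κ s := by
    intro s hs hr F σ
    rw [eagerValue_of_done L hr, ht_def, finalError, if_pos hr, potential,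
      Ctl.error_of_done hs hr, Ctl.load, if_pos hr]
    ring
  induction F with
  | zero =>
    intro s hs
    by_cases hr : s.runs = 0
    · refine ⟨fun _ _ => ?_, fun _ h => (h hr).elim⟩
      rw [sum_congr rfl fun σ _ => hdone s hs hr 0 σ]
      simp
    · have h0 : ∀ σ : Fin m → Bool, eagerValue L t κ 0 s σ = 0 := fun σ => ht0 s hr
      have := hpot s hs
      refine ⟨fun _ _ => ?_, fun _ _ _ => ?_⟩ <;> simp only [h0, sum_const_zero] <;> positivity
  | succ F ih =>
    intro s hs
    by_cases hr : s.runs = 0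
    · refine ⟨fun _ _ => ?_, fun _ h => (h hr).elim⟩
      rw [sum_congr rfl fun σ _ => hdone s hs hr _ σ]
      simp
    refine ⟨fun hreset hpos => ?_, fun hreset _ hpos => ?_⟩
    · -- scanning
      set S := s.settled with hS
      set v := s.cur with hv
      set l := L.list v with hl
      have hvS : v ∉ S := s.cur_notMem_settled
      set s' : Ctl n := { s.sink with pos := l.length } with hs'
      have hws' : s'.WF := by
        have h := Ctl.wf_sink hs hr
        exact ⟨h.1, h.2, h.3, h.4, h.5, h.6, h.7, h.8, h.9⟩
      have hpt : ∀ σ : Fin m → Bool, eagerValue L t κ (F + 1) s σ ≤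
          κ * ∑ i ∈ range (l.length + 1),
            (if ∀ d ∈ l.take i, G.tail σ d.1 ≠ v then (1 : ℝ) else 0) +
          if ∃ e, G.tail σ e = v then succValue L t κ F s σ
          else eagerValue L t κ F s' σ := by
        intro σ
        have h := eagerValue_scan_le L ht hκ ht0 F s σ hr hreset l.length 0 (by simp [hl, hv])
          (by simp)
        have e : ({ s with pos := 0 } : Ctl n) = s := by
          rw [← hpos]
        rw [e] at h
        rwa [range_eq_Ico]
      have hsum := sum_le_sum fun σ (_ : σ ∈ G.noSinkIn S) => hpt σ
      rw [sum_add_distrib, ← mul_sum, sum_comm] at hsum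
      -- For each position, the orientations whose scan gets that far are counted by the local
      -- lemma; summing the geometric series bounds the mean length of a scan.
      have hcount : ∑ i ∈ range (l.length + 1), ∑ σ ∈ G.noSinkIn S,
          (if ∀ d ∈ l.take i, G.tail σ d.1 ≠ v then (1 : ℝ) else 0) ≤
          8 / 3 * (G.noSinkIn S).card := by
        have : ∀ i ∈ range (l.length + 1), ∑ σ ∈ G.noSinkIn S,
            (if ∀ d ∈ l.take i, G.tail σ d.1 ≠ v then (1 : ℝ) else 0) ≤
            (5 / 8) ^ i * (G.noSinkIn S).card := by
          intro i hi
          have h1 := L.card_noSinkInto_le hdeg (List.take_prefix i (L.list v)) hvS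
          rw [List.length_take, min_eq_left (by
            have := mem_range.1 hi; rw [← hl]; omega)] at h1
          refine le_of_eq_of_le ?_ h1
          rw [← sum_filter, sum_const, nsmul_eq_mul, mul_one]
          congr 2
          ext σ
          rw [mem_filter, mem_noSinkIn, mem_noSinkInto]
        refine (sum_le_sum this).trans ?_
        rw [← sum_mul]
        exact mul_le_mul_of_nonneg_right (geom_five_eighths _) (by positivity)
      have hsplit : ∑ σ ∈ G.noSinkIn S, (if ∃ e, G.tail σ e = v then succValue L t κ F s σ
          else eagerValue L t κ F s' σ) =
          ∑ σ ∈ G.noSinkIn (insert v S), succValue L t κ F s σ +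
          ∑ σ ∈ G.noSinkInto S v l, eagerValue L t κ F s' σ := by
        rw [L.sum_noSinkIn S v]
        congr 1
        · refine sum_congr rfl fun σ hσ => if_pos ?_
          exact mem_noSinkIn.1 hσ v (mem_insert_self _ _)
        · refine sum_congr rfl fun σ hσ => if_neg ?_
          rintro ⟨e, he⟩
          exact (mem_noSinkInto.1 hσ).2 (e, σ e) ((L.mem_iff v _).2 he) he
      have hsucc : ∑ σ ∈ G.noSinkIn (insert v S), succValue L t κ F s σ ≤
          (G.noSinkIn (insert v S)).card * potential G N w κ s.succ := by
        have h := (ih s.succ (Ctl.wf_succ hs hr)).1 s.reset_succ s.pos_succ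
        by_cases he : s.EndsRun
        · rw [Ctl.settled_succ_of_endsRun he, noSinkIn_empty] at h
          have h1 : avg (eagerValue L t κ F s.succ) ≤ potential G N w κ s.succ := by
            rw [avg, div_le_iff₀ (by positivity)]
            refine h.trans (le_of_eq ?_)
            simp [mul_comm]
          simp only [succValue, if_pos he, sum_const, nsmul_eq_mul]
          exact mul_le_mul_of_nonneg_left h1 (by positivity)
        · rw [Ctl.settled_succ hs he] at h
          simpa only [succValue, if_neg he] using h
      have hsink : ∑ σ ∈ G.noSinkInto S v l, eagerValue L t κ F s' σ ≤
          (G.noSinkInto S v l).card *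
            (potential G N w κ s' + 200 * κ * l.length + κ * (l.length + 1)) := by
        have h := (ih s' hws').2 rfl hr le_rfl
        have e : (L.list s'.cur).take s'.pos = l := List.take_length
        rw [e] at h
        exact h
      have hcard := L.card_noSinkIn_insert S v
      have hO2 := L.card_noSinkInto_le hdeg (List.prefix_refl l) hvS
      have hd := add_one_mul_pow_le (hdeg v)
      set O : ℝ := ((G.noSinkIn S).card : ℝ)
      set O₁ : ℝ := ((G.noSinkIn (insert v S)).card : ℝ)
      rw [← hl] at hcard hd
      set O₂ : ℝ := ((G.noSinkInto S v l).card : ℝ)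
      have hO : 0 ≤ O := Nat.cast_nonneg _
      have hdO : ((l.length : ℝ) + 1) * O₂ ≤ 125 / 128 * O := by
        calc ((l.length : ℝ) + 1) * O₂ ≤ (l.length + 1) * ((5 / 8) ^ l.length * O) := by gcongr
          _ = (l.length + 1) * (5 / 8) ^ l.length * O := by ring
          _ ≤ _ := by gcongr
      have hload1 : s.succ.load = s.load - 1 := Ctl.load_succ hr
      have hload2 : s'.load = s.load := rfl
      have herr' : s'.error N (stageProb G) = s.sink.error N (stageProb G) := rfl
      -- If this test is a trial, `O₁ / O` is the stage probability and the martingale identity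
      -- applies; otherwise the error is constant and `O₁ + O₂ = O` suffices.
      have herror : O₁ * s.succ.error N (stageProb G) + O₂ * s.sink.error N (stageProb G) =
          O * s.error N (stageProb G) := by
        obtain ⟨h1, h2⟩ := Ctl.error_succ_sink N (stageProb G) hs hr
        cases hf : s.first
        · rw [(h2 hf).1, (h2 hf).2, hcard]; ring
        · have hp := stageProb_mul L hdeg s.stage
          rw [← settled_of_first hs hf, ← hS] at hp
          have hvc : v = s.stage := hs.cur_eq hf
          rw [← hvc] at hp
          have h1' := h1 hf
          rw [← hvc] at h1'
          have hp' : stageProb G v * O = O₁ := hp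
          have hO2' : O₂ = (1 - stageProb G v) * O := by rw [sub_mul, hp']; linarith
          rw [hO2', ← hp', ← h1']; ring
      simp only [potential, hload1, hload2, herr'] at hsucc hsink
      rw [hsplit] at hsum
      refine hsum.trans ?_
      have hk1 := mul_le_mul_of_nonneg_left hcount hκ
      have hk2 := mul_le_mul_of_nonneg_left hdO hκ
      have hk3 : 0 ≤ κ * O := mul_nonneg hκ hO
      have hwe : w * (O₁ * s.succ.error N (stageProb G) + O₂ * s.sink.error N (stageProb G)) =
          w * (O * s.error N (stageProb G)) := by rw [herror]
      have hO1 : O₁ = O - O₂ := by linarith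
      simp only [potential]
      calc _ ≤ κ * (8 / 3 * O) + (O₁ * (w * s.succ.error N (stageProb G) +
              200 * κ * (s.load - 1)) + O₂ * (w * s.sink.error N (stageProb G) +
              200 * κ * s.load + 200 * κ * l.length + κ * (l.length + 1))) := by
            exact add_le_add hk1 (add_le_add hsucc hsink)
        _ = w * (O₁ * s.succ.error N (stageProb G) + O₂ * s.sink.error N (stageProb G)) +
            (O₁ + O₂) * (200 * κ * s.load) + κ * (8 / 3 * O) - 200 * κ * (O₁ + O₂) +
              201 * (κ * ((l.length + 1) * O₂)) := by ring
        _ ≤ _ := by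
            -- What remains is that the coefficient of `κ * O`, at most `8 / 3 - 200 + 201 * (125 /
            -- 128)`, is negative; this is where the constant `200` comes from.
            rw [hwe, ← hcard]
            nlinarith
    · -- resetting
      rw [sum_congr rfl fun σ _ => by rw [eagerValue, if_neg hr, if_pos hreset]]
      rw [sum_add_distrib, sum_const, nsmul_eq_mul]
      set S := s.settled with hS
      set v := s.cur with hv
      set l := L.list v with hl
      have hvS : v ∉ S := s.cur_notMem_settled
      -- At position `0` nothing is known about the edges at `cur` any more, and the invariant is
      -- the one for a scan. At a later position the last edge known to point inwards is peeled off.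
      rcases Nat.eq_zero_or_eq_succ_pred s.pos with hp | hp
      · have e5 : G.noSinkInto S v (l.take s.pos) = G.noSinkIn S := by
          rw [hp, List.take_zero, noSinkInto_nil]
        rw [e5]
        simp only [if_pos hp]
        have hws' : ({ s with reset := false } : Ctl n).WF :=
          ⟨hs.1, hs.2, hs.3, hs.4, hs.5, hs.6, by simp, hs.8, hs.9⟩
        have h := (ih { s with reset := false } hws').1 rfl hp
        refine (add_le_add le_rfl h).trans (le_of_eq ?_)
        have e : potential G N w κ { s with reset := false } = potential G N w κ s := rfl
        have e' : ({ s with reset := false } : Ctl n).settled = S := rfl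
        rw [e, e', hp]
        push_cast
        ring
      · set j := s.pos.pred with hj
        rw [hp]
        have hjl : j < l.length := by omega
        obtain ⟨⟨e, b⟩, hd⟩ : ∃ d, l[j] = d := ⟨_, rfl⟩
        have hget : l[j]? = some (e, b) := by rw [← hd]; exact List.getElem?_eq_getElem hjl
        simp only [Nat.succ_ne_zero, if_false, Nat.succ_sub_one, hget]
        have hb : G.ends e b = v :=
          L.ends_of_mem (d := (e, b)) (by rw [← hd]; exact List.getElem_mem hjl)
        have htake : l.take (j + 1) = l.take j ++ [(e, b)] := by
          rw [List.take_add_one, hget]; rfl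
        rw [Nat.succ_eq_add_one, htake]
        by_cases huv : G.ends e (!b) = v
        · rw [noSinkInto_append_loop hb huv]; simp
        have hpre : l.take j ++ [(e, b)] <+: L.list v := by
          rw [← htake]; exact List.take_prefix _ _
        have hne := L.ne_of_prefix hpre huv
        set u := G.ends e (!b) with hu
        have hws' : (s.back u j).WF := Ctl.wf_back hs hreset huv j
        have h := (ih (s.back u j) hws').2 hreset hr (by
          show j ≤ _; exact hjl.le)
        have e1 : (s.back u j).settled = S.erase u := Ctl.settled_back s u j
        have e2 : (s.back u j).cur = v := rfl
        have e3 : (s.back u j).pos = j := rfl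
        rw [e1, e2, e3, ← hl] at h
        have e4 : (s.back u j).error N (stageProb G) = s.error N (stageProb G) := rfl
        have hsum := sum_noSinkInto_append hvS hb hu.symm huv hne
          (eagerValue L t κ F (s.back u j))
        have hc := two_mul_card_noSinkInto_append hvS hb hu.symm huv hne
        have hload := Ctl.load_back_le s u j
        rw [← sum_div, hsum]
        rw [← hc] at h
        simp only [potential, e4] at h ⊢
        set O : ℝ := ((G.noSinkInto S v (l.take j ++ [(e, b)])).card : ℝ)
        have hO : 0 ≤ O := Nat.cast_nonneg _
        have hk := mul_le_mul_of_nonneg_left hload (mul_nonneg hO hκ)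
        push_cast
        nlinarith

end Potential

/-! ## The program of the sampler -/

namespace Program

/-- A sequence of instructions followed by a program. -/
def block : List Instr → Program → Program
  | [], p => p
  | i :: l, p => .seq (.instr i) (block l p)

/-- A program without effect on the registers and cells in use. -/
def skip : Program := .instr (.const 25 0)

/-- Clear the scratch registers. -/
def clear : Program :=
  block [.const 20 0, .const 21 0, .const 22 0, .const 23 0, .const 24 0] (.instr (.const 25 0))

/-- Load the other end of an edge and the address of its direction. -/
def fetch : Program :=
  block [.read 21 12, .add 22 12 4, .read 22 22, .add 22 22 9, .mul 22 22 7]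
    (.instr (.add 22 22 6))

/-- Load the direction of the next edge at the current vertex, drawing it if necessary. -/
def reveal : Program :=
  -- A direction is stored as the tail plus one, and `0` means unrevealed. Register `20` holds the
  -- coin, `11` the current vertex, `21` its neighbour.
  block [.load 23 22] (.branch 23 skip (.branch 20 (block [.add 23 11 4] (.instr (.store 22 23)))
    (block [.add 23 21 4] (.instr (.store 22 23)))))

/-- Continue with the vertex on the top of the stack. -/
def popStack : Program :=
  block [.sub 13 13 4, .mul 21 13 7, .add 21 21 4, .load 11 21, .mul 21 11 7, .const 22 0]
    (.instr (.store 21 22))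

/-- Continue with the next stage, or with the next run after the last stage. -/
def nextStage : Program :=
  block [.add 10 10 4, .const 14 1, .sub 21 3 10, .const 22 0]
  (.branch 21 (.instr (.add 11 10 22))
    -- Register `9` advances by `m`: each run uses its own block of cells, so no time proportional
    -- to `m` is spent on clearing directions.
    (block [.const 10 0, .const 11 0, .sub 8 8 4] (.instr (.add 9 9 1))))

/-- Count the success. -/
def count : Program :=
  block [.mul 21 10 7, .add 21 21 5, .load 22 21, .add 22 22 14] (.instr (.store 21 22))

/-- Go to the beginning of the list of the current vertex. -/
def rewind : Program := block [.add 21 11 6] (.instr (.read 12 21))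

/-- The current vertex is not a sink. -/
def success : Program := .seq count (.seq (.branch 13 popStack nextStage) rewind)

/-- Compare the tail of the edge with the current vertex. -/
def compare : Program :=
  -- Equality is tested by adding the two truncated differences.
  block [.add 24 11 4, .sub 25 24 23, .sub 24 23 24, .add 24 24 25]
    (.branch 24 (.instr (.add 12 12 5)) success)

/-- Look at the next edge at the current vertex. -/
def scan : Program :=
  block [.add 21 11 7, .read 21 21, .sub 21 21 12]
    (.branch 21 (.seq fetch (.seq reveal compare)) (block [.const 15 1] (.instr (.const 14 0))))

/-- Forget the direction of an edge. -/
def forget : Program := block [.const 23 0] (.instr (.store 22 23))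

/-- Put a neighbour on the stack if it belongs there. -/
def pushStack : Program :=
  block [.add 24 10 4, .sub 24 24 21]
  (.branch 24 (block [.mul 22 21 7, .load 23 22]
    (.branch 23 skip (block [.store 22 4, .mul 24 13 7, .add 24 24 4, .store 24 21]
      (.instr (.add 13 13 4))))) skip)

/-- Reset the edges at a sink, one at a time. -/
def resetEdges : Program :=
  block [.add 21 11 6, .read 21 21, .sub 21 12 21]
    (.branch 21 (block [.sub 12 12 5] (.seq fetch (.seq forget pushStack))) (.instr (.const 15 0)))

/-- One step of the sampler, after a coin has been tossed. -/
def sampleStep : Program := .seq (.branch 8 (.branch 15 resetEdges scan) skip) clear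

end Program

@[simp] theorem Store.reg_setReg (σ : Store) (d y i : ℕ) :
    (σ.setReg d y).reg i = if i = d then y else σ.reg i := by
  simp [Store.setReg, Function.update_apply]

@[simp] theorem Store.mem_setReg (σ : Store) (d y : ℕ) : (σ.setReg d y).mem = σ.mem := rfl

@[simp] theorem Store.reg_setMem (σ : Store) (d y : ℕ) : (σ.setMem d y).reg = σ.reg := rfl

@[simp] theorem Store.mem_setMem (σ : Store) (d y i : ℕ) :
    (σ.setMem d y).mem i = if i = d then y else σ.mem i := by
  simp [Store.setMem, Function.update_apply]

/-! ### The store follows the abstract sampler -/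

section Simulation

variable {n m : ℕ} {G : Multigraph (Fin n) (Fin m)}

/-- The input words hold the adjacency list. -/
structure Encodes (x : List ℕ) (L : AdjList G) : Prop where
  pointer : ∀ v ≤ n, x.getD (v + 3) 0 = L.start v
  neighbour : ∀ v j d, (L.list v)[j]? = some d →
    x.getD (L.start v + 2 * j) 0 = G.ends d.1 (!d.2)
  edge : ∀ v j d, (L.list v)[j]? = some d → x.getD (L.start v + 2 * j + 1) 0 = d.1

/-- Invariants of the control state along all computations. -/
structure Ctl.Safe (L : AdjList G) (N : ℕ) (s : Ctl n) : Prop where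
  nodup : s.st.Nodup
  st_nil : s.first = true → s.st = []
  first_of_reset : s.reset = true → s.first = false
  pos_le : s.pos ≤ (L.list s.cur).length
  runs_le : s.runs ≤ N
  cnt_le : ∀ i, s.cnt i + s.runs ≤
    N + if i < s.stage ∨ (i = s.stage ∧ s.first = false) then 1 else 0
  cnt_le_of_done : s.runs = 0 → ∀ i, s.cnt i ≤ N

/-- The word that stores the direction of an edge. -/
def tailWord (G : Multigraph (Fin n) (Fin m)) (π : Fin m → Option Bool) (e : Fin m) : ℕ :=
  match π e with
  | none => 0
  | some b => (G.ends e b).val + 1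

/-- The store holds the given state of the sampler; `N`, `Q` and `K` are parameters of the
computation that the sampler does not change. -/
structure Represents (L : AdjList G) (N Q K : ℕ) (σ : Store) (s : Ctl n)
    (π : Fin m → Option Bool) : Prop where
  r0 : σ.reg 0 = 1
  r1 : σ.reg 1 = m
  r2 : σ.reg 2 = 0
  r3 : σ.reg 3 = n
  r4 : σ.reg 4 = 1
  r5 : σ.reg 5 = 2
  r6 : σ.reg 6 = 3
  r7 : σ.reg 7 = 4
  r8 : σ.reg 8 = s.runs
  r9 : σ.reg 9 = (N - s.runs) * m
  r10 : σ.reg 10 = s.stage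
  r11 : σ.reg 11 = s.cur
  r12 : σ.reg 12 = L.start s.cur + 2 * s.pos
  r13 : σ.reg 13 = s.st.length
  r14 : σ.reg 14 = s.first.toNat
  r15 : σ.reg 15 = s.reset.toNat
  r17 : σ.reg 17 = N
  r18 : σ.reg 18 = Q
  r19 : σ.reg 19 = K
  big : ∀ i, 25 < i → σ.reg i = 0
  -- Memory holds four interleaved arrays, told apart by the address modulo `4`: membership in the
  -- stack, the stack, the counts, and the directions in one block per run.
  flag : ∀ u : Fin n, σ.mem (4 * u) = if u ∈ s.st then 1 else 0
  stack : ∀ k v, s.st.reverse[k]? = some v → σ.mem (4 * k + 1) = v.val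
  counts : ∀ i : Fin n, σ.mem (4 * i + 2) = s.cnt i
  edges : ∀ e : Fin m, σ.mem (4 * ((N - s.runs) * m + e) + 3) = tailWord G π e
  fresh : ∀ k, (N - s.runs) * m + m ≤ k → σ.mem (4 * k + 3) = 0
  mem_le : ∀ a, σ.mem a ≤ n + N + 1

open Program in
theorem Program.eval_block (x : List ℕ) (i : Instr) (l : List Instr) (p : Program) (σ : Store) :
    (block (i :: l) p).eval x σ = (block l p).eval x (i.eval x σ) := rfl

variable {L : AdjList G} {N Q K : ℕ} {σ : Store} {s : Ctl n} {π : Fin m → Option Bool}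
  {x : List ℕ}

/-- Scratch registers do not matter. -/
theorem Represents.congr {τ : Store} (h : Represents L N Q K σ s π)
    (hreg : ∀ i, i < 20 ∨ 25 < i → i ≠ 16 → τ.reg i = σ.reg i) (hmem : τ.mem = σ.mem) :
    Represents L N Q K τ s π := by
  constructor
  case big => intro i hi; rw [hreg i (Or.inr hi) (by omega)]; exact h.big i hi
  all_goals try rw [hmem]
  case flag => exact h.flag
  case stack => exact h.stack
  case counts => exact h.counts
  case edges => exact h.edges
  case fresh => exact h.fresh
  case mem_le => exact h.mem_le
  all_goals rw [hreg _ (by norm_num) (by norm_num)]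
  exacts [h.r0, h.r1, h.r2, h.r3, h.r4, h.r5, h.r6, h.r7, h.r8, h.r9, h.r10, h.r11, h.r12,
    h.r13, h.r14, h.r15, h.r17, h.r18, h.r19]

theorem Represents.setReg (h : Represents L N Q K σ s π) {d : ℕ} (hd : 20 ≤ d ∧ d ≤ 25) (y : ℕ) :
    Represents L N Q K (σ.setReg d y) s π :=
  h.congr (fun i hi _ => by rw [Store.reg_setReg, if_neg (by omega)]) rfl

theorem Represents.clear (h : Represents L N Q K σ s π) :
    Represents L N Q K (Program.clear.eval x σ) s π ∧
      (∀ i, 20 ≤ i → (Program.clear.eval x σ).reg i = 0) ∧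
      (Program.clear.eval x σ).reg 16 = σ.reg 16 := by
  refine ⟨?_, ?_, ?_⟩
  · exact (((((h.setReg (by norm_num) _).setReg (by norm_num) _).setReg (by norm_num) _).setReg
      (by norm_num) _).setReg (by norm_num) _).setReg (by norm_num) _
  · intro i hi
    have := h.big i
    simp only [Program.clear, Program.block, Program.eval, Instr.eval, Store.reg_setReg]
    split_ifs <;> first | rfl | exact this (by omega)
  · simp [Program.clear, Program.block, Program.eval, Instr.eval]

theorem start_succ (L : AdjList G) (v : Fin n) :
    L.start (v + 1) = L.start v + 2 * (L.list v).length := by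
  have : (univ.filter fun u : Fin n => u.val < v.val + 1) =
      insert v (univ.filter fun u : Fin n => u.val < v.val) := by
    ext u; simp [Fin.ext_iff]; omega
  rw [AdjList.start, AdjList.start, this, sum_insert (by simp)]
  ring

theorem Represents.fetch (hx : Encodes x L) (h : Represents L N Q K σ s π)
    {d : Fin m × Bool} (hd : (L.list s.cur)[s.pos]? = some d) :
    Represents L N Q K (Program.fetch.eval x σ) s π ∧
    (Program.fetch.eval x σ).reg 20 = σ.reg 20 ∧
    (Program.fetch.eval x σ).reg 21 = G.ends d.1 (!d.2) ∧
    (Program.fetch.eval x σ).reg 22 = 4 * ((N - s.runs) * m + d.1) + 3 ∧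
    (Program.fetch.eval x σ).reg 16 = σ.reg 16 := by
  have hn := hx.neighbour _ _ _ hd
  have he := hx.edge _ _ _ hd
  refine ⟨?_, ?_, ?_, ?_, ?_⟩
  · exact (((((h.setReg (by norm_num) _).setReg (by norm_num) _).setReg (by norm_num) _).setReg
        (by norm_num) _).setReg (by norm_num) _).setReg (by norm_num) _
  · simp [Program.fetch, Program.block, Program.eval, Instr.eval]
  · simp [Program.fetch, Program.block, Program.eval, Instr.eval, h.r12, ← hn]
  · simp only [Program.fetch, Program.block, Program.eval, Instr.eval, Store.reg_setReg,
      Nat.reduceEqDiff, if_true, if_false, h.r12, h.r4, h.r9, h.r7, h.r6]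
    rw [he]; ring
  · simp [Program.fetch, Program.block, Program.eval, Instr.eval]

/-- The effect of storing the direction of an edge. -/
theorem Represents.setEdge (h : Represents L N Q K σ s π) (e : Fin m) (o : Option Bool) {w : ℕ}
    (hw : w = tailWord G (Function.update π e o) e) :
    Represents L N Q K (σ.setMem (4 * ((N - s.runs) * m + e) + 3) w) s
      (Function.update π e o) := by
  have hwn : w ≤ n := by
    rw [hw, tailWord]; split
    · exact Nat.zero_le _
    · exact (G.ends e _).2
  constructor
  case flag => intro u; rw [Store.mem_setMem, if_neg (by omega)]; exact h.flag u
  case stack => intro k v hk; rw [Store.mem_setMem, if_neg (by omega)]; exact h.stack k v hk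
  case counts => intro u; rw [Store.mem_setMem, if_neg (by omega)]; exact h.counts u
  case edges =>
    intro e'
    rw [Store.mem_setMem]
    by_cases he : e' = e
    · subst he; rw [if_pos rfl, hw]
    · have : e'.val ≠ e.val := fun h => he (Fin.ext h)
      rw [if_neg (by omega), h.edges e', tailWord, tailWord, Function.update_of_ne he]
  case fresh =>
    intro k hk
    have := e.2
    rw [Store.mem_setMem, if_neg (by omega)]; exact h.fresh k hk
  case mem_le =>
    intro a
    rw [Store.mem_setMem]; split_ifs
    · omega
    · exact h.mem_le a
  case big => exact h.big
  all_goals rw [Store.reg_setMem]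
  exacts [h.r0, h.r1, h.r2, h.r3, h.r4, h.r5, h.r6, h.r7, h.r8, h.r9, h.r10, h.r11, h.r12,
    h.r13, h.r14, h.r15, h.r17, h.r18, h.r19]

theorem Represents.reveal (h : Represents L N Q K σ s π)
    {d : Fin m × Bool} (hd : (L.list s.cur)[s.pos]? = some d) {c : Bool}
    (hc : σ.reg 20 = c.toNat) (hu : σ.reg 21 = G.ends d.1 (!d.2))
    (ha : σ.reg 22 = 4 * ((N - s.runs) * m + d.1) + 3) :
    Represents L N Q K (Program.reveal.eval x σ) s
      (Function.update π d.1 (some ((π d.1).getD (c == d.2)))) ∧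
    (Program.reveal.eval x σ).reg 23 = (G.ends d.1 ((π d.1).getD (c == d.2))).val + 1 ∧
    (Program.reveal.eval x σ).reg 16 = σ.reg 16 := by
  obtain ⟨e, b⟩ := d
  have hb : G.ends e b = s.cur := L.ends_of_mem (List.mem_of_getElem? hd)
  have hmem := h.edges e
  simp only [] at ha hu
  have h1 := h.setReg (d := 23) (by norm_num) (tailWord G π e)
  simp only [Program.reveal, Program.block, Program.eval, Instr.eval, Program.skip, ha, hmem]
  cases hπ : π e with
  | some b' =>
    have : Function.update π e (some b') = π := by rw [← hπ, Function.update_eq_self]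
    simp only [tailWord, hπ, Option.getD_some, this] at h1 ⊢
    simp only [Store.reg_setReg, if_true, ne_eq, Nat.add_eq_zero_iff, one_ne_zero, and_false,
      not_false_iff]
    refine ⟨h1.setReg (by norm_num) _, ?_, ?_⟩ <;> simp
  | none =>
    simp only [tailWord, hπ] at h1 ⊢
    simp only [Option.getD_none, Store.reg_setReg, if_true, ne_eq, not_true, if_false,
      Nat.reduceEqDiff, hc, hu, ha, h.r4, h.r11]
    cases c
    · have h2 := h1.setReg (d := 23) (by norm_num) ((G.ends e !b).val + 1)
      have h3 := h2.setEdge e (some (false == b)) rfl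
      have hf : (false == b) = !b := by cases b <;> rfl
      simp only [tailWord, Function.update_self, hf] at h3
      simp only [hf, Bool.toNat_false, not_true, if_false]
      refine ⟨h3, ?_, ?_⟩ <;> simp
    · have h2 := h1.setReg (d := 23) (by norm_num) (s.cur.val + 1)
      have h3 := h2.setEdge e (some (true == b)) rfl
      have hf : (true == b) = b := by cases b <;> rfl
      simp only [tailWord, Function.update_self, hf, hb] at h3
      simp only [hf, Bool.toNat_true, one_ne_zero, not_false_iff, if_true, hb]
      refine ⟨h3, ?_, ?_⟩ <;> simp

end Simulation

section Simulation

variable {n m : ℕ} {G : Multigraph (Fin n) (Fin m)}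
variable {L : AdjList G} {N Q K : ℕ} {σ : Store} {s : Ctl n} {π : Fin m → Option Bool}
  {x : List ℕ}

theorem Represents.count (h : Represents L N Q K σ s π) (hle : s.bump s.stage ≤ n + N + 1) :
    Represents L N Q K (Program.count.eval x σ) { s with cnt := s.bump } π ∧
      (Program.count.eval x σ).reg 16 = σ.reg 16 := by
  have h1 := ((((h.setReg (d := 21) (by norm_num) (s.stage.val * 4)).setReg (d := 21) (by norm_num)
    (s.stage.val * 4 + 2)).setReg (d := 22) (by norm_num) (s.cnt s.stage)).setReg (d := 22)
    (by norm_num) (s.bump s.stage))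
  have heval : Program.count.eval x σ = ((((σ.setReg 21 (s.stage.val * 4)).setReg 21
      (s.stage.val * 4 + 2)).setReg 22 (s.cnt s.stage)).setReg 22 (s.bump s.stage)).setMem
      (4 * s.stage.val + 2) (s.bump s.stage) := by
    have hc := h.counts s.stage
    have e : s.stage.val * 4 + 2 = 4 * s.stage.val + 2 := by ring
    simp [Program.count, Program.block, Program.eval, Instr.eval, h.r10, h.r7, h.r5, h.r14, e, hc,
      Ctl.bump]
  rw [heval]
  set τ := (((σ.setReg 21 (s.stage.val * 4)).setReg 21
      (s.stage.val * 4 + 2)).setReg 22 (s.cnt s.stage)).setReg 22 (s.bump s.stage) with hτ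
  refine ⟨?_, by simp [hτ]⟩
  constructor
  case flag => intro u; rw [Store.mem_setMem, if_neg (by omega)]; exact h1.flag u
  case stack => intro k v hk; rw [Store.mem_setMem, if_neg (by omega)]; exact h1.stack k v hk
  case counts =>
    intro u
    rw [Store.mem_setMem]
    by_cases he : u = s.stage
    · subst he; rw [if_pos rfl]
    · have : u.val ≠ s.stage.val := fun h => he (Fin.ext h)
      rw [if_neg (by omega), h1.counts u]
      simp [Ctl.bump, he]
  case edges => intro e; rw [Store.mem_setMem, if_neg (by omega)]; exact h1.edges e
  case fresh => intro k hk; rw [Store.mem_setMem, if_neg (by omega)]; exact h1.fresh k hk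
  case mem_le =>
    intro a
    rw [Store.mem_setMem]; split_ifs
    · exact hle
    · exact h1.mem_le a
  case big => exact h1.big
  all_goals rw [Store.reg_setMem]
  exacts [h1.r0, h1.r1, h1.r2, h1.r3, h1.r4, h1.r5, h1.r6, h1.r7, h1.r8, h1.r9, h1.r10, h1.r11,
    h1.r12, h1.r13, h1.r14, h1.r15, h1.r17, h1.r18, h1.r19]

theorem Represents.rewind (hx : Encodes x L)
    (h : Represents L N Q K (σ.setReg 12 (L.start s.cur)) s π) :
    Represents L N Q K (Program.rewind.eval x σ) s π ∧
      (Program.rewind.eval x σ).reg 16 = σ.reg 16 := by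
  have h6 : σ.reg 6 = 3 := by simpa using h.r6
  have h11 : σ.reg 11 = s.cur := by simpa using h.r11
  have hp := hx.pointer s.cur s.cur.2.le
  refine ⟨?_, by simp [Program.rewind, Program.block, Program.eval, Instr.eval]⟩
  refine h.congr (fun i hi hi' => ?_) rfl
  simp only [Program.rewind, Program.block, Program.eval, Instr.eval, Store.reg_setReg, h6, h11,
    if_true, hp]
  split_ifs
  · rfl
  · omega
  · rfl

/-- Register `12` still refers to the old vertex until `Program.rewind` has run; hence the patched
store in the conclusion. The same holds for the two lemmas on `nextStage`. -/
theorem Represents.popStack (h : Represents L N Q K σ s π) {u : Fin n} {l : List (Fin n)}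
    (hst : s.st = u :: l) (hnd : s.st.Nodup) (hr : s.reset = false) :
    Represents L N Q K ((Program.popStack.eval x σ).setReg 12 (L.start u))
      ⟨s.runs, s.stage, u, l, s.first, false, 0, s.cnt⟩ π ∧
      (Program.popStack.eval x σ).reg 16 = σ.reg 16 := by
  have hlen : s.st.length - 1 = l.length := by simp [hst]
  have htop : σ.mem (4 * l.length + 1) = u := by
    refine h.stack _ _ ?_
    rw [hst, List.reverse_cons, List.getElem?_append_right (by simp)]
    simp
  have heval : Program.popStack.eval x σ = ((((((σ.setReg 13 l.length).setReg 21
      (4 * l.length)).setReg 21 (4 * l.length + 1)).setReg 11 u.val).setReg 21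
      (4 * u.val)).setReg 22 0).setMem (4 * u.val) 0 := by
    simp only [Program.popStack, Program.block, Program.eval, Instr.eval, Store.reg_setReg,
      Store.mem_setReg, Nat.reduceEqDiff, if_true, if_false, h.r13, h.r7, h.r4, hlen,
      mul_comm _ 4, htop]
  rw [heval]
  refine ⟨?_, by simp⟩
  rw [hst, List.nodup_cons] at hnd
  constructor
  case flag =>
    intro w
    rw [Store.mem_setReg, Store.mem_setMem]
    simp only [Store.mem_setReg]
    rw [h.flag w, hst]
    by_cases hw : w = u
    · subst hw; simp [hnd.1]
    · have : w.val ≠ u.val := fun h => hw (Fin.ext h)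
      rw [if_neg (by omega)]; simp [hw]
  case stack =>
    intro k v hk
    rw [Store.mem_setReg, Store.mem_setMem, if_neg (by omega)]
    refine h.stack k v ?_
    rw [hst, List.reverse_cons]
    rw [List.getElem?_append_left]
    · exact hk
    · exact (List.getElem?_eq_some_iff.1 hk).1
  case counts => intro w; rw [Store.mem_setReg, Store.mem_setMem, if_neg (by omega)]; exact h.counts w
  case edges => intro e; rw [Store.mem_setReg, Store.mem_setMem, if_neg (by omega)]; exact h.edges e
  case fresh =>
    intro k hk; rw [Store.mem_setReg, Store.mem_setMem, if_neg (by omega)]; exact h.fresh k hk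
  case mem_le =>
    intro a; rw [Store.mem_setReg, Store.mem_setMem]; split_ifs
    · omega
    · exact h.mem_le a
  case big =>
    intro i hi
    have := h.big i hi
    simp only [Store.reg_setReg, Store.reg_setMem]
    split_ifs <;> omega
  all_goals simp [h.r0, h.r1, h.r2, h.r3, h.r4, h.r5, h.r6, h.r7, h.r8, h.r9, h.r10, h.r14,
    h.r15, h.r17, h.r18, h.r19, hr]

theorem Represents.nextStage_of_lt (h : Represents L N Q K σ s π) (hst : s.st = [])
    (hr : s.reset = false) (hlt : s.stage.val + 1 < n) :
    Represents L N Q K ((Program.nextStage.eval x σ).setReg 12 (L.start (s.stage.val + 1)))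
      ⟨s.runs, ⟨s.stage.val + 1, hlt⟩, ⟨s.stage.val + 1, hlt⟩, [], true, false, 0, s.cnt⟩ π ∧
      (Program.nextStage.eval x σ).reg 16 = σ.reg 16 := by
  have hne : n - (s.stage.val + 1) ≠ 0 := by omega
  have heval : Program.nextStage.eval x σ = ((((σ.setReg 10 (s.stage.val + 1)).setReg 14 1).setReg
      21 (n - (s.stage.val + 1))).setReg 22 0).setReg 11 (s.stage.val + 1) := by
    simp [Program.nextStage, Program.block, Program.eval, Instr.eval, h.r10, h.r4, h.r3, hne]
  rw [heval]
  refine ⟨?_, by simp⟩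
  have hs := h.stack
  have hf := h.flag
  rw [hst] at hs hf
  constructor
  case flag => exact hf
  case stack => exact hs
  case counts => exact h.counts
  case edges => exact h.edges
  case fresh => exact h.fresh
  case mem_le => exact h.mem_le
  case big =>
    intro i hi
    have := h.big i hi
    simp only [Store.reg_setReg]
    split_ifs <;> omega
  all_goals simp [h.r0, h.r1, h.r2, h.r3, h.r4, h.r5, h.r6, h.r7, h.r8, h.r9, h.r13, hst,
    h.r15, h.r17, h.r18, h.r19, hr]

/-- The next block of directions has never been written (`fresh`), so all edges count as unrevealed
at once. -/
theorem Represents.nextStage_of_not_lt [NeZero n] (h : Represents L N Q K σ s π) (hst : s.st = [])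
    (hr : s.reset = false) (hlt : ¬ s.stage.val + 1 < n) (h0 : s.runs ≠ 0) (hN : s.runs ≤ N) :
    Represents L N Q K ((Program.nextStage.eval x σ).setReg 12 (L.start 0))
      ⟨s.runs - 1, 0, 0, [], true, false, 0, s.cnt⟩ (fun _ => none) ∧
      (Program.nextStage.eval x σ).reg 16 = σ.reg 16 := by
  have hne : n - (s.stage.val + 1) = 0 := by omega
  have heval : Program.nextStage.eval x σ = (((((((σ.setReg 10 (s.stage.val + 1)).setReg 14
      1).setReg 21 0).setReg 22 0).setReg 10 0).setReg 11 0).setReg 8 (s.runs - 1)).setReg 9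
      ((N - s.runs) * m + m) := by
    simp [Program.nextStage, Program.block, Program.eval, Instr.eval, h.r10, h.r4, h.r3, hne, h.r8,
      h.r9, h.r1]
  rw [heval]
  refine ⟨?_, by simp⟩
  have hs := h.stack
  have hf := h.flag
  rw [hst] at hs hf
  have hbase : (N - (s.runs - 1)) * m = (N - s.runs) * m + m := by
    rw [show N - (s.runs - 1) = N - s.runs + 1 by omega]; ring
  constructor
  case flag => exact hf
  case stack => exact hs
  case counts => exact h.counts
  case edges => intro e; rw [hbase]; exact h.fresh _ (by omega)
  case fresh => intro k hk; rw [hbase] at hk; exact h.fresh _ (by omega)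
  case mem_le => exact h.mem_le
  case big =>
    intro i hi
    have := h.big i hi
    simp only [Store.reg_setReg]
    split_ifs <;> omega
  all_goals simp [h.r0, h.r1, h.r2, h.r3, h.r4, h.r5, h.r6, h.r7, h.r13, hst,
    h.r15, h.r17, h.r18, h.r19, hr, hbase]

theorem Represents.success [NeZero n] (hx : Encodes x L) (h : Represents L N Q K σ s π)
    (hs : s.Safe L N) (hr : s.reset = false) (h0 : s.runs ≠ 0) :
    Represents L N Q K (Program.success.eval x σ) s.succ
      (if s.EndsRun then fun _ => none else π) ∧
      (Program.success.eval x σ).reg 16 = σ.reg 16 := by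
  have hle : s.bump s.stage ≤ n + N + 1 := by
    have := hs.cnt_le s.stage
    cases hf : s.first <;> simp [Ctl.bump, hf] at this ⊢ <;> omega
  obtain ⟨h1, h16⟩ := h.count (x := x) hle
  have h13 := h1.r13
  simp only [Program.success, Program.eval, h13]
  rw [← h16]
  generalize Program.count.eval x σ = τ at h1 h13
  rcases s.succ_cases with ⟨u, l, hst⟩ | ⟨hst, hlt⟩ | he
  · have hE : ¬ s.EndsRun := fun he => by rw [he.1] at hst; cases hst
    obtain ⟨h2, h16'⟩ := h1.popStack (x := x) (u := u) (l := l) hst hs.nodup hr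
    rw [if_pos (by simp [hst]), if_neg hE, Ctl.succ_cons hst, ← h16']
    exact h2.rewind hx
  · have hE : ¬ s.EndsRun := fun he => he.2 hlt
    obtain ⟨h2, h16'⟩ := h1.nextStage_of_lt (x := x) hst hr hlt
    rw [if_neg (by simp [hst]), if_neg hE, Ctl.succ_next hst hlt, ← h16']
    exact h2.rewind hx
  · obtain ⟨h2, h16'⟩ := h1.nextStage_of_not_lt (x := x) he.1 hr he.2 h0 hs.runs_le
    rw [if_neg (by simp [he.1]), if_pos he, Ctl.succ_of_endsRun he, ← h16']
    exact h2.rewind hx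

theorem Represents.compare [NeZero n] (hx : Encodes x L) (h : Represents L N Q K σ s π)
    (hs : s.Safe L N) (hr : s.reset = false) (h0 : s.runs ≠ 0) {w : Fin n}
    (hw : σ.reg 23 = w.val + 1) :
    Represents L N Q K (Program.compare.eval x σ)
      (if w = s.cur then s.succ else { s with pos := s.pos + 1 })
      (if w = s.cur then if s.EndsRun then fun _ => none else π else π) ∧
      (Program.compare.eval x σ).reg 16 = σ.reg 16 := by
  have h1 := (((h.setReg (d := 24) (by norm_num) (s.cur.val + 1)).setReg (d := 25) (by norm_num)
    (s.cur - w)).setReg (d := 24) (by norm_num) (w - s.cur)).setReg (d := 24) (by norm_num)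
      ((w.val - s.cur) + (s.cur - w))
  have heval : Program.compare.eval x σ = (Program.branch 24 (.instr (.add 12 12 5))
      Program.success).eval x ((((σ.setReg 24 (s.cur.val + 1)).setReg 25
    (s.cur - w)).setReg 24 (w - s.cur)).setReg 24 ((w.val - s.cur) + (s.cur - w))) := by
    simp only [Program.compare, Program.block, Program.eval, Instr.eval, Store.reg_setReg, h.r11,
      h.r4, hw, if_true, Nat.reduceEqDiff, if_false, Nat.add_sub_add_right]
  rw [heval]
  have h16 : σ.reg 16 = ((((σ.setReg 24 (s.cur.val + 1)).setReg 25
    (s.cur - w)).setReg 24 (w - s.cur)).setReg 24 ((w.val - s.cur) + (s.cur - w))).reg 16 := by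
    simp
  have h24 : ((((σ.setReg 24 (s.cur.val + 1)).setReg 25
    (s.cur - w)).setReg 24 (w - s.cur)).setReg 24 ((w.val - s.cur) + (s.cur - w))).reg 24 =
      (w.val - s.cur) + (s.cur - w) := by simp
  rw [h16]
  generalize (((σ.setReg 24 (s.cur.val + 1)).setReg 25
    (s.cur - w)).setReg 24 (w - s.cur)).setReg 24 ((w.val - s.cur) + (s.cur - w)) = τ at h1 h24
  simp only [Program.eval, h24]
  by_cases hwc : w = s.cur
  · rw [if_neg (by rw [hwc]; simp), if_pos hwc, if_pos hwc]
    exact h1.success hx hs hr h0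
  · have : w.val ≠ s.cur.val := fun h => hwc (Fin.ext h)
    rw [if_pos (by omega), if_neg hwc, if_neg hwc]
    refine ⟨?_, by simp [Instr.eval]⟩
    constructor
    case flag => exact h1.flag
    case stack => exact h1.stack
    case counts => exact h1.counts
    case edges => exact h1.edges
    case fresh => exact h1.fresh
    case mem_le => exact h1.mem_le
    case big =>
      intro i hi
      have := h1.big i hi
      simp only [Instr.eval, Store.reg_setReg]
      split_ifs <;> omega
    case r12 => simp [Instr.eval, h1.r12, h1.r5]; ring
    all_goals simp [Instr.eval, h1.r0, h1.r1, h1.r2, h1.r3, h1.r4, h1.r5, h1.r6, h1.r7, h1.r8,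
      h1.r9, h1.r10, h1.r11, h1.r13, h1.r14, h1.r15, h1.r17, h1.r18, h1.r19]

theorem start_add_four (hx : Encodes x L) (v : Fin n) :
    x.getD (v + 4) 0 = L.start v + 2 * (L.list v).length := by
  rw [← start_succ, ← hx.pointer (v + 1) v.2]

theorem Represents.scan [NeZero n] (hx : Encodes x L) (h : Represents L N Q K σ s π)
    (hs : s.Safe L N) (hr : s.reset = false) (h0 : s.runs ≠ 0) {c : Bool}
    (hc : σ.reg 20 = c.toNat) :
    Represents L N Q K (Program.scan.eval x σ) (lazyStep L s π c).1 (lazyStep L s π c).2 ∧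
      (Program.scan.eval x σ).reg 16 = σ.reg 16 := by
  have hp := start_add_four hx s.cur
  have hpos := hs.pos_le
  set y := L.start s.cur + 2 * (L.list s.cur).length - (L.start s.cur + 2 * s.pos) with hy
  have h1 := ((h.setReg (d := 21) (by norm_num) (s.cur.val + 4)).setReg (d := 21) (by norm_num)
    (L.start s.cur + 2 * (L.list s.cur).length)).setReg (d := 21) (by norm_num) y
  have heval : Program.scan.eval x σ = (Program.branch 21
      (.seq Program.fetch (.seq Program.reveal Program.compare))
      (Program.block [.const 15 1] (.instr (.const 14 0)))).eval x (((σ.setReg 21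
        (s.cur.val + 4)).setReg 21 (L.start s.cur + 2 * (L.list s.cur).length)).setReg 21 y) := by
    simp only [Program.scan, Program.block, Program.eval, Instr.eval, Store.reg_setReg, h.r11,
      h.r7, h.r12, hp, if_true, Nat.reduceEqDiff, if_false, hy]
  rw [heval]
  have h16 : σ.reg 16 = (((σ.setReg 21 (s.cur.val + 4)).setReg 21
      (L.start s.cur + 2 * (L.list s.cur).length)).setReg 21 y).reg 16 := by simp
  have h20 : (((σ.setReg 21 (s.cur.val + 4)).setReg 21
      (L.start s.cur + 2 * (L.list s.cur).length)).setReg 21 y).reg 20 = c.toNat := by simp [hc]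
  have h21 : (((σ.setReg 21 (s.cur.val + 4)).setReg 21
      (L.start s.cur + 2 * (L.list s.cur).length)).setReg 21 y).reg 21 = y := by simp
  rw [h16]
  generalize ((σ.setReg 21 (s.cur.val + 4)).setReg 21
      (L.start s.cur + 2 * (L.list s.cur).length)).setReg 21 y = τ at h1 h20 h21
  rw [Program.eval, h21]
  by_cases hlt : s.pos < (L.list s.cur).length
  · have hd : (L.list s.cur)[s.pos]? = some (L.list s.cur)[s.pos] := List.getElem?_eq_getElem hlt
    rw [if_pos (by omega)]
    rw [lazyStep, if_neg h0, if_neg (by simp [hr]), hd]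
    simp only []
    generalize (L.list s.cur)[s.pos] = d at hd
    obtain ⟨h2, h2a, h2b, h2c, h2d⟩ := h1.fetch hx hd
    rw [Program.eval, ← h2d]
    rw [h20] at h2a
    generalize Program.fetch.eval x τ = τ₂ at h2 h2a h2b h2c
    obtain ⟨h3, h3a, h3b⟩ := h2.reveal (x := x) hd h2a h2b h2c
    rw [Program.eval, ← h3b]
    generalize Program.reveal.eval x τ₂ = τ₃ at h3 h3a
    have h4 := h3.compare hx hs hr h0 h3a
    by_cases hw : G.ends d.1 ((π d.1).getD (c == d.2)) = s.cur
    · simpa only [if_pos hw] using h4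
    · simpa only [if_neg hw] using h4
  · have hd : (L.list s.cur)[s.pos]? = none := List.getElem?_eq_none (by omega)
    rw [if_neg (by omega)]
    rw [lazyStep, if_neg h0, if_neg (by simp [hr]), hd]
    simp only []
    refine ⟨?_, by simp [Program.block, Program.eval, Instr.eval]⟩
    constructor
    case flag => exact h1.flag
    case stack => exact h1.stack
    case counts => exact h1.counts
    case edges => exact h1.edges
    case fresh => exact h1.fresh
    case mem_le => exact h1.mem_le
    case big =>
      intro i hi
      have := h1.big i hi
      simp only [Program.block, Program.eval, Instr.eval, Store.reg_setReg]
      split_ifs <;> omega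
    all_goals simp [Program.block, Program.eval, Instr.eval, Ctl.sink, h1.r0, h1.r1, h1.r2, h1.r3,
      h1.r4, h1.r5, h1.r6, h1.r7, h1.r8, h1.r9, h1.r10, h1.r11, h1.r12, h1.r13, h1.r17, h1.r18,
      h1.r19]

theorem Represents.forget (h : Represents L N Q K σ s π) {e : Fin m}
    (ha : σ.reg 22 = 4 * ((N - s.runs) * m + e) + 3) :
    Represents L N Q K (Program.forget.eval x σ) s (Function.update π e none) ∧
      (Program.forget.eval x σ).reg 21 = σ.reg 21 ∧
      (Program.forget.eval x σ).reg 16 = σ.reg 16 := by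
  have h1 := (h.setReg (d := 23) (by norm_num) 0).setEdge e none (w := 0) (by simp [tailWord])
  have heval : Program.forget.eval x σ =
      (σ.setReg 23 0).setMem (4 * ((N - s.runs) * m + e) + 3) 0 := by
    simp [Program.forget, Program.block, Program.eval, Instr.eval, ha]
  rw [heval]
  exact ⟨h1, by simp, by simp⟩

theorem Represents.pushStack (h : Represents L N Q K σ s π) {u : Fin n}
    (hu : σ.reg 21 = u) :
    Represents L N Q K (Program.pushStack.eval x σ) { s with st := s.push u } π ∧
      (Program.pushStack.eval x σ).reg 16 = σ.reg 16 := by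
  have h1 := (h.setReg (d := 24) (by norm_num) (s.stage.val + 1)).setReg (d := 24) (by norm_num)
    (s.stage.val + 1 - u)
  by_cases hle : u ≤ s.stage
  · have hle' : u.val ≤ s.stage.val := hle
    have hpos : s.stage.val + 1 - u.val ≠ 0 := by omega
    have h2 := (h1.setReg (d := 22) (by norm_num) (4 * u.val)).setReg (d := 23) (by norm_num)
      (if u ∈ s.st then 1 else 0)
    by_cases hmem : u ∈ s.st
    · have hpush : s.push u = s.st := if_neg fun h => h.2 hmem
      rw [if_pos hmem] at h2
      have heval : Program.pushStack.eval x σ = ((((σ.setReg 24 (s.stage.val + 1)).setReg 24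
          (s.stage.val + 1 - u)).setReg 22 (4 * u.val)).setReg 23 1).setReg 25 0 := by
        have hf := h.flag u
        rw [if_pos hmem] at hf
        simp [Program.pushStack, Program.block, Program.eval, Instr.eval, h.r10, h.r4, h.r7, hu,
          hpos, mul_comm u.val 4, hf, Program.skip]
      rw [heval, hpush]
      exact ⟨h2.setReg (by norm_num) _, by simp⟩
    · have hpush : s.push u = u :: s.st := if_pos ⟨hle, hmem⟩
      have heval : Program.pushStack.eval x σ = ((((((((σ.setReg 24 (s.stage.val + 1)).setReg 24
          (s.stage.val + 1 - u)).setReg 22 (4 * u.val)).setReg 23 0).setMem (4 * u.val) 1).setReg 24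
          (4 * s.st.length)).setReg 24 (4 * s.st.length + 1)).setMem (4 * s.st.length + 1)
          u.val).setReg 13 (s.st.length + 1) := by
        have hf := h.flag u
        rw [if_neg hmem] at hf
        simp [Program.pushStack, Program.block, Program.eval, Instr.eval, h.r10, h.r4, h.r7, hu,
          hpos, mul_comm _ 4, hf, h.r13]
      rw [heval, hpush]
      refine ⟨?_, by simp⟩
      constructor
      case flag =>
        intro w
        simp only [Store.mem_setReg, Store.mem_setMem]
        rw [if_neg (by omega), h.flag w]
        by_cases hw : w = u
        · subst hw; simp
        · have : w.val ≠ u.val := fun h => hw (Fin.ext h)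
          rw [if_neg (by omega)]; simp [hw]
      case stack =>
        intro k v hk
        simp only [Store.mem_setReg, Store.mem_setMem]
        simp only [List.reverse_cons] at hk
        by_cases hkl : k = s.st.length
        · subst hkl
          rw [List.getElem?_append_right (by simp)] at hk
          simp at hk
          rw [if_pos rfl, hk]
        · rw [if_neg (by omega), if_neg (by omega)]
          refine h.stack k v ?_
          rcases lt_or_ge k s.st.length with hlt | hge
          · rwa [List.getElem?_append_left (by simpa using hlt)] at hk
          · rw [List.getElem?_eq_none (by simp; omega)] at hk; cases hk
      case counts =>
        intro w; simp only [Store.mem_setReg, Store.mem_setMem]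
        rw [if_neg (by omega), if_neg (by omega)]; exact h.counts w
      case edges =>
        intro w; simp only [Store.mem_setReg, Store.mem_setMem]
        rw [if_neg (by omega), if_neg (by omega)]; exact h.edges w
      case fresh =>
        intro w hw; simp only [Store.mem_setReg, Store.mem_setMem]
        rw [if_neg (by omega), if_neg (by omega)]; exact h.fresh w hw
      case mem_le =>
        intro a; simp only [Store.mem_setReg, Store.mem_setMem]
        have := u.2
        split_ifs
        · omega
        · omega
        · exact h.mem_le a
      case big =>
        intro i hi
        have := h.big i hi
        simp only [Store.reg_setReg, Store.reg_setMem]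
        split_ifs <;> omega
      all_goals simp [h.r0, h.r1, h.r2, h.r3, h.r4, h.r5, h.r6, h.r7, h.r8, h.r9, h.r10, h.r11,
        h.r12, h.r14, h.r15, h.r17, h.r18, h.r19]
  · have hle' : ¬ u.val ≤ s.stage.val := hle
    have hpos : s.stage.val + 1 - u.val = 0 := by omega
    have hpush : s.push u = s.st := if_neg fun h => hle h.1
    have heval : Program.pushStack.eval x σ = ((σ.setReg 24 (s.stage.val + 1)).setReg 24
        (s.stage.val + 1 - u)).setReg 25 0 := by
      simp [Program.pushStack, Program.block, Program.eval, Instr.eval, h.r10, h.r4, hu, hpos,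
        Program.skip]
    rw [heval, hpush]
    exact ⟨h1.setReg (by norm_num) _, by simp⟩

theorem Represents.resetEdges [NeZero n] (hx : Encodes x L) (h : Represents L N Q K σ s π)
    (hs : s.Safe L N) (hr : s.reset = true) (h0 : s.runs ≠ 0) (c : Bool) :
    Represents L N Q K (Program.resetEdges.eval x σ) (lazyStep L s π c).1 (lazyStep L s π c).2 ∧
      (Program.resetEdges.eval x σ).reg 16 = σ.reg 16 := by
  have hp := hx.pointer s.cur s.cur.2.le
  have hpos := hs.pos_le
  have hy : L.start s.cur + 2 * s.pos - L.start s.cur = 2 * s.pos := by omega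
  have h1 := ((h.setReg (d := 21) (by norm_num) (s.cur.val + 3)).setReg (d := 21) (by norm_num)
    (L.start s.cur)).setReg (d := 21) (by norm_num) (2 * s.pos)
  have heval : Program.resetEdges.eval x σ = (Program.branch 21
      (Program.block [.sub 12 12 5] (.seq Program.fetch (.seq Program.forget Program.pushStack)))
      (.instr (.const 15 0))).eval x (((σ.setReg 21 (s.cur.val + 3)).setReg 21
        (L.start s.cur)).setReg 21 (2 * s.pos)) := by
    simp only [Program.resetEdges, Program.block, Program.eval, Instr.eval, Store.reg_setReg, h.r11,
      h.r6, h.r12, hp, if_true, Nat.reduceEqDiff, if_false, hy]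
  rw [heval]
  have h16 : σ.reg 16 = (((σ.setReg 21 (s.cur.val + 3)).setReg 21
        (L.start s.cur)).setReg 21 (2 * s.pos)).reg 16 := by simp
  have h21 : (((σ.setReg 21 (s.cur.val + 3)).setReg 21
        (L.start s.cur)).setReg 21 (2 * s.pos)).reg 21 = 2 * s.pos := by simp
  rw [h16]
  generalize ((σ.setReg 21 (s.cur.val + 3)).setReg 21
        (L.start s.cur)).setReg 21 (2 * s.pos) = τ at h1 h21
  rw [Program.eval, h21]
  simp only [lazyStep, if_neg h0, hr, if_true]
  by_cases hp0 : s.pos = 0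
  · rw [if_neg (by omega), if_pos hp0]
    refine ⟨?_, by simp [Program.eval, Instr.eval]⟩
    constructor
    case flag => exact h1.flag
    case stack => exact h1.stack
    case counts => exact h1.counts
    case edges => exact h1.edges
    case fresh => exact h1.fresh
    case mem_le => exact h1.mem_le
    case big =>
      intro i hi
      have := h1.big i hi
      simp only [Program.eval, Instr.eval, Store.reg_setReg]
      split_ifs <;> omega
    all_goals simp [Program.eval, Instr.eval, h1.r0, h1.r1, h1.r2, h1.r3,
      h1.r4, h1.r5, h1.r6, h1.r7, h1.r8, h1.r9, h1.r10, h1.r11, h1.r12, h1.r13, h1.r14, h1.r17,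
      h1.r18, h1.r19]
  · have hlt : s.pos - 1 < (L.list s.cur).length := by omega
    have hd : (L.list s.cur)[s.pos - 1]? = some (L.list s.cur)[s.pos - 1] :=
      List.getElem?_eq_getElem hlt
    rw [if_pos (by omega), if_neg hp0]
    simp only [hd]
    generalize (L.list s.cur)[s.pos - 1] = d at hd
    have h2 : Represents L N Q K (τ.setReg 12 (L.start s.cur + 2 * (s.pos - 1)))
        { s with pos := s.pos - 1 } π := by
      constructor
      case flag => exact h1.flag
      case stack => exact h1.stack
      case counts => exact h1.counts
      case edges => exact h1.edges
      case fresh => exact h1.fresh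
      case mem_le => exact h1.mem_le
      case big =>
        intro i hi
        have := h1.big i hi
        simp only [Store.reg_setReg]
        split_ifs <;> omega
      all_goals simp [h1.r0, h1.r1, h1.r2, h1.r3,
        h1.r4, h1.r5, h1.r6, h1.r7, h1.r8, h1.r9, h1.r10, h1.r11, h1.r13, h1.r14, h1.r15, h1.r17,
        h1.r18, h1.r19]
    have hsub : (Instr.sub 12 12 5).eval x τ = τ.setReg 12 (L.start s.cur + 2 * (s.pos - 1)) := by
      simp only [Instr.eval, h1.r12, h1.r5]
      congr 1
      omega
    have h16' : τ.reg 16 = (τ.setReg 12 (L.start s.cur + 2 * (s.pos - 1))).reg 16 := by simp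
    rw [Program.eval_block, hsub, h16']
    simp only [Program.block]
    generalize τ.setReg 12 (L.start s.cur + 2 * (s.pos - 1)) = τ₂ at h2
    obtain ⟨h3, -, h3b, h3c, h3d⟩ := h2.fetch hx hd
    rw [Program.eval, ← h3d]
    generalize Program.fetch.eval x τ₂ = τ₃ at h3 h3b h3c
    obtain ⟨h4, h4a, h4b⟩ := h3.forget (x := x) h3c
    rw [Program.eval, ← h4b]
    rw [h3b] at h4a
    generalize Program.forget.eval x τ₃ = τ₄ at h4 h4a
    exact h4.pushStack h4a

theorem Represents.sampleStep [NeZero n] (hx : Encodes x L) (h : Represents L N Q K σ s π)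
    (hs : s.Safe L N) {c : Bool} (hc : σ.reg 20 = c.toNat) :
    Represents L N Q K (Program.sampleStep.eval x σ) (lazyStep L s π c).1 (lazyStep L s π c).2 ∧
      (∀ i, 20 ≤ i → (Program.sampleStep.eval x σ).reg i = 0) ∧
      (Program.sampleStep.eval x σ).reg 16 = σ.reg 16 := by
  have key : Represents L N Q K ((Program.branch 8 (.branch 15 Program.resetEdges Program.scan)
      Program.skip).eval x σ) (lazyStep L s π c).1 (lazyStep L s π c).2 ∧
      ((Program.branch 8 (.branch 15 Program.resetEdges Program.scan)
      Program.skip).eval x σ).reg 16 = σ.reg 16 := by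
    simp only [Program.eval, h.r8, h.r15]
    by_cases h0 : s.runs = 0
    · rw [if_neg (by simpa using h0)]
      simp only [lazyStep, if_pos h0]
      exact ⟨h.setReg (by norm_num) _, by simp [Program.skip, Program.eval, Instr.eval]⟩
    · rw [if_pos h0]
      cases hr : s.reset
      · rw [if_neg (by simp)]; exact h.scan hx hs hr h0 hc
      · rw [if_pos (by simp)]; exact h.resetEdges hx hs hr h0 c
  obtain ⟨h1, h2, h3⟩ := key.1.clear (x := x)
  exact ⟨h1, h2, h3.trans key.2⟩

/-- A trial raises a count by at most one, and the same trial raises the slack in `cnt_le` or lowers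
the number of runs. This holds for every sequence of coins, as the word bound demands. -/
theorem Ctl.Safe.lazyStep [NeZero n] (hs : s.Safe L N) (c : Bool) :
    (lazyStep L s π c).1.Safe L N := by
  rw [SFO.lazyStep]
  by_cases h0 : s.runs = 0
  · rw [if_pos h0]; exact hs
  rw [if_neg h0]
  by_cases hr : s.reset = true
  · rw [if_pos hr]
    by_cases hp : s.pos = 0
    · rw [if_pos hp]
      exact ⟨hs.nodup, hs.st_nil, by simp, hs.pos_le, hs.runs_le, hs.cnt_le,
        fun h => (h0 h).elim⟩
    rw [if_neg hp]
    split
    · exact hs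
    · refine ⟨?_, ?_, hs.first_of_reset, ?_, hs.runs_le, hs.cnt_le,
        fun h => (h0 h).elim⟩
      · simp only [Ctl.back, Ctl.push]
        split_ifs with h
        · exact List.nodup_cons.2 ⟨h.2, hs.nodup⟩
        · exact hs.nodup
      · simp [Ctl.back, hs.first_of_reset hr]
      · have := hs.pos_le
        simp only [Ctl.back]; omega
  · rw [if_neg hr]
    split
    · refine ⟨hs.nodup, by simp [Ctl.sink], by simp [Ctl.sink], hs.pos_le, hs.runs_le, ?_,
        fun h => (h0 h).elim⟩
      intro i
      refine (hs.cnt_le i).trans ?_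
      simp only [Ctl.sink]
      gcongr
      split_ifs <;> first | omega | (exfalso; tauto)
    · rename_i d hd
      by_cases hout : G.ends d.1 ((π d.1).getD (c == d.2)) = s.cur
      · rw [if_pos hout]
        have hb : ∀ i, s.bump i + s.runs ≤
            N + if i < s.stage ∨ i = s.stage then 1 else 0 := by
          intro i
          have := hs.cnt_le i
          by_cases hi : i = s.stage
          · subst hi
            cases hf : s.first <;> simp [Ctl.bump, hf] at this ⊢ <;> omega
          · simpa [Ctl.bump, hi] using this
        rcases s.succ_cases with ⟨u, l, hst⟩ | ⟨hst, hlt⟩ | he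
        · rw [Ctl.succ_cons hst]
          have hf : s.first = false := by
            cases hf : s.first
            · rfl
            · rw [hs.st_nil hf] at hst; cases hst
          have hnd := hs.nodup
          rw [hst, List.nodup_cons] at hnd
          refine ⟨hnd.2, by simp [hf], by simp, Nat.zero_le _, hs.runs_le, ?_, fun h => (h0 h).elim⟩
          simpa [hf] using hb
        · rw [Ctl.succ_next hst hlt]
          refine ⟨by simp, by simp, by simp, Nat.zero_le _, hs.runs_le, fun i => ?_,
            fun h => (h0 h).elim⟩
          refine (hb i).trans ?_
          simp only [Fin.lt_def, Fin.ext_iff]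
          gcongr
          split_ifs <;> omega
        · rw [Ctl.succ_of_endsRun he]
          have hb' : ∀ i, s.bump i + s.runs ≤ N + 1 := by
            intro i
            have h1 := hb i
            have h2 : i < s.stage ∨ i = s.stage := by
              have := he.2
              have := i.2
              rw [Fin.lt_def, Fin.ext_iff]; omega
            rwa [if_pos h2] at h1
          have := hs.runs_le
          refine ⟨by simp, by simp, by simp, Nat.zero_le _, ?_, fun i => ?_, fun h i => ?_⟩
          · simp only []; omega
          · have := hb' i
            simp only []; omega
          · have := hb' i
            simp only [] at h ⊢; omega
      · rw [if_neg hout]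
        refine ⟨hs.nodup, hs.st_nil, hs.first_of_reset, ?_, hs.runs_le, hs.cnt_le,
        fun h => (h0 h).elim⟩
        have := (List.getElem?_eq_some_iff.1 hd).1
        simp only []; omega

end Simulation

/-! ## The input words -/

section Input

variable {n m : ℕ} {G : Multigraph (Fin n) (Fin m)} (L : AdjList G) (a b : ℕ)

/-- The part of the input that describes the list of one vertex. -/
def adjWords (v : Fin n) : List ℕ :=
  (L.list v).flatMap fun d => [(G.ends d.1 (!d.2)).val, d.1.val]

theorem length_flatMap_pair {α : Type*} (l : List α) (f g : α → ℕ) :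
    (l.flatMap fun d => [f d, g d]).length = 2 * l.length := by
  induction l with
  | nil => rfl
  | cons c l ih =>
    rw [List.flatMap_cons, List.length_append, ih, List.length_cons]
    simp; ring

theorem getElem?_flatMap_pair {α : Type*} (l : List α) (f g : α → ℕ) (j : ℕ) (d : α)
    (h : l[j]? = some d) : (l.flatMap fun d => [f d, g d])[2 * j]? = some (f d) ∧
      (l.flatMap fun d => [f d, g d])[2 * j + 1]? = some (g d) := by
  induction l generalizing j with
  | nil => simp at h
  | cons c l ih =>
    cases j with
    | zero => simp at h; simp [h]
    | succ j =>
      simp only [List.getElem?_cons_succ] at h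
      have := ih j h
      simp only [List.flatMap_cons, Nat.mul_add, mul_one]
      simpa [List.getElem?_cons_succ, show 2 * j + 2 + 1 = 2 * j + 1 + 2 by ring] using this

theorem start_zero : L.start 0 = n + 4 := by simp [AdjList.start]

theorem start_eq_length (v : ℕ) (hv : v ≤ n) :
    L.start v = n + 4 + (((List.finRange n).take v).flatMap (adjWords L)).length := by
  induction v with
  | zero => simp [start_zero]
  | succ v ih =>
    have hv' : v < n := hv
    rw [start_succ L ⟨v, hv'⟩, ih hv'.le, List.take_add_one, List.flatMap_append,
      List.length_append]
    have : (List.finRange n)[v]? = some ⟨v, hv'⟩ := by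
      rw [List.getElem?_eq_getElem (by simpa using hv')]; simp
    rw [this]
    simp [adjWords]
    ring

theorem getElem?_adjWords (v : Fin n) (i : ℕ) (hi : i < (adjWords L v).length) :
    ((List.finRange n).flatMap (adjWords L))[L.start v - (n + 4) + i]? = (adjWords L v)[i]? := by
  have h : List.finRange n = (List.finRange n).take v ++ (v :: (List.finRange n).drop (v + 1)) := by
    conv_lhs => rw [← List.take_append_drop v.val (List.finRange n)]
    rw [List.drop_eq_getElem_cons (by simp)]
    simp
  have hs := start_eq_length L v v.2.le
  conv_lhs => rw [h]
  rw [List.flatMap_append, List.flatMap_cons, List.getElem?_append_right (by omega),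
    List.getElem?_append_left (by omega)]
  congr 1
  omega

theorem encode_eq : L.encode a b = ([n, a, b] ++ (List.range (n + 1)).map L.start) ++
    (List.finRange n).flatMap (adjWords L) := rfl

theorem encodes_encode : Encodes (L.encode a b) L := by
  have hlen : ([n, a, b] ++ (List.range (n + 1)).map L.start).length = n + 4 := by
    simp
  have key : ∀ (v : Fin n) (i : ℕ), i < (adjWords L v).length →
      (L.encode a b)[L.start v + i]? = (adjWords L v)[i]? := by
    intro v i hi
    have hs := start_eq_length L v v.2.le
    rw [← getElem?_adjWords L v i hi, encode_eq, List.getElem?_append_right (by omega), hlen]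
    congr 1
    omega
  constructor
  · intro v hv
    rw [encode_eq, List.getD_eq_getElem?_getD, List.getElem?_append_left (by omega)]
    simp [Nat.lt_succ_iff.2 hv]
  · intro v j d hd
    have hj := (List.getElem?_eq_some_iff.1 hd).1
    have h := (getElem?_flatMap_pair (L.list v) (fun d => (G.ends d.1 (!d.2)).val)
      (fun d => d.1.val) j d hd).1
    rw [List.getD_eq_getElem?_getD, key v _ (by rw [adjWords, length_flatMap_pair]; omega),
      adjWords, h]
    rfl
  · intro v j d hd
    have hj := (List.getElem?_eq_some_iff.1 hd).1
    have h := (getElem?_flatMap_pair (L.list v) (fun d => (G.ends d.1 (!d.2)).val)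
      (fun d => d.1.val) j d hd).2
    rw [List.getD_eq_getElem?_getD, add_assoc,
      key v _ (by rw [adjWords, length_flatMap_pair]; omega), adjWords, h]
    rfl

theorem sum_length_list : ∑ v, (L.list v).length = 2 * m := by
  have h1 : ∀ v, (L.list v).length =
      ((univ : Finset (Fin m × Bool)).filter fun d => G.ends d.1 d.2 = v).card := by
    intro v
    rw [← List.toFinset_card_of_nodup (L.nodup v)]
    congr 1
    ext d
    simp [L.mem_iff]
  simp_rw [h1]
  rw [← card_eq_sum_card_fiberwise (fun _ _ => by simp)]
  simp [mul_comm]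

/-- The input does not contain `m`; the program recovers it from this last pointer. -/
theorem start_last : L.start n = n + 4 + 4 * m := by
  rw [AdjList.start, filter_true_of_mem (fun u _ => u.2), ← mul_sum, sum_length_list]
  ring

theorem start_le (v : ℕ) : L.start v ≤ n + 4 + 4 * m := by
  rw [← start_last L, AdjList.start, AdjList.start]
  refine Nat.add_le_add_left (sum_le_sum_of_subset ?_) _
  intro u _
  simp

theorem encode_getD_le (hab : a < b) (i : ℕ) :
    (L.encode a b).getD i 0 ≤ n + 4 + 4 * m + b := by
  have h : ∀ w ∈ L.encode a b, w ≤ n + 4 + 4 * m + b := by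
    intro w hw
    rw [encode_eq, List.mem_append, List.mem_append, List.mem_map, List.mem_flatMap] at hw
    rcases hw with (hw | ⟨v, -, rfl⟩) | ⟨v, -, hw⟩
    · simp at hw
      rcases hw with rfl | rfl | rfl <;> omega
    · exact (start_le L v).trans (by omega)
    · rw [adjWords, List.mem_flatMap] at hw
      obtain ⟨d, -, hd⟩ := hw
      have h1 := d.1.2
      have h2 := (G.ends d.1 (!d.2)).2
      simp only [List.mem_cons, List.not_mem_nil, or_false] at hd
      rcases hd with rfl | rfl <;> omega
  rw [List.getD_eq_getElem?_getD]
  cases hi : (L.encode a b)[i]? with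
  | none => simp
  | some w => exact h w (List.mem_of_getElem? hi)

end Input

/-! ## The loops -/

namespace Program

/-- Repeat a step of the sampler as often as register `16` says. -/
def sampleLoop : Program :=
  .loop 16 (.seq (.instr (.flip 20)) (.seq sampleStep (.instr (.sub 16 16 4))))

/-- Multiply the mantissa by the next estimated probability. -/
def multiply : Program :=
  block [.mul 22 10 7, .add 22 22 5, .load 22 22, .mul 0 0 22, .div 0 0 17] (.instr (.add 10 10 4))

/-- Double the mantissa. -/
def double : Program := block [.add 0 0 0] (.instr (.add 2 2 4))

/-- One step of the computation of the product of the estimated probabilities. -/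
def productStep : Program :=
  .seq (block [.sub 20 3 10]
    (.branch 20 (block [.add 21 0 4, .sub 21 21 18] (.branch 21 multiply double)) skip))
    (.instr (.sub 19 19 4))

/-- The computation of the product of the estimated probabilities. -/
def productLoop : Program := .loop 19 productStep

end Program

section Loops

variable {n m : ℕ} {G : Multigraph (Fin n) (Fin m)}
variable {L : AdjList G} {N Q K : ℕ} {σ : Store} {s : Ctl n} {π : Fin m → Option Bool}
  {x : List ℕ} {A : Set ℝ}

theorem Ctl.Safe.cnt_le' (hs : s.Safe L N) (i : Fin n) : s.cnt i ≤ N := by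
  by_cases h0 : s.runs = 0
  · exact hs.cnt_le_of_done h0 i
  · have := hs.cnt_le i
    split_ifs at this <;> omega

/-- The bounds for words between two steps of the sampler. -/
structure WordBound (n m N Q K F B : ℕ) : Prop where
  const : 1600 ≤ B
  small : 4 * n + N + 3 ≤ B
  base : N * m ≤ B
  input : n + 4 + 4 * m ≤ B
  product : 2 * Q * (N + 1) + 1 ≤ B
  fuel : F ≤ B
  fuel' : K ≤ B

theorem Represents.boundedBy (h : Represents L N Q K σ s π) (hs : s.Safe L N) {F B : ℕ}
    (hB : WordBound n m N Q K F B) (hF : σ.reg 16 ≤ F) (h0 : ∀ i, 20 ≤ i → σ.reg i = 0) :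
    σ.BoundedBy B := by
  have hc := hB.const
  have hsm := hB.small
  have hba := hB.base
  have hin := hB.input
  have hpr := hB.product
  have hfu := hB.fuel
  have hfu' := hB.fuel'
  have hQ : 2 * Q ≤ 2 * Q * (N + 1) := Nat.le_mul_of_pos_right _ (by omega)
  have h12 : L.start s.cur + 2 * s.pos ≤ n + 4 + 4 * m := by
    have h1 := start_succ L s.cur
    have h2 := start_le L (s.cur + 1)
    have h3 := hs.pos_le
    omega
  have hlen : s.st.length ≤ n := by
    have := hs.nodup.length_le_card
    simpa using this
  have hruns := hs.runs_le
  have h9 : (N - s.runs) * m ≤ N * m := Nat.mul_le_mul_right _ (Nat.sub_le _ _)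
  have hst := s.stage.2
  have hcu := s.cur.2
  refine ⟨fun i => ?_, fun a => (h.mem_le a).trans (by omega)⟩
  by_cases hi : i < 20
  · interval_cases i
    · rw [h.r0]; omega
    · rw [h.r1]; omega
    · rw [h.r2]; omega
    · rw [h.r3]; omega
    · rw [h.r4]; omega
    · rw [h.r5]; omega
    · rw [h.r6]; omega
    · rw [h.r7]; omega
    · rw [h.r8]; omega
    · rw [h.r9]; omega
    · rw [h.r10]; omega
    · rw [h.r11]; omega
    · rw [h.r12]; omega
    · rw [h.r13]; omega
    · rw [h.r14]; have := Bool.toNat_le s.first; omega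
    · rw [h.r15]; have := Bool.toNat_le s.reset; omega
    · omega
    · rw [h.r17]; omega
    · rw [h.r18]; omega
    · rw [h.r19]; omega
  · rw [h0 i (by omega)]; omega

theorem lazyValue_nonneg [NeZero n] {t : Ctl n → ℝ} (ht : ∀ s, 0 ≤ t s) (F : ℕ) : ∀ (s : Ctl n)
    (π : Fin m → Option Bool), 0 ≤ lazyValue L t 0 F s π := by
  induction F with
  | zero => intro s π; exact ht s
  | succ F ih =>
    intro s π
    simp only [lazyValue, ite_self, zero_add]
    exact div_nonneg (add_nonneg (ih _ _) (ih _ _)) (by norm_num)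

theorem Program.sampleStep_det : Program.sampleStep.Det 1600 := by
  simp [Program.sampleStep, Program.resetEdges, Program.scan, Program.skip, Program.clear,
    Program.block, Program.Det, Instr.Det, Program.fetch, Program.forget, Program.pushStack,
    Program.reveal, Program.compare, Program.success, Program.count, Program.popStack,
    Program.nextStage, Program.rewind]

/-- A bound for the number of steps of one round of the main loop. -/
def Program.sampleCost : ℕ := (Program.seq Program.sampleStep (.instr (.sub 16 16 4))).cost

/-- If the rest of the program succeeds with probability at least `t s` from each final state `s`,
then the loop followed by the rest succeeds with at least the expectation of `t`, which is
`lazyValue` without charge. Within a round words may grow up to `W`, but each round ends in a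
representing store with cleared scratch registers, and these are bounded by `B` again. -/
theorem Represents.good_sampleLoop [NeZero n] (hx : Encodes x L) {F₀ B W T : ℕ}
    (hB : WordBound n m N Q K F₀ B) (hxB : ∀ a, x.getD a 0 ≤ B)
    (hW : B ^ 2 ^ Program.sampleCost ≤ W) {t : Ctl n → ℝ} (ht : ∀ s, 0 ≤ t s) {k : List Program}
    (hk : ∀ (σ : Store) (s : Ctl n) (π : Fin m → Option Bool), Represents L N Q K σ s π →
      s.Safe L N → σ.reg 16 = 0 → (∀ i, 20 ≤ i → σ.reg i = 0) →
      Config.Good x A W T (t s) ⟨k, σ⟩) (F : ℕ) :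
    ∀ (σ : Store) (s : Ctl n) (π : Fin m → Option Bool), F ≤ F₀ → Represents L N Q K σ s π →
      s.Safe L N → σ.reg 16 = F → (∀ i, 20 ≤ i → σ.reg i = 0) →
      Config.Good x A W (T + 1 + F * (Program.sampleCost + 3)) (lazyValue L t 0 F s π)
        ⟨Program.sampleLoop :: k, σ⟩ := by
  have hBW : B ≤ W := (Nat.le_self_pow (by positivity) B).trans hW
  have hc := hB.const
  induction F with
  | zero =>
    intro σ s π hF h hs h16 h0
    have hb := h.boundedBy hs hB (by omega) h0
    refine Config.Good.mono (Config.Good.of_step (d := ⟨k, σ⟩) ?_ (hb.mono hBW)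
      (hk σ s π h hs h16 h0)) (by omega)
    simp only [Program.sampleLoop, Config.step, h16]
    rfl
  | succ F ih =>
    intro σ s π hF h hs h16 h0
    have hb := h.boundedBy hs hB (by omega) h0
    have half : ∀ c : Bool, Config.Good x A W (T + 1 + F * (Program.sampleCost + 3) +
        Program.sampleCost)
        (lazyValue L t 0 F (lazyStep L s π c).1 (lazyStep L s π c).2)
        ⟨.seq Program.sampleStep (.instr (.sub 16 16 4)) :: Program.sampleLoop :: k,
          σ.setReg 20 c.toNat⟩ := by
      intro c
      have h1 := h.setReg (d := 20) (by norm_num) c.toNat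
      have h16' : (σ.setReg 20 c.toNat).reg 16 = F + 1 := by simp [h16]
      obtain ⟨h2, h2a, h2b⟩ := h1.sampleStep hx hs (c := c) (by simp)
      rw [h16'] at h2b
      have hb1 : (σ.setReg 20 c.toNat).BoundedBy B :=
        hb.setReg ((Bool.toNat_le c).trans (by omega))
      refine Config.Good.of_eval (K := 1600) (B := B) ?_ hc (by omega) hxB hb1 hW ?_
      · exact ⟨Program.sampleStep_det, trivial⟩
      · have e : (Program.seq Program.sampleStep (.instr (.sub 16 16 4))).eval x
            (σ.setReg 20 c.toNat) =
            (Program.sampleStep.eval x (σ.setReg 20 c.toNat)).setReg 16 F := by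
          simp only [Program.eval, Instr.eval, h2b, h2.r4, Nat.add_sub_cancel]
        rw [e]
        refine ih _ _ _ (by omega) ?_ (hs.lazyStep c) (by simp) ?_
        · exact h2.congr (fun i _ hi => by rw [Store.reg_setReg, if_neg hi]) rfl
        · intro i hi
          rw [Store.reg_setReg, if_neg (by omega)]
          exact h2a i hi
    have h1 := Config.Good.of_flip (r := 20) (hb.mono hBW) (lazyValue_nonneg ht F _ _)
      (lazyValue_nonneg ht F _ _) (half true) (half false)
    have h2 := Config.Good.of_step (c := ⟨.seq (.instr (.flip 20)) (.seq Program.sampleStep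
      (.instr (.sub 16 16 4))) :: Program.sampleLoop :: k, σ⟩) rfl (hb.mono hBW) h1
    have h3 := Config.Good.of_step (x := x) (c := ⟨Program.sampleLoop :: k, σ⟩)
      (by simp only [Program.sampleLoop, Config.step, h16]; rfl) (hb.mono hBW) h2
    have e : lazyValue L t 0 (F + 1) s π =
        (lazyValue L t 0 F (lazyStep L s π true).1 (lazyStep L s π true).2 +
          lazyValue L t 0 F (lazyStep L s π false).1 (lazyStep L s π false).2) / 2 := by
      simp only [lazyValue, ite_self, zero_add]
    rw [e]
    exact h3.mono (by ring_nf; omega)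

/-- The step that the product loop performs on the mantissa, the negative exponent and the number of
factors. -/
def productNext (n N Q : ℕ) (c : ℕ → ℕ) (p : ℕ × ℕ × ℕ) : ℕ × ℕ × ℕ :=
  if p.2.2 < n then
    if Q ≤ p.1 then (p.1 * c p.2.2 / N, p.2.1, p.2.2 + 1) else (p.1 + p.1, p.2.1 + 1, p.2.2)
  else p

/-- The store holds the given state of the computation of the product. -/
structure HoldsProduct (n m N Q : ℕ) (c : ℕ → ℕ) (σ : Store) (p : ℕ × ℕ × ℕ) : Prop where
  r0 : σ.reg 0 = p.1
  r1 : σ.reg 1 = m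
  r2 : σ.reg 2 = p.2.1
  r3 : σ.reg 3 = n
  r4 : σ.reg 4 = 1
  r5 : σ.reg 5 = 2
  r7 : σ.reg 7 = 4
  r10 : σ.reg 10 = p.2.2
  r17 : σ.reg 17 = N
  r18 : σ.reg 18 = Q
  counts : ∀ i < n, σ.mem (4 * i + 2) = c i
  count_le : ∀ i < n, c i ≤ N
  mantissa_le : p.1 ≤ 2 * Q
  index_le : p.2.2 ≤ n

theorem Program.productStep_det : Program.productStep.Det 1600 := by
  simp [Program.productStep, Program.skip, Program.block, Program.Det, Instr.Det,
    Program.multiply, Program.double]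

variable {c : ℕ → ℕ} {p : ℕ × ℕ × ℕ}

theorem HoldsProduct.boundedBy_of_eq {F₀ B : ℕ} (hB : WordBound n m N Q K F₀ B) {y : ℕ}
    (hy : y ≤ 2 * Q * (N + 1) + 1 ∨ y ≤ 4 * n + N + 3 ∨ y ≤ K) : y ≤ B := by
  have h1 := hB.product
  have h2 := hB.small
  have h3 := hB.fuel'
  omega

theorem HoldsProduct.step {F₀ B T : ℕ} (h : HoldsProduct n m N Q c σ p)
    (hB : WordBound n m N Q K F₀ B) (hb : σ.BoundedBy B) (h19 : σ.reg 19 = T + 1)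
    (he : p.2.1 + (T + 1) ≤ K) :
    HoldsProduct n m N Q c (Program.productStep.eval x σ) (productNext n N Q c p) ∧
      (Program.productStep.eval x σ).BoundedBy B ∧
      (Program.productStep.eval x σ).reg 19 = T ∧ (productNext n N Q c p).2.1 + T ≤ K := by
  obtain ⟨M, e, i⟩ := p
  have hM : M ≤ 2 * Q := h.mantissa_le
  have hi : i ≤ n := h.index_le
  simp only [] at he
  have hc := hB.const
  have hQN : 2 * Q ≤ 2 * Q * (N + 1) := Nat.le_mul_of_pos_right _ (by omega)
  have hle : ∀ {y : ℕ}, (y ≤ 2 * Q * (N + 1) + 1 ∨ y ≤ 4 * n + N + 3 ∨ y ≤ K) → y ≤ B :=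
    fun hy => HoldsProduct.boundedBy_of_eq hB hy
  by_cases hin : i < n
  · have hne : n - i ≠ 0 := by omega
    by_cases hQM : Q ≤ M
    · have hne' : M + 1 - Q ≠ 0 := by omega
      have hci := h.count_le i hin
      have hMc : M * c i ≤ 2 * Q * (N + 1) := Nat.mul_le_mul hM (by omega)
      have hMN : M * c i / N ≤ 2 * Q := by
        refine le_trans (Nat.div_le_div_right (Nat.mul_le_mul hM hci)) ?_
        exact Nat.div_le_of_le_mul (by rw [mul_comm])
      have heval : Program.productStep.eval x σ = (((((((((σ.setReg 20 (n - i)).setReg 21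
          (M + 1)).setReg 21 (M + 1 - Q)).setReg 22 (i * 4)).setReg 22 (i * 4 + 2)).setReg 22
          (c i)).setReg 0 (M * c i)).setReg 0 (M * c i / N)).setReg 10 (i + 1)).setReg 19 T := by
        have hcm := h.counts i hin
        rw [mul_comm] at hcm
        simp only [Program.productStep, Program.multiply, Program.block, Program.eval, Instr.eval,
          Store.reg_setReg, Store.mem_setReg, Nat.reduceEqDiff, if_true, if_false, h.r3, h.r10,
          ne_eq, hne, not_false_iff, h.r0, h.r4, h.r18, hne', h.r7, h.r5, hcm, h.r17, h19,
          Nat.add_sub_cancel, OfNat.ofNat_ne_zero, OfNat.zero_ne_ofNat]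
      have hnext : productNext n N Q c (M, e, i) = (M * c i / N, e, i + 1) := by
        simp [productNext, hin, hQM]
      rw [heval, hnext]
      refine ⟨?_, ?_, by simp, by simp only []; omega⟩
      · refine ⟨by simp, ?_, ?_, ?_, ?_, ?_, ?_, by simp, ?_, ?_, ?_, h.count_le, hMN, hin⟩ <;>
          simp [h.r1, h.r2, h.r3, h.r4, h.r5, h.r7, h.r17, h.r18]
        exact h.counts
      · exact (((((((((hb.setReg (hle (by omega))).setReg (hle (by omega))).setReg
          (hle (by omega))).setReg (hle (by omega))).setReg (hle (by omega))).setReg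
          (hle (by omega))).setReg (hle (by omega))).setReg (hle (by omega))).setReg
          (hle (by omega))).setReg (hle (by omega))
    · have hne' : M + 1 - Q = 0 := by omega
      have heval : Program.productStep.eval x σ = (((((σ.setReg 20 (n - i)).setReg 21
          (M + 1)).setReg 21 (M + 1 - Q)).setReg 0 (M + M)).setReg 2 (e + 1)).setReg 19 T := by
        simp only [Program.productStep, Program.double, Program.block, Program.eval, Instr.eval,
          Store.reg_setReg, Nat.reduceEqDiff, if_true, if_false, h.r3, h.r10,
          ne_eq, hne, not_false_iff, h.r0, h.r4, h.r18, hne', h.r2, h19, not_true,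
          Nat.add_sub_cancel, OfNat.ofNat_ne_zero, OfNat.zero_ne_ofNat]
      have hnext : productNext n N Q c (M, e, i) = (M + M, e + 1, i) := by
        simp [productNext, hin, hQM]
      rw [heval, hnext]
      refine ⟨?_, ?_, by simp, by simp only []; omega⟩
      · refine ⟨by simp, ?_, ?_, ?_, ?_, ?_, ?_, ?_, ?_, ?_, ?_, h.count_le, ?_, hi⟩ <;>
          simp [h.r1, h.r3, h.r4, h.r5, h.r7, h.r17, h.r18, h.r10]
        · exact h.counts
        · omega
      · exact (((((hb.setReg (hle (by omega))).setReg (hle (by omega))).setReg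
          (hle (by omega))).setReg (hle (by omega))).setReg (hle (by omega))).setReg
          (hle (by omega))
  · have hne : n - i = 0 := by omega
    have heval : Program.productStep.eval x σ =
        ((σ.setReg 20 0).setReg 25 0).setReg 19 T := by
      simp only [Program.productStep, Program.skip, Program.block, Program.eval, Instr.eval,
        Store.reg_setReg, Nat.reduceEqDiff, if_true, if_false, h.r3, h.r10,
        ne_eq, hne, not_true, h.r4, h19, Nat.add_sub_cancel]
    have hnext : productNext n N Q c (M, e, i) = (M, e, i) := by
      simp [productNext, hin]
    rw [heval, hnext]
    refine ⟨?_, ?_, by simp, by simp only []; omega⟩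
    · refine ⟨?_, ?_, ?_, ?_, ?_, ?_, ?_, ?_, ?_, ?_, ?_, h.count_le, hM, hi⟩ <;>
        simp [h.r0, h.r1, h.r2, h.r3, h.r4, h.r5, h.r7, h.r17, h.r18, h.r10]
      exact h.counts
    · exact ((hb.setReg (Nat.zero_le _)).setReg (Nat.zero_le _)).setReg (hle (by omega))

theorem HoldsProduct.good_productLoop {F₀ B W : ℕ} {q : ℝ}
    (hB : WordBound n m N Q K F₀ B) (hxB : ∀ a, x.getD a 0 ≤ B)
    (hW : B ^ 2 ^ Program.productStep.cost ≤ W) (T : ℕ) :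
    ∀ (σ : Store) (p : ℕ × ℕ × ℕ), HoldsProduct n m N Q c σ p → σ.BoundedBy B →
      σ.reg 19 = T → p.2.1 + T ≤ K →
      (q ≤ 0 ∨ q ≤ 1 ∧ (((productNext n N Q c)^[T] p).1 : ℝ) * 2 ^ m /
        2 ^ ((productNext n N Q c)^[T] p).2.1 ∈ A) →
      Config.Good x A W (1 + T * (Program.productStep.cost + 1)) q ⟨[Program.productLoop], σ⟩ := by
  have hBW : B ≤ W := (Nat.le_self_pow (by positivity) B).trans hW
  have hc := hB.const
  induction T with
  | zero =>
    intro σ p h hb h19 he hq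
    refine Config.Good.mono (Config.Good.of_step (T := 0) (d := ⟨[], σ⟩) ?_ (hb.mono hBW) ?_)
      (by omega)
    · simp only [Program.productLoop, Config.step, h19]; rfl
    · refine Config.Good.of_halted (hb.mono hBW) ?_
      rwa [Store.output, h.r0, h.r1, h.r2]
  | succ T ih =>
    intro σ p h hb h19 he hq
    obtain ⟨h1, h2, h3, h4⟩ := h.step (x := x) hB hb h19 he
    rw [Function.iterate_succ_apply] at hq
    have h5 := Config.Good.of_eval (k := [Program.productLoop]) Program.productStep_det hc
      (by omega) hxB hb hW (ih _ _ h1 h2 h3 h4 hq)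
    refine Config.Good.mono (Config.Good.of_step (c := ⟨[Program.productLoop], σ⟩) ?_
      (hb.mono hBW) h5) (by ring_nf; omega)
    simp only [Program.productLoop, Config.step, h19]
    rfl

/-! ## The value of the product -/

/-- The number `(n - i) * (ℓ + 1) - log M` drops with every step: a doubling raises the logarithm by
one, and a multiplication removes `ℓ + 1` while the logarithm it may destroy is at most `ℓ`. The
mantissa stays positive because `N ≤ Q` and no count is zero. -/
theorem productNext_iterate_index {ℓ : ℕ} (hN : 0 < N) (hNQ : N ≤ Q) (hQ : Q ≤ 2 ^ ℓ)
    (hc : ∀ i < n, 1 ≤ c i) (T : ℕ) : ∀ p : ℕ × ℕ × ℕ, 1 ≤ p.1 → p.1 < 2 ^ (ℓ + 1) →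
    (∀ i < n, c i ≤ N) → p.2.2 ≤ n → (n - p.2.2) * (ℓ + 1) ≤ T + Nat.log 2 p.1 →
    ((productNext n N Q c)^[T] p).2.2 = n := by
  induction T with
  | zero =>
    rintro ⟨M, e, i⟩ hM hM' hcN hi h
    simp only [zero_add, Function.iterate_zero_apply] at hM hM' hi h ⊢
    have hlog : Nat.log 2 M < ℓ + 1 := Nat.log_lt_of_lt_pow (by omega) hM'
    by_contra hne
    have : 1 * (ℓ + 1) ≤ (n - i) * (ℓ + 1) := Nat.mul_le_mul_right _ (by omega)
    omega
  | succ T ih =>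
    rintro ⟨M, e, i⟩ hM hM' hcN hi h
    rw [Function.iterate_succ_apply]
    simp only [] at hM hM' hi h
    have hlog : Nat.log 2 M < ℓ + 1 := Nat.log_lt_of_lt_pow (by omega) hM'
    by_cases hin : i < n
    · by_cases hQM : Q ≤ M
      · have hnext : productNext n N Q c (M, e, i) = (M * c i / N, e, i + 1) := by
          simp [productNext, hin, hQM]
        rw [hnext]
        have h1 : 1 ≤ M * c i / N := by
          rw [Nat.one_le_div_iff hN]
          nlinarith [hc i hin]
        have h2 : M * c i / N ≤ M :=
          Nat.div_le_of_le_mul (by rw [mul_comm N]; exact Nat.mul_le_mul_left _ (hcN i hin))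
        refine ih _ h1 (by simp only []; omega) hcN hin ?_
        have h3 : (n - i) * (ℓ + 1) = (n - (i + 1)) * (ℓ + 1) + (ℓ + 1) := by
          rw [show n - i = n - (i + 1) + 1 by omega]; ring
        simp only []
        omega
      · have hnext : productNext n N Q c (M, e, i) = (M + M, e + 1, i) := by
          simp [productNext, hin, hQM]
        rw [hnext]
        refine ih _ (by simp only []; omega) (by simp only []; rw [pow_succ]; omega) hcN hi ?_
        simp only []
        have h3 : Nat.log 2 (M + M) = Nat.log 2 M + 1 := by
          rw [← two_mul, mul_comm]; exact Nat.log_mul_base (by norm_num) (by omega)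
        omega
    · have hnext : productNext n N Q c (M, e, i) = (M, e, i) := by simp [productNext, hin]
      rw [hnext]
      refine ih _ hM hM' hcN hi ?_
      simp only []
      rw [show n - i = 0 by omega]; simp

/-- The mantissa and the exponent approximate the product of the factors so far. -/
def ProductApprox (N : ℕ) (δ : ℝ) (c : ℕ → ℕ) (p : ℕ × ℕ × ℕ) : Prop :=
  (1 - δ) ^ p.2.2 * ∏ j ∈ range p.2.2, ((c j : ℝ) / N) ≤ p.1 / 2 ^ p.2.1 ∧
    (p.1 : ℝ) / 2 ^ p.2.1 ≤ ∏ j ∈ range p.2.2, ((c j : ℝ) / N)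

/-- Rounding down loses less than `1`, while the exact value is at least `Q / N ≥ 1 / δ`; so a
multiplication has relative error at most `δ`. Doublings are exact. -/
theorem ProductApprox.next {δ : ℝ} (hN : 0 < N) (hδ : N ≤ δ * Q) (hδ' : δ ≤ 1)
    (hc : ∀ i < n, 1 ≤ c i) (h : ProductApprox N δ c p) :
    ProductApprox N δ c (productNext n N Q c p) := by
  obtain ⟨M, e, i⟩ := p
  obtain ⟨h1, h2⟩ := h
  simp only [] at h1 h2
  by_cases hin : i < n
  · by_cases hQM : Q ≤ M
    · have hnext : productNext n N Q c (M, e, i) = (M * c i / N, e, i + 1) := by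
        simp [productNext, hin, hQM]
      rw [hnext]
      have hN' : (0 : ℝ) < N := by exact_mod_cast hN
      have hδ0 : 0 ≤ δ := by
        by_contra hneg
        have : δ * Q ≤ 0 := mul_nonpos_of_nonpos_of_nonneg (by linarith) (Nat.cast_nonneg _)
        linarith
      have hci : (1 : ℝ) ≤ c i := by exact_mod_cast hc i hin
      have hup : ((M * c i / N : ℕ) : ℝ) ≤ M * (c i / N) := by
        refine Nat.cast_div_le.trans (le_of_eq ?_)
        push_cast; ring
      have hQM' : (Q : ℝ) ≤ M := by exact_mod_cast hQM
      have hlo : (1 - δ) * (M * (c i / N)) ≤ ((M * c i / N : ℕ) : ℝ) := by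
        have hfl : ((M * c i : ℕ) : ℝ) / N < ((M * c i / N : ℕ) : ℝ) + 1 := by
          rw [← Nat.floor_div_eq_div (K := ℝ)]
          exact Nat.lt_floor_add_one _
        have hone : 1 ≤ δ * (M * (c i / N)) := by
          have : 1 ≤ δ * M / N := by
            rw [le_div_iff₀ hN', one_mul]
            exact hδ.trans (by gcongr)
          calc (1 : ℝ) ≤ δ * M / N * 1 := by linarith
            _ ≤ δ * M / N * c i := by gcongr
            _ = _ := by ring
        push_cast at hfl
        have e : (M : ℝ) * c i / N = M * (c i / N) := by ring
        rw [e] at hfl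
        linarith
      have hf : (0 : ℝ) ≤ c i / N := by positivity
      have h2e : (0 : ℝ) < 2 ^ e := by positivity
      simp only [ProductApprox]
      rw [prod_range_succ, pow_succ]
      constructor
      · calc _ = (1 - δ) * ((1 - δ) ^ i * ∏ j ∈ range i, ((c j : ℝ) / N)) * (c i / N) := by ring
          _ ≤ (1 - δ) * (M / 2 ^ e) * (c i / N) := by
              have : 0 ≤ 1 - δ := by linarith
              gcongr
          _ = (1 - δ) * (M * (c i / N)) / 2 ^ e := by ring
          _ ≤ _ := by gcongr
      · calc _ ≤ M * ((c i : ℝ) / N) / 2 ^ e := by gcongr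
          _ = M / 2 ^ e * (c i / N) := by ring
          _ ≤ _ := by gcongr
    · have hnext : productNext n N Q c (M, e, i) = (M + M, e + 1, i) := by
        simp [productNext, hin, hQM]
      rw [hnext]
      have e1 : ((M + M : ℕ) : ℝ) / 2 ^ (e + 1) = M / 2 ^ e := by
        push_cast; rw [pow_succ]; field_simp; ring
      simp only [ProductApprox, e1]
      exact ⟨h1, h2⟩
  · have hnext : productNext n N Q c (M, e, i) = (M, e, i) := by simp [productNext, hin]
    rw [hnext]
    exact ⟨h1, h2⟩

theorem productNext_iterate_approx {δ : ℝ} (hN : 0 < N) (hδ : N ≤ δ * Q) (hδ' : δ ≤ 1)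
    (hc : ∀ i < n, 1 ≤ c i) (T : ℕ) (h : ProductApprox N δ c p) :
    ProductApprox N δ c ((productNext n N Q c)^[T] p) := by
  induction T generalizing p with
  | zero => exact h
  | succ T ih => rw [Function.iterate_succ_apply]; exact ih (h.next hN hδ hδ' hc)

end Loops

/-! ## The whole program -/

namespace Program

/-- Compute the parameters from the input. -/
def setup : Program :=
  block [.const 4 1, .const 5 2, .const 6 3, .const 7 4, .const 0 1, .const 14 1,
    -- Register `21` still holds `0`, so the three reads fetch `n`, `a` and `b`. Then `23` holds
    -- `k`, `17` and `8` hold `N`, `18` the threshold `Q`, `16` and `19` the lengths of the two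
    -- loops, and `1` the number `m`, taken from the last pointer.
    .read 3 21, .read 22 4, .read 23 5, .div 23 23 22, .add 23 23 4, .mul 24 3 23,
    .mul 17 24 23, .const 20 64, .mul 17 17 20, .add 8 17 21,
    .mul 18 24 17, .const 20 16, .mul 18 18 20, .mul 16 3 17, .const 20 1600, .mul 16 16 20,
    .add 19 17 4, .mul 19 19 3, .add 1 3 6, .read 1 1, .sub 1 1 3, .sub 1 1 7, .div 1 1 7]
    (.instr (.read 12 6))

/-- Prepare the main loop. -/
def init : Program := .seq setup clear

/-- Estimate, for each vertex in turn, the probability that it is not a sink if no earlier vertex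
is a sink, and output the product of the estimates and the number of all orientations. -/
def approxSinkFree : Program :=
  .seq init (.seq sampleLoop (.seq (.instr (.const 10 0)) productLoop))

theorem init_det : init.Det 1600 := by
  simp [init, setup, clear, block, Det, Instr.Det]

end Program

/-- The initial control state. -/
def Ctl.start (n N : ℕ) [NeZero n] : Ctl n := ⟨N, 0, 0, [], true, false, 0, fun _ => 0⟩

section Whole

variable {n m : ℕ} {G : Multigraph (Fin n) (Fin m)} [NeZero n]
variable {L : AdjList G} {N Q K a b k : ℕ} {σ : Store} {s : Ctl n} {π : Fin m → Option Bool}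
  {x : List ℕ} {A : Set ℝ}

theorem Ctl.safe_start (L : AdjList G) (N : ℕ) : (Ctl.start n N).Safe L N where
  nodup := List.nodup_nil
  st_nil _ := rfl
  first_of_reset h := by simp [start] at h
  pos_le := Nat.zero_le _
  runs_le := le_rfl
  cnt_le i := by simp [start]
  cnt_le_of_done _ _ := Nat.zero_le _

theorem Ctl.wf_start (n N : ℕ) [NeZero n] : (Ctl.start n N).WF where
  nodup := List.nodup_nil
  cur_notMem := by simp [start]
  le_stage := by simp [start]
  cur_le := le_rfl
  st_nil _ := rfl
  cur_eq _ := rfl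
  first_of_reset h := by simp [start] at h
  stage_zero _ := by simp [start]
  first_true _ := rfl

theorem represents_init (hx : Encodes x L) (hn : x.getD 0 0 = n) (ha : x.getD 1 0 = a)
    (hb : x.getD 2 0 = b) (hk : k = b / a + 1) (hN : N = n * k * k * 64) :
    Represents L N (n * k * N * 16) ((N + 1) * n) (Program.init.eval x Store.zero)
      (Ctl.start n N) (fun _ => none) ∧
    (∀ i, 20 ≤ i → (Program.init.eval x Store.zero).reg i = 0) ∧
    (Program.init.eval x Store.zero).reg 16 = n * N * 1600 := by
  have hstart : x.getD 3 0 = n + 4 := by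
    have := hx.pointer 0 (Nat.zero_le _)
    rwa [start_zero] at this
  have hlast : x.getD (n + 3) 0 = n + 4 + 4 * m := by
    rw [hx.pointer n le_rfl, start_last]
  have hm : (n + 4 + 4 * m - n - 4) / 4 = m := by omega
  have key : Represents L N (n * k * N * 16) ((N + 1) * n) (Program.setup.eval x Store.zero)
      (Ctl.start n N) (fun _ => none) := by
    constructor
    case big =>
      intro i hi
      simp only [Program.setup, Program.block, Program.eval, Instr.eval, Store.reg_setReg]
      repeat rw [if_neg (by omega)]
      rfl
    all_goals simp [Program.setup, Program.block, Program.eval, Instr.eval, Store.zero, Ctl.start, -List.getD_eq_getElem?_getD,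
      hn, ha, hb, ← hk, ← hN, hstart, hlast, hm, start_zero, tailWord]
  obtain ⟨h1, h2, h3⟩ := key.clear (x := x)
  refine ⟨h1, h2, h3.trans ?_⟩
  simp [Program.setup, Program.block, Program.eval, Instr.eval, Store.zero, -List.getD_eq_getElem?_getD, hn, ha, hb, ← hk, ← hN]

end Whole

/-! ## The success probability -/

section Success

variable {n m : ℕ} {G : Multigraph (Fin n) (Fin m)} (L : AdjList G)

/-- The product of conditional probabilities telescopes. -/
theorem prod_stageProb_filter (hdeg : ∀ v, 3 ≤ (L.list v).length) (k : ℕ) (hk : k ≤ n) :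
    ∏ i : Fin n with i.val < k, stageProb G i =
      (G.noSinkIn (univ.filter fun i : Fin n => i.val < k)).card / 2 ^ m := by
  induction k with
  | zero => simp [noSinkIn_empty]
  | succ k ih =>
    have h1 : (univ.filter fun i : Fin n => i.val < k + 1) =
        insert ⟨k, hk⟩ (univ.filter fun i : Fin n => i.val < k) := by
      ext u; simp [Fin.ext_iff]; omega
    have h2 : (univ.filter fun i : Fin n => i.val < k) =
        univ.filter fun i : Fin n => i < ⟨k, hk⟩ := by
      ext u; simp [Fin.lt_def]
    rw [h1, prod_insert (by simp), ih (by omega), mul_div_assoc', h2, stageProb_mul L hdeg]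

theorem prod_stageProb (hdeg : ∀ v, 3 ≤ (L.list v).length) :
    ∏ i, stageProb G i = G.numSinkFree / 2 ^ m := by
  have h := prod_stageProb_filter L hdeg n le_rfl
  rwa [filter_true_of_mem (fun i _ => i.2), card_noSinkIn_univ] at h

/-- The final state yields a good estimate. -/
def Ctl.Accurate (G : Multigraph (Fin n) (Fin m)) (N : ℕ) (ε : ℝ) (s : Ctl n) : Prop :=
  s.runs = 0 ∧ |∏ i, (s.cnt i : ℝ) / (N * stageProb G i) - 1| ≤ ε / 2

open Classical in
/-- The indicator of the good final states. -/
noncomputable def accuracy (G : Multigraph (Fin n) (Fin m)) (N : ℕ) (ε : ℝ) (s : Ctl n) : ℝ :=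
  if s.Accurate G N ε then 1 else 0

theorem accuracy_nonneg (N : ℕ) (ε : ℝ) (s : Ctl n) : 0 ≤ accuracy G N ε s := by
  rw [accuracy]; split_ifs <;> norm_num

/-- The weight `4 / ε ^ 2` makes the squared error count at least `1` as soon as the deviation
exceeds `ε / 2`, as in Chebyshev's inequality. -/
theorem accuracy_add_finalError {N : ℕ} {ε : ℝ} (hε : 0 < ε) {s : Ctl n} (hs : s.runs = 0) :
    1 ≤ accuracy G N ε s + finalError G N (4 / ε ^ 2) s := by
  rw [accuracy, finalError, if_pos hs]
  split_ifs with h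
  · have : 0 ≤ 4 / ε ^ 2 * (∏ i, (s.cnt i : ℝ) / (N * stageProb G i) - 1) ^ 2 := by positivity
    linarith
  · have h' : ε / 2 < |∏ i, (s.cnt i : ℝ) / (N * stageProb G i) - 1| := by
      by_contra hc
      exact h ⟨hs, not_lt.1 hc⟩
    have h2 : (ε / 2) ^ 2 ≤ (∏ i, (s.cnt i : ℝ) / (N * stageProb G i) - 1) ^ 2 := by
      rw [← sq_abs (∏ i, (s.cnt i : ℝ) / (N * stageProb G i) - 1)]
      gcongr
    rw [zero_add, div_mul_eq_mul_div, one_le_div (by positivity)]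
    linarith

variable [NeZero n]

theorem lazyValue_of_done {t : Ctl n → ℝ} {κ : ℝ} {s : Ctl n} (hs : s.runs = 0) (F : ℕ)
    (π : Fin m → Option Bool) : lazyValue L t κ F s π = t s := by
  induction F with
  | zero => rfl
  | succ F ih => simp [lazyValue, lazyStep, hs, ih]

/-- A computation that exhausts its fuel has paid `κ` at all `F` steps; one that finishes
contributes at least `1 ≥ κ * F` through its final state. -/
theorem le_lazyValue_add {t f : Ctl n → ℝ} {κ : ℝ} (ht : ∀ s, 0 ≤ t s) (hf : ∀ s, 0 ≤ f s)
    (h : ∀ s : Ctl n, s.runs = 0 → 1 ≤ t s + f s) (F : ℕ) (hκ : κ * F ≤ 1) (hκ0 : 0 ≤ κ) :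
    ∀ (s : Ctl n) (π : Fin m → Option Bool),
      κ * F ≤ lazyValue L t 0 F s π + lazyValue L f κ F s π := by
  induction F with
  | zero =>
    intro s π
    simpa [lazyValue] using add_nonneg (ht s) (hf s)
  | succ F ih =>
    intro s π
    by_cases hs : s.runs = 0
    · rw [lazyValue_of_done L hs, lazyValue_of_done L hs]
      exact hκ.trans (h s hs)
    · push_cast at hκ ⊢
      have ih' := ih (by linarith)
      have h1 := ih' (lazyStep L s π true).1 (lazyStep L s π true).2
      have h2 := ih' (lazyStep L s π false).1 (lazyStep L s π false).2
      simp only [lazyValue, if_neg hs]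
      linarith

/-- With `κ` the reciprocal of the fuel, either kind of failure, inaccuracy or lack of fuel, costs
at least `1`, so the failure probability is at most the initial potential. Error and time contribute
at most `1 / 8` each. -/
theorem three_quarters_le_lazyValue (hdeg : ∀ v, 3 ≤ (L.list v).length) {N k : ℕ} {ε : ℝ}
    (hε : 0 < ε) (hεk : 1 ≤ ε * k) (hN : N = n * k * k * 64) :
    3 / 4 ≤ lazyValue L (accuracy G N ε) 0 (n * N * 1600) (Ctl.start n N) fun _ => none := by
  have hn : 0 < n := Nat.pos_of_ne_zero (NeZero.ne n)
  have hk : 0 < k := by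
    rcases Nat.eq_zero_or_pos k with rfl | h
    · norm_num at hεk
    · exact h
  have hN0 : 0 < N := by rw [hN]; positivity
  have hnN : n ≤ N := by
    rw [hN, mul_assoc, mul_assoc]; exact Nat.le_mul_of_pos_right _ (by positivity)
  have hn' : (0 : ℝ) < n := by exact_mod_cast hn
  have hN' : (0 : ℝ) < N := by exact_mod_cast hN0
  set κ : ℝ := 1 / (n * N * 1600) with hκ
  have hκF : κ * (n * N * 1600 : ℕ) = 1 := by
    rw [hκ]; push_cast; field_simp
  have hκ0 : 0 ≤ κ := by positivity
  have hw : (0 : ℝ) ≤ 4 / ε ^ 2 := by positivity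
  have h1 := le_lazyValue_add L (accuracy_nonneg (G := G) N ε)
    (f := finalError G N (4 / ε ^ 2)) (fun s => by rw [finalError]; split_ifs <;> positivity)
    (fun s hs => accuracy_add_finalError hε hs) (n * N * 1600) hκF.le hκ0 (Ctl.start n N)
    fun _ => none
  rw [hκF] at h1
  have h2 : lazyValue L (finalError G N (4 / ε ^ 2)) κ (n * N * 1600) (Ctl.start n N)
      (fun _ => none) ≤ potential G N (4 / ε ^ 2) κ (Ctl.start n N) := by
    rw [lazyValue_eq_avg, avg, div_le_iff₀ (by positivity)]
    have h := (sum_noSinkIn_eagerValue_le L hdeg hw hκ0 (N := N) (n * N * 1600) (Ctl.start n N)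
      (Ctl.wf_start n N)).1 rfl rfl
    have hs : (Ctl.start n N).settled = ∅ := by
      ext u
      simp [Ctl.mem_settled, Ctl.start]
    rw [hs, noSinkIn_empty] at h
    simp only [complete_none]
    refine h.trans (le_of_eq ?_)
    simp [mul_comm]
  have h3 : potential G N (4 / ε ^ 2) κ (Ctl.start n N) ≤ 1 / 4 := by
    have hrem : (Ctl.start n N).rem = fun _ => (N : ℝ) := by
      funext i
      simp [Ctl.rem, Ctl.start]
    have hcnt : (fun i => ((Ctl.start n N).cnt i : ℝ)) = fun _ => 0 := by
      funext i; simp [Ctl.start]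
    have herr : (Ctl.start n N).error N (stageProb G) ≤ 2 * (n / N) := by
      rw [Ctl.error, hrem, hcnt]
      exact errorSq_start_le hN' (half_le_stageProb L hdeg) (stageProb_le_one L hdeg)
        (by exact_mod_cast hnN)
    have hload : (Ctl.start n N).load = n * N := by
      rw [Ctl.load, if_neg (show (Ctl.start n N).runs ≠ 0 from hN0.ne')]
      simp only [Ctl.start, List.length_nil, Fin.val_zero]
      push_cast; ring
    have h4 : 4 / ε ^ 2 * (2 * (n / N)) ≤ (1 : ℝ) / 8 := by
      -- The factor `64` in `N` turns the weighted initial error into `1 / (8 * (ε * k) ^ 2)`, and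
      -- `ε * k ≥ 1`.
      have e : 4 / ε ^ 2 * (2 * (n / N)) = 1 / (8 * (ε * k) ^ 2) := by
        have hk' : (0 : ℝ) < k := by exact_mod_cast hk
        rw [hN]; push_cast; field_simp; norm_num
      rw [e]
      gcongr
      nlinarith
    have h5 : 200 * κ * (n * N) = 1 / 8 := by
      rw [hκ]; field_simp; norm_num
    rw [potential, hload, h5]
    have := mul_le_mul_of_nonneg_left herr hw
    linarith
  linarith

end Success

/-! ## The accuracy of the output -/

section Accuracy

variable {n m : ℕ} {G : Multigraph (Fin n) (Fin m)} {L : AdjList G} {N Q K k : ℕ} {ε : ℝ}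
  {s : Ctl n}

/-- The counts of the vertices as a function on the natural numbers. -/
def Ctl.count (s : Ctl n) (i : ℕ) : ℕ := if h : i < n then s.cnt ⟨i, h⟩ else 0

theorem Ctl.count_val (s : Ctl n) (i : Fin n) : s.count i = s.cnt i := by simp [count]

theorem sq_le_two_pow {h : ℕ} (hh : 0 < h) : (2 * h) * (2 * h) ≤ 2 ^ (2 * h) := by
  obtain ⟨j, rfl⟩ : ∃ j, h = j + 1 := ⟨h - 1, by omega⟩
  have h1 : j + 1 ≤ 2 ^ j := Nat.lt_two_pow_self
  have h2 : 2 * (j + 1) ≤ 2 ^ (j + 1) := by rw [pow_succ]; omega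
  rw [two_mul (j + 1), pow_add, ← two_mul]
  exact Nat.mul_le_mul h2 h2

/-- Sampling and rounding may each cost a relative error `ε / 2`: `n` roundings with `δ = 1 / (16 *
n * k)` lose at most `n * δ ≤ ε / 2`, and `(1 - ε / 2) ^ 2 ≥ 1 - ε`. Rounding goes only downwards,
so the upper bound needs sampling alone. -/
theorem Ctl.Accurate.isApprox (hdeg : ∀ v, 3 ≤ (L.list v).length) (h : s.Accurate G N ε)
    (hs : s.Safe L N) (hn : 0 < n) (hk : 0 < k) (hε1 : ε < 1) (hεk : 1 ≤ ε * k)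
    (hN : N = n * k * k * 64) {p : ℕ × ℕ × ℕ}
    (hp : p = (productNext n N (n * k * N * 16) s.count)^[(N + 1) * n] (1, 0, 0)) :
    IsApprox ε G.numSinkFree ((p.1 : ℝ) * 2 ^ m / 2 ^ p.2.1) := by
  have hn' : (0 : ℝ) < n := by exact_mod_cast hn
  have hk' : (0 : ℝ) < k := by exact_mod_cast hk
  have hN0 : 0 < N := by rw [hN]; positivity
  have hN' : (0 : ℝ) < N := by exact_mod_cast hN0
  set P : ℝ := ∏ i, (s.cnt i : ℝ) / N with hP
  set q : ℝ := ∏ i, stageProb G i with hq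
  have hq0 : 0 < q := prod_pos fun i _ => by linarith [half_le_stageProb L hdeg i]
  have hZ : (G.numSinkFree : ℝ) = q * 2 ^ m := by
    rw [hq, prod_stageProb L hdeg]; field_simp
  obtain ⟨-, habs⟩ := h
  have hPq : ∏ i, (s.cnt i : ℝ) / (N * stageProb G i) = P / q := by
    rw [hP, hq, ← prod_div_distrib]
    exact prod_congr rfl fun i _ => by rw [div_div]
  rw [hPq, abs_le] at habs
  have hlo : (1 - ε / 2) * q ≤ P := by
    rw [← le_div_iff₀ hq0]; linarith [habs.1]
  have hup : P ≤ (1 + ε / 2) * q := by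
    rw [← div_le_iff₀ hq0]; linarith [habs.2]
  -- An accurate product is nonzero, hence no count is zero and the mantissa never vanishes.
  have hP0 : P ≠ 0 := by
    have : 0 < (1 - ε / 2) * q := mul_pos (by linarith) hq0
    linarith
  have hc : ∀ i < n, 1 ≤ s.count i := by
    intro i hi
    have h1 := prod_ne_zero_iff.1 hP0 ⟨i, hi⟩ (mem_univ _)
    rw [Ctl.count, dif_pos hi, Nat.one_le_iff_ne_zero]
    intro h0
    rw [h0] at h1
    simp at h1
  have hcN : ∀ i < n, s.count i ≤ N := by
    intro i hi
    rw [Ctl.count, dif_pos hi]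
    exact hs.cnt_le' _
  have hQN : n * k * N * 16 ≤ N * N := by
    calc n * k * N * 16 = n * k * 1 * 16 * N := by ring
      _ ≤ n * k * k * 64 * N := by gcongr <;> omega
      _ = N * N := by rw [← hN]
  have hNQ : N ≤ n * k * N * 16 := by
    calc N = 1 * 1 * N * 1 := by ring
      _ ≤ n * k * N * 16 := by gcongr <;> omega
  -- The true bit length of `Q` is logarithmic, but `N` is good enough: `(N + 1) * n` product steps
  -- do not exceed the order of the main loop.
  have hQ : n * k * N * 16 ≤ 2 ^ N := by
    refine hQN.trans ?_
    have e : N = 2 * (n * k * k * 32) := by rw [hN]; ring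
    have := sq_le_two_pow (h := n * k * k * 32) (by positivity)
    rwa [← e] at this
  have hindex : p.2.2 = n := by
    rw [hp]
    refine productNext_iterate_index hN0 hNQ hQ hc _ _ le_rfl ?_ hcN (Nat.zero_le _) ?_
    · exact Nat.one_lt_two_pow (by omega)
    · simp [mul_comm]
  set δ : ℝ := 1 / (16 * n * k) with hδ
  have hnδ : n * δ ≤ ε / 2 := by
    have e : n * δ = 1 / (16 * k) := by rw [hδ]; field_simp
    rw [e, div_le_iff₀ (by positivity)]
    nlinarith
  have hδ0 : 0 ≤ δ := by positivity
  have hδ1 : δ ≤ 1 := by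
    have : (1 : ℝ) ≤ n := by exact_mod_cast hn
    nlinarith
  have happ : ProductApprox N δ s.count p := by
    rw [hp]
    refine productNext_iterate_approx hN0 (le_of_eq ?_) hδ1 hc _ ?_
    · rw [hδ]; push_cast; field_simp
    · simp [ProductApprox]
  obtain ⟨h1, h2⟩ := happ
  rw [hindex, ← Fin.prod_univ_eq_prod_range (fun j => (s.count j : ℝ) / N) n] at h1 h2
  simp only [Ctl.count_val, ← hP] at h1 h2
  have hbern : 1 - ε / 2 ≤ (1 - δ) ^ n := by
    have := one_add_mul_le_pow (a := -δ) (by linarith) n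
    rw [← sub_eq_add_neg] at this
    linarith
  have hε0 : 0 < ε := by
    by_contra hneg
    nlinarith
  have hlow : (1 - ε) * q ≤ p.1 / 2 ^ p.2.1 := by
    refine le_trans ?_ h1
    calc (1 - ε) * q ≤ (1 - ε / 2) * ((1 - ε / 2) * q) := by nlinarith
      _ ≤ (1 - δ) ^ n * P := mul_le_mul hbern hlo (mul_nonneg (by linarith) hq0.le)
        (by linarith)
  have hupp : (p.1 : ℝ) / 2 ^ p.2.1 ≤ (1 + ε) * q := by
    refine (h2.trans hup).trans ?_
    gcongr
    linarith
  have h2m : (0 : ℝ) < 2 ^ m := by positivity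
  have e : (p.1 : ℝ) * 2 ^ m / 2 ^ p.2.1 = p.1 / 2 ^ p.2.1 * 2 ^ m := by ring
  rw [IsApprox, hZ, e, ← mul_assoc, ← mul_assoc]
  exact ⟨mul_le_mul_of_nonneg_right hlow h2m.le, mul_le_mul_of_nonneg_right hupp h2m.le⟩

end Accuracy

/-! ## Bounds for time and word size -/

section Final

variable {n m : ℕ} {G : Multigraph (Fin n) (Fin m)} {L : AdjList G} {N Q K k a b : ℕ} {ε : ℝ}
  {σ : Store} {s : Ctl n} {π : Fin m → Option Bool} {x : List ℕ} {A : Set ℝ}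

theorem wordBound_pow {X : ℕ} (hX : 4 ≤ X) (hn : n ≤ X) (hm : m ≤ X) (hk : k ≤ X)
    (hN : N = n * k * k * 64) :
    WordBound n m N (n * k * N * 16) ((N + 1) * n) (n * N * 1600) (X ^ 20) := by
  have hX1 : 1 ≤ X := by omega
  have hX3 : 64 ≤ X ^ 3 := by
    calc 64 = 4 ^ 3 := by norm_num
      _ ≤ X ^ 3 := Nat.pow_le_pow_left hX 3
  have hX6 : 1600 ≤ X ^ 6 := by
    calc 1600 ≤ 4 ^ 6 := by norm_num
      _ ≤ X ^ 6 := Nat.pow_le_pow_left hX 6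
  have hX2 : 16 ≤ X ^ 2 := by
    calc 16 = 4 ^ 2 := by norm_num
      _ ≤ X ^ 2 := Nat.pow_le_pow_left hX 2
  have hle : ∀ i ≤ 20, X ^ i ≤ X ^ 20 := fun i hi => Nat.pow_le_pow_right hX1 hi
  have hN6 : N ≤ X ^ 6 := by
    calc N = n * k * k * 64 := hN
      _ ≤ X * X * X * X ^ 3 := by gcongr
      _ = X ^ 6 := by ring
  have hmul : ∀ i, 4 * X ^ i ≤ X ^ (i + 1) := by
    intro i; rw [pow_succ, mul_comm]; exact Nat.mul_le_mul_left _ hX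
  have hX7 : 4 * X ^ 6 ≤ X ^ 7 := hmul 6
  have hX1' : X ≤ X ^ 6 := Nat.le_self_pow (by norm_num) X
  have h8 : 4 * X ^ 7 ≤ X ^ 8 := hmul 7
  refine ⟨hX6.trans (hle 6 (by norm_num)), ?_, ?_, ?_, ?_, ?_, ?_⟩
  · have := hle 8 (by norm_num); omega
  · calc N * m ≤ X ^ 6 * X := by gcongr
      _ = X ^ 7 := by ring
      _ ≤ X ^ 20 := hle 7 (by norm_num)
  · have := hle 8 (by norm_num); omega
  · have h1 : n * k * N * 16 ≤ X ^ 10 := by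
      calc n * k * N * 16 ≤ X * X * X ^ 6 * X ^ 2 := by gcongr
        _ = X ^ 10 := by ring
    have h2 : N + 1 ≤ X ^ 7 := by omega
    have h3 : 2 * (n * k * N * 16) * (N + 1) ≤ 2 * X ^ 10 * X ^ 7 := by gcongr
    have h4 : 2 * X ^ 10 * X ^ 7 = 2 * X ^ 17 := by ring
    have h5 : 4 * X ^ 17 ≤ X ^ 18 := hmul 17
    have h6 := hle 18 (by norm_num)
    have h7 : 1 ≤ X ^ 17 := Nat.one_le_pow _ _ hX1
    omega
  · calc n * N * 1600 ≤ X * X ^ 6 * X ^ 6 := by gcongr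
      _ = X ^ 13 := by ring
      _ ≤ X ^ 20 := hle 13 (by norm_num)
  · calc (N + 1) * n ≤ X ^ 7 * X := by
          gcongr
          omega
      _ = X ^ 8 := by ring
      _ ≤ X ^ 20 := hle 8 (by norm_num)

/-- A bound for the number of steps per unit of work. -/
def stepCost : ℕ := Program.init.cost + Program.sampleCost + Program.productStep.cost + 12

theorem good_approxSinkFree [NeZero n] (hdeg : ∀ v, 3 ≤ (L.list v).length) (hx : Encodes x L)
    (hx0 : x.getD 0 0 = n) (hx1 : x.getD 1 0 = a) (hx2 : x.getD 2 0 = b) (hk : k = b / a + 1)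
    (hN : N = n * k * k * 64) (hε1 : ε < 1) (hεk : 1 ≤ ε * k)
    {B W : ℕ} (hB : WordBound n m N (n * k * N * 16) ((N + 1) * n) (n * N * 1600) B)
    (hxB : ∀ i, x.getD i 0 ≤ B) (hW : B ^ 2 ^ stepCost ≤ W) :
    Config.Good x {y | IsApprox ε G.numSinkFree y} W (stepCost * (n * N * 1600)) (3 / 4)
      ⟨[Program.approxSinkFree], Store.zero⟩ := by
  have hn : 0 < n := Nat.pos_of_ne_zero (NeZero.ne n)
  have hk0 : 0 < k := hk ▸ Nat.succ_pos _
  have hε0 : 0 < ε := by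
    by_contra hneg
    have : ε * k ≤ 0 := mul_nonpos_of_nonpos_of_nonneg (by linarith) (Nat.cast_nonneg _)
    linarith
  have hN0 : 0 < N := by rw [hN]; positivity
  have hc := hB.const
  have hpow : ∀ c ≤ stepCost, B ^ 2 ^ c ≤ W := fun c hc =>
    (Nat.pow_le_pow_right (by omega) (Nat.pow_le_pow_right (by norm_num) hc)).trans hW
  have hBW : B ≤ W := by simpa using hpow 0 (Nat.zero_le _)
  have hfinal : ∀ (σ : Store) (s : Ctl n) (π : Fin m → Option Bool),
      Represents L N (n * k * N * 16) ((N + 1) * n) σ s π → s.Safe L N → σ.reg 16 = 0 →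
      (∀ i, 20 ≤ i → σ.reg i = 0) →
      Config.Good x {y | IsApprox ε G.numSinkFree y} W
        (1 + (N + 1) * n * (Program.productStep.cost + 1) + 1 + 1) (accuracy G N ε s)
        ⟨[.seq (.instr (.const 10 0)) Program.productLoop], σ⟩ := by
    intro σ s π h hs h16 h0
    have hb := h.boundedBy hs hB (by omega) h0
    have hq : accuracy G N ε s ≤ 0 ∨ accuracy G N ε s ≤ 1 ∧
        (((productNext n N (n * k * N * 16) s.count)^[(N + 1) * n] (1, 0, 0)).1 : ℝ) * 2 ^ m /
        2 ^ ((productNext n N (n * k * N * 16) s.count)^[(N + 1) * n] (1, 0, 0)).2.1 ∈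
          {y | IsApprox ε G.numSinkFree y} := by
      rw [accuracy]
      split_ifs with hacc
      · exact Or.inr ⟨le_rfl, hacc.isApprox hdeg hs hn hk0 hε1 hεk hN rfl⟩
      · exact Or.inl le_rfl
    refine Config.Good.of_step rfl (hb.mono hBW) (Config.Good.of_step
      (d := ⟨[Program.productLoop], σ.setReg 10 0⟩) (PMF.pure_map _ _) (hb.mono hBW) ?_)
    refine HoldsProduct.good_productLoop hB hxB
      (hpow _ (by rw [stepCost]; omega)) _ _ _ ?_ (hb.setReg (Nat.zero_le _)) ?_ ?_ hq
    · refine ⟨?_, ?_, ?_, ?_, ?_, ?_, ?_, ?_, ?_, ?_, ?_, ?_, ?_, Nat.zero_le _⟩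
      case refine_11 =>
        intro i hi
        rw [Ctl.count, dif_pos hi]
        exact h.counts ⟨i, hi⟩
      case refine_12 =>
        intro i hi
        rw [Ctl.count, dif_pos hi]
        exact hs.cnt_le' _
      case refine_13 =>
        have : 0 < n * k * N * 16 := by positivity
        simp only []
        omega
      all_goals simp [h.r0, h.r1, h.r2, h.r3, h.r4, h.r5, h.r7, h.r17, h.r18]
    · simp [h.r19]
    · simp
  obtain ⟨h1, h2, h3⟩ := represents_init (L := L) hx hx0 hx1 hx2 hk hN
  have hloop := Represents.good_sampleLoop (A := {y | IsApprox ε G.numSinkFree y}) hx hB hxB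
    (hpow _ (by rw [stepCost]; omega)) (accuracy_nonneg (G := G) N ε) hfinal (n * N * 1600) _ _ _
    le_rfl h1 (Ctl.safe_start L N) h3 h2
  have hz : Store.zero.BoundedBy B := ⟨fun _ => Nat.zero_le _, fun _ => Nat.zero_le _⟩
  have h4 := (hloop.mono_prob (three_quarters_le_lazyValue L hdeg hε0 hεk hN))
  have h5 := Config.Good.of_step (c := ⟨[.seq Program.sampleLoop
    (.seq (.instr (.const 10 0)) Program.productLoop)], Program.init.eval x Store.zero⟩) rfl
    ((h1.boundedBy (Ctl.safe_start L N) hB h3.le h2).mono hBW) h4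
  have h6 := Config.Good.of_eval Program.init_det hc (by omega) hxB hz
    (hpow _ (by rw [stepCost]; omega)) h5
  have h7 := Config.Good.of_step (c := ⟨[Program.approxSinkFree], Store.zero⟩) rfl (hz.mono hBW) h6
  refine h7.mono ?_
  have hF : 1 ≤ n * N * 1600 := Nat.one_le_iff_ne_zero.2 (by positivity)
  have hKF : (N + 1) * n ≤ n * N * 1600 := by
    calc (N + 1) * n ≤ (N + N) * n := by gcongr; omega
      _ = n * N * 2 := by ring
      _ ≤ n * N * 1600 := by gcongr; norm_num
  have hK := Nat.mul_le_mul_right (Program.productStep.cost + 1) hKF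
  have hI := Nat.mul_le_mul_left (Program.init.cost + 8) hF
  rw [stepCost]
  generalize n * N * 1600 = F at *
  generalize (N + 1) * n = K at *
  generalize Program.init.cost = c₁ at *
  generalize Program.sampleCost = c₂ at *
  generalize Program.productStep.cost = c₃ at *
  nlinarith

/-- From `k ≤ 2 / ε` the fuel is at most `409600 * (n / ε) ^ 2`; since `n / ε ≥ 2`, the logarithm is
at least `1 / 2`, which doubles the constant. -/
theorem fuel_le {n k a b : ℕ} (hn : 2 ≤ n) (ha : 0 < a) (hab : a < b) (hk : k = b / a + 1)
    (hε : ε = (a : ℝ) / b) :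
    ((n * (n * k * k * 64) * 1600 : ℕ) : ℝ) ≤
      819200 * (((n : ℝ) / ε) ^ 2 * Real.log ((n : ℝ) / ε)) := by
  have ha' : (0 : ℝ) < a := by exact_mod_cast ha
  have hb' : (0 : ℝ) < b := by exact_mod_cast ha.trans hab
  have hab' : (a : ℝ) ≤ b := by exact_mod_cast hab.le
  have hn' : (2 : ℝ) ≤ n := by exact_mod_cast hn
  have hba : 1 ≤ (b : ℝ) / a := (one_le_div ha').2 hab'
  have hkr : (k : ℝ) ≤ 2 * (b / a) := by
    rw [hk]; push_cast
    have : ((b / a : ℕ) : ℝ) ≤ b / a := Nat.cast_div_le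
    linarith
  have he : (n : ℝ) / ε = n * (b / a) := by rw [hε]; field_simp
  rw [he]
  have h2 : 2 ≤ (n : ℝ) * (b / a) := by nlinarith
  have hlog : 1 / 2 ≤ Real.log (n * (b / a)) := by
    have := Real.log_le_log (by norm_num) h2
    linarith [Real.log_two_gt_d9]
  have hnk : (n : ℝ) * k ≤ 2 * (n * (b / a)) := by nlinarith
  have hsq : ((n : ℝ) * k) ^ 2 ≤ (2 * (n * (b / a))) ^ 2 := by gcongr
  push_cast
  nlinarith [mul_le_mul_of_nonneg_left hlog (sq_nonneg ((n : ℝ) * (b / a)))]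

end Final

end SFO

theorem theorem3 :
    ∃ (P : SFO.Program) (C : ℕ),
      ∀ (n m : ℕ) (G : SFO.Multigraph (Fin n) (Fin m)) (L : SFO.AdjList G) (a b : ℕ) (ε : ℝ),
        2 ≤ n → (∀ v, 3 ≤ G.degree v) →
        0 < a → a < b → ε = (a : ℝ) / (b : ℝ) →
        ∃ T : ℕ,
          (T : ℝ) ≤ (C : ℝ) * (((n : ℝ) / ε) ^ 2 * Real.log ((n : ℝ) / ε)) ∧
          P.HaltsWithin (L.encode a b) T ∧
          P.WordsBoundedBy (L.encode a b) ((n + m + b) ^ C) ∧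
          3 / 4 ≤ P.probOutput (L.encode a b) T
            {y : ℝ | SFO.IsApprox ε (G.numSinkFree : ℝ) y} := by
  -- The first summand serves the running time. The second serves the word size: between rounds
  -- words are at most `(n + m + b) ^ 20`, and within a loop-free piece this is raised at most to
  -- the power `2 ^ stepCost`.
  refine ⟨SFO.Program.approxSinkFree, 819200 * SFO.stepCost + 20 * 2 ^ SFO.stepCost, ?_⟩
  intro n m G L a b ε hn hdeg ha hab hε
  have : NeZero n := ⟨by omega⟩
  have hdeg' : ∀ v, 3 ≤ (L.list v).length := fun v => by rw [L.length_list]; exact hdeg v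
  have ha' : (0 : ℝ) < a := by exact_mod_cast ha
  have hb' : (0 : ℝ) < b := by exact_mod_cast ha.trans hab
  have hε1 : ε < 1 := by
    rw [hε, div_lt_one hb']; exact_mod_cast hab
  obtain ⟨k, hk⟩ : ∃ k, k = b / a + 1 := ⟨_, rfl⟩
  have hεk : 1 ≤ ε * k := by
    have h := Nat.lt_div_mul_add (a := b) ha
    have h1 : b ≤ a * k := by rw [hk]; nlinarith
    have h2 : (b : ℝ) ≤ a * k := by exact_mod_cast h1
    rw [hε, div_mul_eq_mul_div, one_le_div hb']
    exact h2
  have hkb : k ≤ b + 1 := by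
    rw [hk]; exact Nat.succ_le_succ (Nat.div_le_self _ _)
  have hB := SFO.wordBound_pow (n := n) (m := m) (k := k) (X := n + m + b) (by omega) (by omega)
    (by omega) (by omega) rfl
  have hxB : ∀ i, (L.encode a b).getD i 0 ≤ (n + m + b) ^ 20 := by
    intro i
    refine (SFO.encode_getD_le L a b hab i).trans ?_
    calc n + 4 + 4 * m + b ≤ (n + m + b) * (n + m + b) := by
          have : (n + m + b) * 4 ≤ (n + m + b) * (n + m + b) := Nat.mul_le_mul_left _ (by omega)
          omega
      _ = (n + m + b) ^ 2 := by ring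
      _ ≤ (n + m + b) ^ 20 := Nat.pow_le_pow_right (by omega) (by norm_num)
  have h := SFO.good_approxSinkFree (L := L) (ε := ε) (x := L.encode a b) hdeg'
    (SFO.encodes_encode L a b) rfl rfl rfl hk rfl hε1 hεk hB hxB
    (W := (n + m + b) ^ (819200 * SFO.stepCost + 20 * 2 ^ SFO.stepCost)) (by
      rw [← pow_mul]
      exact Nat.pow_le_pow_right (by omega) (Nat.le_add_left _ _))
  refine ⟨_, ?_, h.halts, h.bounded, ?_⟩
  · have hf := SFO.fuel_le (ε := ε) hn ha hab hk hε
    set V := ((n : ℝ) / ε) ^ 2 * Real.log ((n : ℝ) / ε)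
    have hV : 0 ≤ V := by
      have : (0 : ℝ) ≤ ((n * (n * k * k * 64) * 1600 : ℕ) : ℝ) := Nat.cast_nonneg _
      linarith
    rw [Nat.cast_mul]
    calc (SFO.stepCost : ℝ) * ((n * (n * k * k * 64) * 1600 : ℕ) : ℝ)
        ≤ SFO.stepCost * (819200 * V) := by gcongr
      _ = 819200 * SFO.stepCost * V := by ring
      _ ≤ _ := by
        gcongr
        push_cast
        have : (0 : ℝ) ≤ 20 * 2 ^ SFO.stepCost := by positivity
        linarith
  · have e : ENNReal.ofReal (3 / 4) = 3 / 4 := by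
      rw [ENNReal.ofReal_div_of_pos (by norm_num)]
      norm_num
    have hp := h.prob
    rwa [e] at hp
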